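/- **Setting.** Let $d\ge 1$, $r,s\ge 0$ be integers. A *dilation matrix* is a $d\times d$ integer matrix all of whose eigenvalues have modulus $>1$. Let $M_0,\dots,M_s$ be dilation matrices and let $b_0,\tilde b_0:\mathbb Z^d\to\mathbb C^{r\times r}$, $b_1,\dots,b_s,\tilde b_1,\dots,\tilde b_s:\mathbb Z^d\to\mathbb C^{1\times r}$ be finitely supported filters. For a finitely supported sequence put $\hat u(\xi)=\sum_{k}u(k)e^{-ik\cdot\xi}$, and for functions let $\hat f(\xi)=\int_{\mathbb R^d} f(x)e^{-ix\cdot\xi}\,dx$ (extended to $L_2(\mathbb R^d)$ by Plancherel). Write $A^*=\overline A^{\mathsf T}$ and $\langle f,g\rangle=\int f(x)g(x)^*dx$. *Operators.* For a matrix $M$ and a filter $a$, $[\mathcal S_{a,M}u](n)=|\det M|^{1/2}\sum_k u(k)a(n-Mk)$ and $[\mathcal T_{a,M}u](n)=|\det M|^{1/2}\sum_k u(k)a(k-Mn)^*$. For a sequence $v:\mathbb Z^d\to\mathbb C^{1\times r}$ put $v_{0,0}=v$, $v_{l,j}=\mathcal T_{b_l,M_l}v_{0,j-1}$; let $\mathcal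 W_Jv=(v_{1,1},\dots,v_{s,1},\dots,v_{1,J},\dots,v_{s,J},v_{0,J})$, $\mathcal W=\mathcal W_1$, and $\tilde{\mathcal V}(w_1,\dots,w_s,w_0)=\sum_{l=0}^s\mathcal S_{\tilde b_l,M_l}w_l$. The filter bank $\{b_l!M_l\}_{l=0}^s$ *has stability in* $l_2(\mathbb Z^d)$ if there are $C_1,C_2>0$ with $C_1\|v\|_{l_2}^2\le\|\mathcal W_Jv\|_{l_2}^2\le C_2\|v\|_{l_2}^2$ for all $J\ge1$ and all square-summable $v$; similarly for $\{\tilde b_l!M_l\}_{l=0}^s$. *Filter banks.* Let $\Omega_l=(M_l^{-\mathsf T}\mathbb Z^d)\cap[0,1)^d$. The pair $(\{b_l!M_l\},\{\tilde b_l!M_l\})$ is a *dual framelet filter bank* if $\sum_{l=0}^s\chi_{\Omega_l}(\omega)\,\hat b_l(\xi)^*\,\hat{\tilde b}_l(\xi+2\pi\omega)=\boldsymbol\delta(\omega)I_r$ for a.e. $\xi$ and all $\omega\in\bigcup_l\Omega_l$, where $\boldsymbol\delta(0)=1$ and $\boldsymbol\delta(x)=0$ for $x\neq0$. It is a *biorthogonal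 wavelet filter bank* if moreover $\tilde{\mathcal V}\mathcal W=\mathrm{Id}$ and $\mathcal W\tilde{\mathcal V}=\mathrm{Id}$ on all (not necessarily summable) sequences. *Generators.* A compactly supported $\phi\in(L_2(\mathbb R^d))^r$ is a *standard $M_0$-refinable vector function* associated to $b_0$ if there are a matrix norm, constants $C_0,C_b,\tau>0$ and a finitely supported $u:\mathbb Z^d\to\mathbb C^r$ such that $\log_2(\|\hat b_0(0)\|+C_0)\le\tau$, $\|\hat b_0(\xi)\hat u(\xi)-\hat u(M_0^{\mathsf T}\xi)\|\le C_b\|\xi\|^\tau$ on $[-\pi,\pi]^d$, and $\hat\phi(\xi)=\lim_{n\to\infty}\hat b_0(M_0^{-\mathsf T}\xi)\cdots\hat b_0((M_0^{-\mathsf T})^n\xi)\,\hat u((M_0^{-\mathsf T})^n\xi)$ for all $\xi$. Let $\psi^0,\tilde\psi^0\in(L_2(\mathbb R^d))^r$ be compactly supported standard $M_0$-refinable vector functions associated to $b_0,\tilde b_0$, with $\hat\psi^0(M_0^{\mathsf T}\xi)=\hat b_0(\xi)\hat\psi^0(\xi)$, $\hat{\tilde\psi}{}^0(M_0^{\mathsf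 T}\xi)=\hat{\tilde b}_0(\xi)\hat{\tilde\psi}{}^0(\xi)$ and $\hat\psi^0(0)^*\hat{\tilde\psi}{}^0(0)=1$. Define $\psi^l,\tilde\psi^l\in L_2(\mathbb R^d)$, $l=1,\dots,s$, by $\hat\psi^l(\xi)=\hat b_l(M_0^{-\mathsf T}\xi)\hat\psi^0(M_0^{-\mathsf T}\xi)$ and $\hat{\tilde\psi}{}^l(\xi)=\hat{\tilde b}_l(M_0^{-\mathsf T}\xi)\hat{\tilde\psi}{}^0(M_0^{-\mathsf T}\xi)$. *Wavelets.* With $f_{U;y}(x)=|\det U|^{1/2}f(Ux-y)$, the affine system $\mathsf{AS}(\{\psi^l!M_l\}_{l=0}^s)$ is the family of the functions $\psi^0_q(\cdot-k)$ ($1\le q\le r$, $k\in\mathbb Z^d$) and $|\det(M_0^{-1}M_l)|^{1/2}\,\psi^l_{M_0^j;\,M_0^{-1}M_lk}$ ($1\le l\le s$, $j\ge0$, $k\in\mathbb Z^d$). The pair $(\{\psi^l!M_l\},\{\tilde\psi^l!M_l\})$ is a *biorthogonal wavelet in $L_2(\mathbb R^d)$ with mixed dilation factors* if both affine systems are Riesz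 bases of $L_2(\mathbb R^d)$ and they are biorthogonal to each other (the inner product of two members is $1$ if their indices agree and $0$ otherwise). **Theorem.** $(\{\psi^l!M_l\}_{l=0}^s,\{\tilde\psi^l!M_l\}_{l=0}^s)$ is a biorthogonal wavelet in $L_2(\mathbb R^d)$ with mixed dilation factors if the following three conditions hold: 1. $(\{b_l!M_l\}_{l=0}^s,\{\tilde b_l!M_l\}_{l=0}^s)$ is a biorthogonal wavelet filter bank; 2. both $\{b_l!M_l\}_{l=0}^s$ and $\{\tilde b_l!M_l\}_{l=0}^s$ have stability in $l_2(\mathbb Z^d)$; 3. $\langle\tilde\psi^0,\psi^0(\cdot-k)\rangle=\boldsymbol\delta(k)I_r$ for all $k\in\mathbb Z^d$. Conversely, if $(\{\psi^l!M_l\}_{l=0}^s,\{\tilde\psi^l!M_l\}_{l=0}^s)$ is a biorthogonal wavelet in $L_2(\mathbb R^d)$ and there is $C'>0$ such that, for a.e. $\xi\in\mathbb R^d$, both $$\sum_{k\in\mathbb Z^d}\hat\psi^0(\xi+2\pi k)\hat\psi^0(\xi+2\pi k)^*-C'I_r\quad\text{and}\quad\sum_{k\in\mathbb Z^d}\hat{\tilde\psi}{}^0(\xi+2\pi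 k)\hat{\tilde\psi}{}^0(\xi+2\pi k)^*-C'I_r$$ are positive semidefinite, then conditions 1–3 hold. -/

import Mathlib

open MeasureTheory Filter Topology FourierTransform
open scoped ENNReal NNReal Matrix ComplexConjugate Real ComplexOrder

noncomputable section

namespace MixedWavelet

/-! ## Lattice, filters and sequences -/

/-- The lattice `ℤ^d`. -/
abbrev ZLat (d : ℕ) := Fin d → ℤ

/-- Euclidean space `ℝ^d`. -/
abbrev Euc (d : ℕ) := EuclideanSpace ℝ (Fin d)

/-- All sequences `ℤ^d → ℂ^{m × n}`. -/
abbrev MSeq (d m n : ℕ) := ZLat d → Matrix (Fin m) (Fin n) ℂ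

/-- Finitely supported matrix filters `ℤ^d → ℂ^{m × n}`. -/
abbrev MFilter (d m n : ℕ) := ZLat d →₀ Matrix (Fin m) (Fin n) ℂ

/-- A lattice point viewed in `ℝ^d`. -/
def latVec {d : ℕ} (k : ZLat d) : Euc d := WithLp.toLp 2 (fun i => (k i : ℝ))

/-- An integer matrix viewed as a real matrix. -/
def realMat {d : ℕ} (M : Matrix (Fin d) (Fin d) ℤ) : Matrix (Fin d) (Fin d) ℝ :=
  M.map (fun z : ℤ => (z : ℝ))

/-- The action of a real matrix on `ℝ^d`. -/
def act {d : ℕ} (A : Matrix (Fin d) (Fin d) ℝ) (x : Euc d) : Euc d :=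
  WithLp.toLp 2 (A *ᵥ x.ofLp)

/-- A dilation matrix: an integer matrix all of whose (complex) eigenvalues have modulus `> 1`. -/
def IsDilation {d : ℕ} (M : Matrix (Fin d) (Fin d) ℤ) : Prop :=
  ∀ μ ∈ spectrum ℂ (M.map (fun z : ℤ => (z : ℂ))), 1 < ‖μ‖

/-- The scalar `|det M|^{1/2}`. -/
def sqrtAbsDet {d : ℕ} (A : Matrix (Fin d) (Fin d) ℝ) : ℝ := Real.sqrt |A.det|

/-- The `2π`-periodic Fourier series `∑ₖ u(k) e^{-i k·ξ}` of a finitely supported sequence. -/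
def fourierSeries {d : ℕ} {V : Type*} [AddCommGroup V] [Module ℂ V] (u : ZLat d →₀ V)
    (ξ : Euc d) : V :=
  u.sum fun k a => Complex.exp (-Complex.I * ((∑ i, (k i : ℝ) * ξ i : ℝ) : ℂ)) • a

/-- The subdivision operator `[S_{a,M} u](n) = |det M|^{1/2} ∑ₖ u(k) a(n - M k)`. -/
def subdivision {d p m n : ℕ} (a : MFilter d m n) (M : Matrix (Fin d) (Fin d) ℤ)
    (u : MSeq d p m) : MSeq d p n :=
  fun x => (sqrtAbsDet (realMat M) : ℂ) • ∑ᶠ k : ZLat d, u k * a (x - M *ᵥ k)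

/-- The transition operator `[T_{b,M} u](n) = |det M|^{1/2} ∑ₖ u(k) b(k - M n)^*`. -/
def transition {d p m n : ℕ} (b : MFilter d m n) (M : Matrix (Fin d) (Fin d) ℤ)
    (u : MSeq d p n) : MSeq d p m :=
  fun x => (sqrtAbsDet (realMat M) : ℂ) • ∑ᶠ k : ZLat d, u k * (b (k - M *ᵥ x))ᴴ

/-- The squared `l₂` norm of a matrix-valued sequence (possibly infinite). -/
def l2sq {d m n : ℕ} (v : MSeq d m n) : ℝ≥0∞ := ∑' k, ∑ p, ∑ q, ‖v k p q‖ₑ ^ 2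

/-! ## Filter banks with mixed dilation factors -/

/-- The filters `b₀` (`r × r`) and `b₁, …, bₛ` (`1 × r`); `high l` is `b_{l+1}`. -/
structure FilterBank (d r s : ℕ) where
  low : MFilter d r r
  high : Fin s → MFilter d 1 r

/-- Dilation matrices `M₀, …, Mₛ`; the matrix attached to `high l` is `M l.succ`. -/
abbrev Dilations (d s : ℕ) := Fin (s + 1) → Matrix (Fin d) (Fin d) ℤ

variable {d r s : ℕ}

/-- The low-pass coefficients: `v_{0,0} = v` and `v_{0,j+1} = T_{b₀,M₀} v_{0,j}`. -/
def lowCoeff (M : Dilations d s) (B : FilterBank d r s) (v : MSeq d 1 r) : ℕ → MSeq d 1 r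
  | 0 => v
  | j + 1 => transition B.low (M 0) (lowCoeff M B v j)

/-- The `J`-level discrete analysis operator `W_J`: the first component at `(j, l)` is
`v_{l+1,j+1} = T_{b_{l+1},M_{l+1}} v_{0,j}`, the second component is `v_{0,J}`. -/
def analysisJ (M : Dilations d s) (B : FilterBank d r s) (J : ℕ) (v : MSeq d 1 r) :
    (Fin J → Fin s → MSeq d 1 1) × MSeq d 1 r :=
  (fun j l => transition (B.high l) (M l.succ) (lowCoeff M B v j), lowCoeff M B v J)

/-- The one-level analysis operator `W`. -/
def analysis (M : Dilations d s) (B : FilterBank d r s) (v : MSeq d 1 r) :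
    (Fin s → MSeq d 1 1) × MSeq d 1 r :=
  (fun l => transition (B.high l) (M l.succ) v, transition B.low (M 0) v)

/-- The one-level synthesis operator `V`. -/
def synthesis (M : Dilations d s) (B : FilterBank d r s)
    (w : (Fin s → MSeq d 1 1) × MSeq d 1 r) : MSeq d 1 r :=
  subdivision B.low (M 0) w.2 + ∑ l, subdivision (B.high l) (M l.succ) (w.1 l)

/-- Stability of a filter bank in `l₂(ℤ^d)`: two-sided bounds for `W_J`, uniform in `J ≥ 1`. -/
def HasStability (M : Dilations d s) (B : FilterBank d r s) : Prop :=
  ∃ C₁ C₂ : ℝ≥0, 0 < C₁ ∧ 0 < C₂ ∧ ∀ J : ℕ, 1 ≤ J → ∀ v : MSeq d 1 r, l2sq v < ∞ →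
    C₁ * l2sq v ≤
        (∑ j, ∑ l, l2sq ((analysisJ M B J v).1 j l)) + l2sq (analysisJ M B J v).2 ∧
      (∑ j, ∑ l, l2sq ((analysisJ M B J v).1 j l)) + l2sq (analysisJ M B J v).2
        ≤ C₂ * l2sq v

/-- `Ω_M = (M^{-T} ℤ^d) ∩ [0,1)^d`. -/
def Omega (M : Matrix (Fin d) (Fin d) ℤ) : Set (Euc d) :=
  {ω | (∃ k : ZLat d, ω = act ((realMat M)ᵀ⁻¹) (latVec k)) ∧ ∀ i, 0 ≤ ω i ∧ ω i < 1}

/-- `(b, b̃)` is a dual framelet filter bank with mixed dilation factors: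
`∑ₗ χ_{Ωₗ}(ω) b̂ₗ(ξ)^* b̃̂ₗ(ξ + 2πω) = δ(ω) I_r` for a.e. `ξ` and all `ω ∈ ⋃ₗ Ωₗ`. -/
def IsDualFrameletFilterBank (M : Dilations d s) (B B' : FilterBank d r s) : Prop :=
  ∀ ω ∈ ⋃ l, Omega (M l), ∀ᵐ ξ : Euc d,
    (Omega (M 0)).indicator (fun _ => (1 : ℂ)) ω •
        ((fourierSeries B.low ξ)ᴴ * fourierSeries B'.low (ξ + (2 * π) • ω)) +
      ∑ l : Fin s, (Omega (M l.succ)).indicator (fun _ => (1 : ℂ)) ω •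
        ((fourierSeries (B.high l) ξ)ᴴ * fourierSeries (B'.high l) (ξ + (2 * π) • ω)) =
      ({0} : Set (Euc d)).indicator (fun _ => (1 : Matrix (Fin r) (Fin r) ℂ)) ω

/-- `(b, b̃)` is a biorthogonal wavelet filter bank with mixed dilation factors: a dual framelet
filter bank for which `W` and `Ṽ` are inverse to each other on all sequences. -/
def IsBiorthogonalWaveletFilterBank (M : Dilations d s) (B B' : FilterBank d r s) : Prop :=
  IsDualFrameletFilterBank M B B' ∧
    (∀ v, synthesis M B' (analysis M B v) = v) ∧
    (∀ w, analysis M B (synthesis M B' w) = w)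

/-! ## Functions on `ℝ^d` -/

/-- The vector of Fourier transforms `f̂(ξ) = ∫ f(x) e^{-i x·ξ} dx`, as an integral
(used for compactly supported `L₂`, hence integrable, functions). -/
def ftVec (f : Fin r → Euc d → ℂ) (ξ : Euc d) : Fin r → ℂ :=
  fun q => ∫ x : Euc d, Complex.exp (-Complex.I * ((∑ i, x i * ξ i : ℝ) : ℂ)) * f q x

/-- The Plancherel extension to `L₂(ℝ^d)` of `f̂(ξ) = ∫ f(x) e^{-i x·ξ} dx`
(Mathlib's transform uses the kernel `e^{-2πi x·ξ}`, whence the rescaling). -/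
def ftL2 (f : Lp (α := Euc d) ℂ 2 volume) (ξ : Euc d) : ℂ :=
  (𝓕 f : Lp (α := Euc d) ℂ 2 volume) ((2 * π)⁻¹ • ξ)

/-- Compact support of a measurable function (up to a null set). -/
def EssCompactSupport (f : Euc d → ℂ) : Prop :=
  ∃ K : Set (Euc d), IsCompact K ∧ ∀ᵐ x : Euc d, x ∉ K → f x = 0

/-- `φ` is a compactly supported standard `M₀`-refinable vector function in `(L₂(ℝ^d))^r`
associated to `b₀`: for some matrix norm, `C₀, C_b, τ > 0` and finitely supported `u`,
`log₂(‖b̂₀(0)‖ + C₀) ≤ τ` and `‖b̂₀(ξ) û(ξ) - û(M₀ᵀ ξ)‖ ≤ C_b ‖ξ‖^τ` on `[-π,π]^d`, and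
`φ̂(ξ) = limₙ b̂₀(M₀^{-T} ξ) ⋯ b̂₀((M₀^{-T})ⁿ ξ) û((M₀^{-T})ⁿ ξ)` for all `ξ`. -/
def IsStandardRefinable (M₀ : Matrix (Fin d) (Fin d) ℤ) (b₀ : MFilter d r r)
    (φ : Fin r → Euc d → ℂ) : Prop :=
  (∀ q, MemLp (φ q) 2 volume) ∧ (∀ q, EssCompactSupport (φ q)) ∧
  ∃ (N : AlgebraNorm ℂ (Matrix (Fin r) (Fin r) ℂ)) (C₀ Cb τ : ℝ) (u : ZLat d →₀ (Fin r → ℂ)),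
    0 < C₀ ∧ 0 < Cb ∧ 0 < τ ∧
    Real.logb 2 (N (fourierSeries b₀ 0) + C₀) ≤ τ ∧
    (∀ ξ : Euc d, (∀ i, ξ i ∈ Set.Icc (-π) π) →
      ‖fourierSeries b₀ ξ *ᵥ fourierSeries u ξ - fourierSeries u (act (realMat M₀)ᵀ ξ)‖
        ≤ Cb * ‖ξ‖ ^ τ) ∧
    ∀ ξ : Euc d, Tendsto
      (fun n : ℕ =>
        ((List.range n).map
          (fun j => fourierSeries b₀ (act ((realMat M₀)ᵀ⁻¹ ^ (j + 1)) ξ))).prod *ᵥ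
            fourierSeries u (act ((realMat M₀)ᵀ⁻¹ ^ n) ξ))
      atTop (𝓝 (ftVec φ ξ))

/-- The dilate and translate `f_{U;y}(x) = |det U|^{1/2} f(U x - y)`. -/
def dilate (U : Matrix (Fin d) (Fin d) ℝ) (y : Euc d) (f : Euc d → ℂ) : Euc d → ℂ :=
  fun x => (sqrtAbsDet U : ℂ) * f (act U x - y)

/-- The affine system `AS({ψˡ!Mₗ})`: the functions `ψ⁰_q(· - k)` and
`|det(M₀⁻¹ Mₗ)|^{1/2} ψˡ_{M₀ʲ; M₀⁻¹ Mₗ k}`. -/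
def affineSystem (M : Dilations d s) (ψ₀ : Fin r → Euc d → ℂ) (ψ : Fin s → Euc d → ℂ) :
    (Fin r × ZLat d) ⊕ (Fin s × ℕ × ZLat d) → Euc d → ℂ
  | .inl (q, k) => fun x => ψ₀ q (x - latVec k)
  | .inr (l, j, k) => fun x =>
      (sqrtAbsDet ((realMat (M 0))⁻¹ * realMat (M l.succ)) : ℂ) *
        dilate (realMat (M 0) ^ j)
          (act ((realMat (M 0))⁻¹ * realMat (M l.succ)) (latVec k)) (ψ l) x

/-- Riesz bases of a complex Hilbert space. -/
def IsRieszBasis {ι H : Type*} [NormedAddCommGroup H] [InnerProductSpace ℂ H]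
    (u : ι → H) : Prop :=
  (Submodule.span ℂ (Set.range u)).topologicalClosure = ⊤ ∧
  ∃ A B : ℝ, 0 < A ∧ 0 < B ∧ ∀ c : ι →₀ ℂ,
    A * (c.sum fun _ a => ‖a‖ ^ 2) ≤ ‖c.sum fun i a => a • u i‖ ^ 2 ∧
      ‖c.sum fun i a => a • u i‖ ^ 2 ≤ B * (c.sum fun _ a => ‖a‖ ^ 2)

open Classical in
/-- A pair of biorthogonal (Riesz) bases of a Hilbert space. -/
def AreBiorthogonalBases {ι H : Type*} [NormedAddCommGroup H] [InnerProductSpace ℂ H]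
    (u u' : ι → H) : Prop :=
  IsRieszBasis u ∧ IsRieszBasis u' ∧
    ∀ i j, inner ℂ (u i) (u' j) = if i = j then (1 : ℂ) else 0

/-- `({ψˡ!Mₗ}, {ψ̃ˡ!Mₗ})` is a biorthogonal wavelet in `L₂(ℝ^d)` with mixed dilation factors. -/
def IsBiorthogonalWavelet (M : Dilations d s)
    (ψ₀ : Fin r → Euc d → ℂ) (ψ : Fin s → Euc d → ℂ)
    (ψ₀' : Fin r → Euc d → ℂ) (ψ' : Fin s → Euc d → ℂ) : Prop :=
  ∃ (h : ∀ i, MemLp (affineSystem M ψ₀ ψ i) 2 volume)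
    (h' : ∀ i, MemLp (affineSystem M ψ₀' ψ' i) 2 volume),
    AreBiorthogonalBases (fun i => (h i).toLp _) (fun i => (h' i).toLp _)

/-- The matrix `⟨f, g⟩ = ∫ f(x) g(x)^* dx` of two vector functions. -/
def innerMat (f g : Fin r → Euc d → ℂ) : Matrix (Fin r) (Fin r) ℂ :=
  Matrix.of fun p q => ∫ x : Euc d, f p x * conj (g q x)

/-- The bracket product `[F, G](ξ) = ∑ₖ F(ξ + 2πk) G(ξ + 2πk)^*` of column vector functions. -/
def bracket (F G : Euc d → Fin r → ℂ) (ξ : Euc d) : Matrix (Fin r) (Fin r) ℂ :=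
  ∑' k : ZLat d,
    Matrix.vecMulVec (F (ξ + (2 * π) • latVec k)) (star (G (ξ + (2 * π) • latVec k)))

/-- `[φ̂, φ̂](ξ) ≥ C I_r` for a.e. `ξ`. -/
def BracketLowerBound (φ : Fin r → Euc d → ℂ) (C : ℝ) : Prop :=
  ∀ᵐ ξ : Euc d,
    (bracket (ftVec φ) (ftVec φ) ξ - (C : ℂ) • (1 : Matrix (Fin r) (Fin r) ℂ)).PosSemidef

/-- `ψ¹, …, ψˢ ∈ L₂(ℝ^d)` are the functions with
`ψ̂ˡ(ξ) = b̂ₗ(M₀^{-T} ξ) ψ̂⁰(M₀^{-T} ξ)` for a.e. `ξ`. -/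
def AreGeneratedBy (M₀ : Matrix (Fin d) (Fin d) ℤ) (b : Fin s → MFilter d 1 r)
    (ψ₀ : Fin r → Euc d → ℂ) (ψ : Fin s → Euc d → ℂ) : Prop :=
  ∀ l, ∃ h : MemLp (ψ l) 2 volume, ∀ᵐ ξ : Euc d,
    ftL2 (h.toLp (ψ l)) ξ =
      (fourierSeries (b l) (act (realMat M₀)ᵀ⁻¹ ξ) *ᵥ ftVec ψ₀ (act (realMat M₀)ᵀ⁻¹ ξ)) 0

end MixedWavelet

end

open MixedWavelet

/-!
The refinement and generation equations say, in the time domain, that each generator is the image,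
under the unitary dilation `D` by `M₀`, of a finite linear combination of the integer translates
of `ψ₀`; the coefficients are rows `b i` of the analysis operator `W` (`two_scale_of_ftL2`,
`toLp_eq_dilOp_lc`, `twoScale_shifts`). The dilation matrix `Mₗ` only enters through the index
`k - Mₗ x` of the coefficients, so after this step the theorem is a statement about a Hilbert space
`H`, an isometry `D`, families `e`, `e'` (the translates of `ψ₀`, `ψ₀'`), and coefficient sequences
`b`, `b'` with `e k = D (∑ b (inr k) m • e m)`, `w l = D (∑ b (inl l) m • e m)` (`TwoScale`).
Analysis of the coefficients `⟨f, D^(J+1) e⟩` with `b` gives the inner products of `f` with level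
`J` of the system, and iterating gives `W_J` (`TwoScale.energy_coef_eq`).

From filter banks to bases (`areBiorthogonalBases_system`): `W Ṽ = Id` and the biorthogonality of
`e`, `e'` yield the biorthogonality of the systems. If `f` is a finite combination of the dual
system, then its coefficient vector is `W_J v` where `v` collects the inner products of `f` with
the `D^J e m`, for `J` large; stability compares it with `v`, and the Bessel bounds of `e`, `e'`
compare `v` with `f`. By `Ṽ W = Id` the closed span of the system contains every `D^J e m`, so
completeness reduces to the density of these functions. That is
`eq_zero_of_inner_dilOp_shifts_eq_zero`: by `ψ̂₀(0)^* ψ̂₀'(0) = 1` and Riemann sums, the finite sums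
of `⟨f, D^J e' m⟩ ⟨D^J e m, f⟩` converge to `‖f‖²` for continuous compactly supported `f`
(`exists_norm_sq_sub_sum_le`), hence such an `f` satisfies `‖f‖ ≤ C ‖f - g‖` whenever `g` is
orthogonal to all `D^J e m`, and letting `f → g` gives `g = 0`.

From bases to filter banks (`bank_of_areBiorthogonalBases`): the level-zero inner products are the
entries of `W Ṽ`; expanding `D (e' n)` in the basis gives `Ṽ W = Id`; and every square-summable `v`
is the level-`J` coefficient sequence of some `f`, so that the frame bounds of the basis bound
`W_J v`. Finally `Ṽ W = Id` gives the dual framelet identities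
(`isDualFrameletFilterBank_of_synAna`): expand the indicator of `M ℤ^d` in the characters
`e^{2πi k·ω}`, `ω ∈ Ω_M` (`exists_Omega_finset`), and use the linear independence of characters.
-/

namespace MixedWavelet

noncomputable section

/-! ### Bessel families and Riesz bases -/

/-- The squared `ℓ²` norm of a scalar family, with values in `[0, ∞]`. -/
def nsq {α : Type*} (v : α → ℂ) : ℝ≥0∞ := ∑' i, ‖v i‖ₑ ^ 2

/-- The linear combination `∑ₘ c(m) e(m)` of a family of vectors. -/
abbrev lc {K H : Type*} [AddCommGroup H] [Module ℂ H] (e : K → H) (c : K →₀ ℂ) : H :=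
  Finsupp.linearCombination ℂ e c

/-- The family `e` is a Bessel sequence with bound `B`, in the form of an upper bound for the
synthesis operator. -/
def IsBessel {K H : Type*} [NormedAddCommGroup H] [InnerProductSpace ℂ H] (e : K → H)
    (B : ℝ≥0) : Prop :=
  ∀ c : K →₀ ℂ, ‖lc e c‖ₑ ^ 2 ≤ B * nsq c

lemma enorm_sq_eq_ofReal {E : Type*} [SeminormedAddCommGroup E] (x : E) :
    ‖x‖ₑ ^ 2 = ENNReal.ofReal (‖x‖ ^ 2) := by
  rw [ENNReal.ofReal_pow (norm_nonneg _), ofReal_norm]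

lemma nsq_finsupp {α : Type*} (c : α →₀ ℂ) :
    nsq c = ENNReal.ofReal (c.sum fun _ a => ‖a‖ ^ 2) := by
  rw [nsq, tsum_eq_sum (s := c.support), Finsupp.sum, ENNReal.ofReal_sum_of_nonneg]
  · simp only [enorm_sq_eq_ofReal]
  · intro i _; positivity
  · intro i hi
    simp [Finsupp.notMem_support_iff.mp hi]

section Abstract

variable {ι K L H : Type*} [NormedAddCommGroup H] [InnerProductSpace ℂ H]

lemma inner_lc_left (e : K → H) (c : K →₀ ℂ) (f : H) :
    inner ℂ (lc e c) f = c.sum fun m a => conj a * inner ℂ (e m) f := by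
  simp [lc, Finsupp.linearCombination_apply, Finsupp.sum_inner]

lemma inner_lc_right (e : K → H) (c : K →₀ ℂ) (f : H) :
    inner ℂ f (lc e c) = c.sum fun m a => a * inner ℂ f (e m) := by
  simp [lc, Finsupp.linearCombination_apply, Finsupp.inner_sum]

open Classical in
/-- The two families are biorthogonal to each other. -/
def Biorth (e e' : K → H) : Prop :=
  ∀ i j, inner ℂ (e i) (e' j) = if i = j then (1 : ℂ) else 0

lemma Biorth.symm {e e' : K → H} (h : Biorth e e') : Biorth e' e := by
  intro i j
  rw [← inner_conj_symm, h j i]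
  by_cases hij : i = j
  · rw [if_pos hij, if_pos hij.symm, map_one]
  · rw [if_neg hij, if_neg (Ne.symm hij), map_zero]

lemma Biorth.inner_lc {e e' : K → H} (h : Biorth e e') (c : K →₀ ℂ) (i : K) :
    inner ℂ (e i) (lc e' c) = c i := by
  classical
  rw [inner_lc_right, Finsupp.sum, Finset.sum_eq_single i]
  · simp [h i i]
  · intro j _ hj
    simp [h i j, hj.symm]
  · intro hi
    simp [Finsupp.notMem_support_iff.mp hi]

lemma Biorth.isometry {e e' : K → H} (h : Biorth e e') (D : H →ₗᵢ[ℂ] H) :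
    Biorth (fun k => D (e k)) (fun k => D (e' k)) := by
  intro i j
  rw [D.inner_map_map, h]

lemma IsBessel.isometry {e : K → H} {B : ℝ≥0} (h : IsBessel e B) (D : H →ₗᵢ[ℂ] H) :
    IsBessel (fun k => D (e k)) B := by
  intro c
  have : lc (fun k => D (e k)) c = D (lc e c) := by
    simp [lc, Finsupp.linearCombination_apply, Finsupp.sum, map_sum]
  rw [this, D.enorm_map]
  exact h c

lemma IsBessel.nsq_inner_le {e : K → H} {B : ℝ≥0} (h : IsBessel e B) (f : H) :
    nsq (fun m => inner ℂ (e m) f) ≤ B * ‖f‖ₑ ^ 2 := by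
  classical
  refine ENNReal.summable.tsum_le_of_sum_le fun F => ?_
  set c : K →₀ ℂ := Finsupp.onFinset F (fun m => if m ∈ F then inner ℂ (e m) f else 0)
    (by intro m hm; by_contra h0; simp [h0] at hm) with hc
  have hcm : ∀ m ∈ F, c m = inner ℂ (e m) f := by
    intro m hm; simp [hc, hm]
  set S : ℝ := ∑ m ∈ F, ‖inner ℂ (e m) f‖ ^ 2 with hS
  have hS0 : 0 ≤ S := Finset.sum_nonneg fun _ _ => by positivity
  have hsup : c.support ⊆ F := Finsupp.support_onFinset_subset
  have h1 : c.sum (fun _ a => ‖a‖ ^ 2) = S := by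
    rw [Finsupp.sum_of_support_subset _ hsup _ (by simp)]
    exact Finset.sum_congr rfl fun m hm => by rw [hcm m hm]
  have h2 : inner ℂ (lc e c) f = (S : ℂ) := by
    rw [inner_lc_left, Finsupp.sum_of_support_subset _ hsup _ (by simp), hS]
    push_cast
    refine Finset.sum_congr rfl fun m hm => ?_
    rw [hcm m hm, Complex.conj_mul']
  have h3 := h c
  rw [nsq_finsupp, h1, enorm_sq_eq_ofReal, ← ENNReal.ofReal_coe_nnreal,
    ← ENNReal.ofReal_mul (NNReal.coe_nonneg B), ENNReal.ofReal_le_ofReal_iff (by positivity)] at h3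
  have h4 : S ≤ ‖lc e c‖ * ‖f‖ := by
    have := norm_inner_le_norm (𝕜 := ℂ) (lc e c) f
    rwa [h2, Complex.norm_real, Real.norm_of_nonneg hS0] at this
  have h5 : S ≤ B * ‖f‖ ^ 2 := by
    rcases hS0.eq_or_lt with h0 | h0
    · rw [← h0]; positivity
    have : S * S ≤ (B * ‖f‖ ^ 2) * S := by
      calc S * S ≤ (‖lc e c‖ * ‖f‖) * (‖lc e c‖ * ‖f‖) := by gcongr
        _ = ‖lc e c‖ ^ 2 * ‖f‖ ^ 2 := by ring
        _ ≤ (B * S) * ‖f‖ ^ 2 := by gcongr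
        _ = _ := by ring
    exact le_of_mul_le_mul_right this h0
  calc ∑ m ∈ F, ‖inner ℂ (e m) f‖ₑ ^ 2 = ENNReal.ofReal S := by
        rw [hS, ENNReal.ofReal_sum_of_nonneg (fun _ _ => by positivity)]
        simp only [enorm_sq_eq_ofReal]
    _ ≤ ENNReal.ofReal (B * ‖f‖ ^ 2) := ENNReal.ofReal_le_ofReal h5
    _ = B * ‖f‖ₑ ^ 2 := by
        rw [ENNReal.ofReal_mul (NNReal.coe_nonneg B), enorm_sq_eq_ofReal]; simp

/-- A Bessel sequence can be summed against square-summable coefficients. -/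
lemma IsBessel.exists_hasSum [CompleteSpace H] {e : K → H} {B : ℝ≥0} (h : IsBessel e B)
    {v : K → ℂ} (hv : nsq v < ∞) :
    ∃ f : H, HasSum (fun m => v m • e m) f ∧ ‖f‖ₑ ^ 2 ≤ B * nsq v := by
  classical
  have key : ∀ F : Finset K, ‖∑ m ∈ F, v m • e m‖ₑ ^ 2 ≤ B * ∑ m ∈ F, ‖v m‖ₑ ^ 2 := by
    intro F
    set c : K →₀ ℂ := Finsupp.onFinset F (fun m => if m ∈ F then v m else 0)
      (by intro m hm; by_contra h0; simp [h0] at hm) with hc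
    have hsup : c.support ⊆ F := Finsupp.support_onFinset_subset
    have hcm : ∀ m ∈ F, c m = v m := by
      intro m hm; simp [hc, hm]
    have h1 : lc e c = ∑ m ∈ F, v m • e m := by
      rw [lc, Finsupp.linearCombination_apply, Finsupp.sum_of_support_subset _ hsup _ (by simp)]
      exact Finset.sum_congr rfl fun m hm => by rw [hcm m hm]
    have h2 : nsq c = ∑ m ∈ F, ‖v m‖ₑ ^ 2 := by
      rw [nsq, tsum_eq_sum (s := F)]
      · exact Finset.sum_congr rfl fun m hm => by rw [hcm m hm]
      · intro m hm
        simp [hc, hm]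
    rw [← h1, ← h2]
    exact h c
  have hsum : Summable fun m => ‖v m‖ ^ 2 := by
    have h1 : ∑' m, ENNReal.ofReal (‖v m‖ ^ 2) ≠ ∞ := by
      simp only [← enorm_sq_eq_ofReal]
      exact hv.ne
    have h2 := ENNReal.summable_toReal h1
    refine h2.congr fun m => ?_
    rw [ENNReal.toReal_ofReal (by positivity)]
  have hS : Summable fun m => v m • e m := by
    rw [summable_iff_vanishing_norm] at hsum ⊢
    intro ε hε
    obtain ⟨s, hs⟩ := hsum (ε ^ 2 / (B + 1)) (by positivity)
    refine ⟨s, fun t ht => ?_⟩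
    have h1 := hs t ht
    rw [Real.norm_of_nonneg (Finset.sum_nonneg fun _ _ => by positivity)] at h1
    have h2 := key t
    simp only [enorm_sq_eq_ofReal] at h2
    rw [← ENNReal.ofReal_sum_of_nonneg (fun _ _ => by positivity), ← ENNReal.ofReal_coe_nnreal,
      ← ENNReal.ofReal_mul (NNReal.coe_nonneg B), ENNReal.ofReal_le_ofReal_iff (by positivity)] at h2
    have h3 : ‖∑ m ∈ t, v m • e m‖ ^ 2 < ε ^ 2 := by
      calc _ ≤ (B : ℝ) * ∑ m ∈ t, ‖v m‖ ^ 2 := h2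
        _ ≤ (B + 1 : ℝ) * ∑ m ∈ t, ‖v m‖ ^ 2 := by
            gcongr
            linarith
        _ < (B + 1 : ℝ) * (ε ^ 2 / (B + 1)) := by gcongr
        _ = ε ^ 2 := by field_simp
    exact lt_of_pow_lt_pow_left₀ 2 hε.le h3
  obtain ⟨f, hf⟩ := hS
  refine ⟨f, hf, ?_⟩
  have h1 : Tendsto (fun F : Finset K => ‖∑ m ∈ F, v m • e m‖ₑ ^ 2) atTop (𝓝 (‖f‖ₑ ^ 2)) :=
    ((ENNReal.continuous_pow 2).tendsto _).comp ((continuous_enorm.tendsto f).comp hf)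
  refine le_of_tendsto h1 (Eventually.of_forall fun F => (key F).trans ?_)
  gcongr
  exact ENNReal.sum_le_tsum F

/-- A complete family `u` and a Bessel sequence `u'` biorthogonal to it: `u` has a lower frame
bound. -/
lemma Biorth.enorm_sq_le [CompleteSpace H] {u u' : ι → H} (hb : Biorth u u') {B : ℝ≥0}
    (hB : IsBessel u' B) (hd : (Submodule.span ℂ (Set.range u)).topologicalClosure = ⊤) (f : H) :
    ‖f‖ₑ ^ 2 ≤ B * nsq (fun i => inner ℂ (u i) f) := by
  classical
  rcases eq_or_ne B 0 with h0 | h0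
  · -- for `B = 0` the family `u'` vanishes, which contradicts biorthogonality unless it is empty
    have hB0 : B = 0 := h0
    have hz : ∀ i, u' i = 0 := by
      intro i
      have := hB (Finsupp.single i 1)
      simpa [hB0, lc] using this
    have hemp : IsEmpty ι := ⟨fun i => by simpa [hz i] using hb i i⟩
    have : f ∈ (Submodule.span ℂ (Set.range u)).topologicalClosure := by rw [hd]; trivial
    have hf : f = 0 := by simpa [Set.range_eq_empty] using this
    simp [hf]
  by_cases hv : nsq (fun i => inner ℂ (u i) f) < ∞
  · obtain ⟨g, hg, hle⟩ := hB.exists_hasSum hv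
    have hin : ∀ i, inner ℂ (u i) (f - g) = 0 := by
      intro i
      have h1 : HasSum (fun j => inner ℂ (u i) (inner ℂ (u j) f • u' j)) (inner ℂ (u i) g) :=
        hg.mapL (innerSL ℂ (u i))
      have h2 := h1.unique (hasSum_single i fun j hj => by
        rw [inner_smul_right, hb i j, if_neg hj.symm, mul_zero])
      rw [inner_sub_right, h2, inner_smul_right, hb i i]
      simp
    have hort : (Submodule.span ℂ (Set.range u))ᗮ = ⊥ :=
      Submodule.topologicalClosure_eq_top_iff.mp hd
    have hmem : f - g ∈ (Submodule.span ℂ (Set.range u))ᗮ := by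
      rw [Submodule.mem_orthogonal]
      intro x hx
      induction hx using Submodule.span_induction with
      | mem x hx => obtain ⟨i, rfl⟩ := hx; exact hin i
      | zero => simp
      | add x y _ _ h1 h2 => rw [inner_add_left, h1, h2, add_zero]
      | smul a x _ h1 => rw [inner_smul_left, h1, mul_zero]
    rw [hort, Submodule.mem_bot, sub_eq_zero] at hmem
    rw [hmem] at hle ⊢
    exact hle
  · rw [not_lt, top_le_iff] at hv
    rw [hv, ENNReal.mul_top (by simpa using h0)]
    exact le_top

lemma isRieszBasis_iff {u : ι → H} : IsRieszBasis u ↔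
    (Submodule.span ℂ (Set.range u)).topologicalClosure = ⊤ ∧
      ∃ A B : ℝ≥0, 0 < A ∧ 0 < B ∧ (∀ c : ι →₀ ℂ, nsq c ≤ A * ‖lc u c‖ₑ ^ 2) ∧ IsBessel u B := by
  have hconv : ∀ (A : ℝ≥0) (x y : ℝ), 0 ≤ x → 0 ≤ y →
      (ENNReal.ofReal x ≤ A * ENNReal.ofReal y ↔ x ≤ A * y) := by
    intro A x y _ hy
    rw [← ENNReal.ofReal_coe_nnreal, ← ENNReal.ofReal_mul (NNReal.coe_nonneg A),
      ENNReal.ofReal_le_ofReal_iff (by positivity)]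
  have hsum0 : ∀ c : ι →₀ ℂ, 0 ≤ c.sum fun _ a => ‖a‖ ^ 2 := fun c =>
    Finset.sum_nonneg fun _ _ => by positivity
  refine and_congr_right fun _ => ⟨?_, ?_⟩
  · rintro ⟨A, B, hA, hB, h⟩
    refine ⟨A⁻¹.toNNReal, B.toNNReal, by simpa using hA, by simpa using hB,
      fun c => ?_, fun c => ?_⟩
    · rw [nsq_finsupp, enorm_sq_eq_ofReal, hconv _ _ _ (hsum0 c) (by positivity)]
      have := (h c).1
      rw [← Finsupp.linearCombination_apply] at this
      rw [Real.coe_toNNReal _ (by positivity)]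
      rw [← div_eq_inv_mul, le_div_iff₀ hA, mul_comm]
      exact this
    · rw [nsq_finsupp, enorm_sq_eq_ofReal, hconv _ _ _ (by positivity) (hsum0 c),
        Real.coe_toNNReal _ hB.le]
      exact (h c).2
  · rintro ⟨A, B, hA, hB, h1, h2⟩
    refine ⟨A⁻¹, B, by positivity, hB, fun c => ⟨?_, ?_⟩⟩
    · have := h1 c
      rw [nsq_finsupp, enorm_sq_eq_ofReal, hconv _ _ _ (hsum0 c) (by positivity)] at this
      rw [inv_mul_le_iff₀ (by exact_mod_cast hA), ← Finsupp.linearCombination_apply]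
      exact this
    · have := h2 c
      rw [nsq_finsupp, enorm_sq_eq_ofReal, hconv _ _ _ (by positivity) (hsum0 c)] at this
      exact this

lemma IsRieszBasis.comp_equiv {κ : Type*} {u : ι → H} (h : IsRieszBasis u) (σ : κ ≃ ι) :
    IsRieszBasis (u ∘ σ) := by
  obtain ⟨h1, A, B, hA, hB, h2⟩ := h
  refine ⟨by rwa [σ.surjective.range_comp], A, B, hA, hB, fun c => ?_⟩
  have := h2 (Finsupp.equivMapDomain σ c)
  rw [Finsupp.sum_equivMapDomain, Finsupp.sum_equivMapDomain] at this
  exact this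

lemma AreBiorthogonalBases.comp_equiv {κ : Type*} {u u' : ι → H} (h : AreBiorthogonalBases u u')
    (σ : κ ≃ ι) : AreBiorthogonalBases (u ∘ σ) (u' ∘ σ) := by
  refine ⟨h.1.comp_equiv σ, h.2.1.comp_equiv σ, fun i j => ?_⟩
  rw [Function.comp_apply, Function.comp_apply, h.2.2]
  by_cases hij : i = j
  · rw [if_pos hij, if_pos (congrArg σ hij)]
  · rw [if_neg hij, if_neg fun h' => hij (σ.injective h')]

end Abstract

/-! ### Abstract filter banks -/

section AbstractBank

variable {I K L H : Type*}

/-- The analysis operator with coefficient sequences `b i`: `v ↦ (∑ₘ conj (b i m) v(m))ᵢ`. -/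
def ana (b : I → K →₀ ℂ) (v : K → ℂ) : I → ℂ := fun i => (b i).sum fun m a => conj a * v m

/-- The synthesis operator with coefficient sequences `b i`: `w ↦ ∑ᵢ w(i) b i`. -/
def syn (b : I → K →₀ ℂ) (w : I → ℂ) : K → ℂ := fun m => ∑ᶠ i, w i * b i m

/-- Each index `m` is met by finitely many of the coefficient sequences `b i`. -/
def ColFinite (b : I → K →₀ ℂ) : Prop := ∀ m, {i | b i m ≠ 0}.Finite

open Classical in
/-- The matrix identity expressing that analysis with `b` inverts synthesis with `b'`. -/
def AnaSyn (b b' : I → K →₀ ℂ) : Prop :=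
  ∀ i j, ana b (b' j) i = if i = j then (1 : ℂ) else 0

open Classical in
/-- The matrix identity expressing that synthesis with `b'` inverts analysis with `b`. -/
def SynAna (b b' : I → K →₀ ℂ) : Prop :=
  ∀ n m, ∑ᶠ i, conj (b i n) * b' i m = if n = m then (1 : ℂ) else 0

lemma ana_eq_sum (b : I → K →₀ ℂ) (v : K → ℂ) (i : I) {F : Finset K} (hF : (b i).support ⊆ F) :
    ana b v i = ∑ m ∈ F, conj (b i m) * v m := by
  rw [ana, Finsupp.sum_of_support_subset _ hF _ (by simp)]

lemma syn_eq_sum (b : I → K →₀ ℂ) (w : I → ℂ) (m : K) {F : Finset I}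
    (hF : ∀ i, b i m ≠ 0 → i ∈ F) : syn b w m = ∑ i ∈ F, w i * b i m := by
  refine finsum_eq_finsetSum_of_support_subset _ fun i hi => hF i fun h0 => hi ?_
  simp [h0]

lemma AnaSyn.symm {b b' : I → K →₀ ℂ} (h : AnaSyn b b') : AnaSyn b' b := by
  classical
  intro i j
  have h1 := congrArg conj (h j i)
  rw [ana_eq_sum b _ _ (F := (b j).support ∪ (b' i).support) Finset.subset_union_left] at h1
  rw [ana_eq_sum b' _ _ (F := (b j).support ∪ (b' i).support) Finset.subset_union_right]
  have h2 : ∑ m ∈ (b j).support ∪ (b' i).support, conj (b' i m) * b j m =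
      conj (∑ m ∈ (b j).support ∪ (b' i).support, conj (b j m) * b' i m) := by
    rw [map_sum]
    exact Finset.sum_congr rfl fun m _ => by rw [map_mul, Complex.conj_conj, mul_comm]
  rw [h2, h1]
  by_cases hij : i = j
  · rw [if_pos hij, if_pos hij.symm, map_one]
  · rw [if_neg hij, if_neg (Ne.symm hij), map_zero]

lemma SynAna.symm {b b' : I → K →₀ ℂ} (hb : ColFinite b) (h : SynAna b b') : SynAna b' b := by
  classical
  intro n m
  have hs : ∀ (c c' : I → ℂ), (∀ i, c i ≠ 0 → b i m ≠ 0) →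
      ∑ᶠ i, c i = ∑ i ∈ (hb m).toFinset, c i := fun c _ hc =>
    finsum_eq_finsetSum_of_support_subset _ fun i hi => by simpa using hc i hi
  have h1 := congrArg conj (h m n)
  rw [hs _ (fun _ => 0) (by intro i hi h0; simp [h0] at hi), map_sum] at h1
  rw [hs _ (fun _ => 0) (by intro i hi h0; simp [h0] at hi)]
  have h2 : ∑ i ∈ (hb m).toFinset, conj (b' i n) * b i m =
      ∑ i ∈ (hb m).toFinset, conj (conj (b i m) * b' i n) :=
    Finset.sum_congr rfl fun i _ => by rw [map_mul, Complex.conj_conj, mul_comm]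
  rw [h2, h1]
  by_cases hij : n = m
  · rw [if_pos hij, if_pos hij.symm, map_one]
  · rw [if_neg hij, if_neg (Ne.symm hij), map_zero]

lemma anaSyn_iff {b b' : I → K →₀ ℂ} (hb' : ColFinite b') :
    AnaSyn b b' ↔ ∀ w, ana b (syn b' w) = w := by
  classical
  constructor
  · intro h w
    funext i
    set T : Finset I := insert i ((b i).support.biUnion fun m => (hb' m).toFinset) with hT
    have h1 : ∀ m ∈ (b i).support, syn b' w m = ∑ j ∈ T, w j * b' j m := fun m hm =>
      syn_eq_sum b' w m fun j hj => Finset.mem_insert_of_mem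
        (Finset.mem_biUnion.mpr ⟨m, hm, by simpa using hj⟩)
    rw [ana_eq_sum b _ i subset_rfl, Finset.sum_congr rfl fun m hm => by rw [h1 m hm]]
    simp_rw [Finset.mul_sum]
    rw [Finset.sum_comm]
    have h2 : ∀ j ∈ T, ∑ m ∈ (b i).support, conj (b i m) * (w j * b' j m) =
        w j * if i = j then 1 else 0 := by
      intro j _
      rw [← h i j, ana_eq_sum b _ i subset_rfl, Finset.mul_sum]
      exact Finset.sum_congr rfl fun m _ => by ring
    rw [Finset.sum_congr rfl h2]
    simp [hT]
  · intro h i j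
    have h1 := congrFun (h (Pi.single j 1)) i
    have h2 : syn b' (Pi.single j 1) = b' j := by
      funext m
      rw [syn, finsum_eq_single _ j]
      · simp
      · intro x hx
        simp [hx]
    rw [h2] at h1
    rw [h1, Pi.single_apply]

lemma synAna_iff {b b' : I → K →₀ ℂ} (hb' : ColFinite b') :
    SynAna b b' ↔ ∀ v, syn b' (ana b v) = v := by
  classical
  have hfin : ∀ n m, ∑ᶠ i, conj (b i n) * b' i m =
      ∑ i ∈ (hb' m).toFinset, conj (b i n) * b' i m := fun n m =>
    finsum_eq_finsetSum_of_support_subset _ fun i hi => by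
      simp only [Set.Finite.coe_toFinset, Set.mem_ofPred_eq]
      intro h0
      exact hi (by simp [h0])
  constructor
  · intro h v
    funext m
    set T := (hb' m).toFinset with hT
    set N : Finset K := insert m (T.biUnion fun i => (b i).support) with hN
    rw [syn_eq_sum b' _ m (F := T) (by simp [hT])]
    have h1 : ∀ i ∈ T, ana b v i = ∑ n ∈ N, conj (b i n) * v n := fun i hi =>
      ana_eq_sum b v i fun n hn => Finset.mem_insert_of_mem
        (Finset.mem_biUnion.mpr ⟨i, hi, hn⟩)
    rw [Finset.sum_congr rfl fun i hi => by rw [h1 i hi]]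
    simp_rw [Finset.sum_mul]
    rw [Finset.sum_comm]
    have h2 : ∀ n ∈ N, ∑ i ∈ T, conj (b i n) * v n * b' i m = v n * if n = m then 1 else 0 := by
      intro n _
      rw [← h n m, hfin, Finset.mul_sum]
      exact Finset.sum_congr rfl fun i _ => by ring
    rw [Finset.sum_congr rfl h2]
    simp [hN]
  · intro h n m
    have h1 := congrFun (h (Pi.single n 1)) m
    have h2 : ∀ i, ana b (Pi.single n 1) i = conj (b i n) := by
      intro i
      rw [ana_eq_sum b _ i (F := insert n (b i).support) (Finset.subset_insert _ _)]
      simp [Pi.single_apply]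
    rw [syn] at h1
    simp_rw [h2] at h1
    rw [h1, Pi.single_apply]
    simp only [eq_comm]

/-- The low-pass coefficients of `v` after `j` analysis steps with the low-pass part of `b`. -/
def lowIter (b : L ⊕ K → K →₀ ℂ) (v : K → ℂ) : ℕ → K → ℂ
  | 0 => v
  | j + 1 => fun k => ana b (lowIter b v j) (Sum.inr k)

/-- The squared norm of the `J`-level analysis of `v`. -/
def energy (b : L ⊕ K → K →₀ ℂ) (J : ℕ) (v : K → ℂ) : ℝ≥0∞ :=
  ∑ j ∈ Finset.range J, nsq (fun l => ana b (lowIter b v j) (Sum.inl l)) + nsq (lowIter b v J)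

/-- Two-sided bounds for the `J`-level analysis operators, uniform in `J ≥ 1`. -/
def BankStable (b : L ⊕ K → K →₀ ℂ) : Prop :=
  ∃ C₁ C₂ : ℝ≥0, 0 < C₁ ∧ 0 < C₂ ∧ ∀ J : ℕ, 1 ≤ J → ∀ v : K → ℂ, nsq v < ∞ →
    C₁ * nsq v ≤ energy b J v ∧ energy b J v ≤ C₂ * nsq v

end AbstractBank

/-! ### Multilevel systems in a Hilbert space -/

section System

variable {K L H : Type*} [NormedAddCommGroup H] [InnerProductSpace ℂ H]

/-- The generators `e` and `w` are obtained from the dilated family `D e` through the coefficient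
sequences `b`. -/
structure TwoScale (D : H →ₗᵢ[ℂ] H) (b : L ⊕ K → K →₀ ℂ) (e : K → H) (w : L → H) : Prop where
  low : ∀ k, e k = D (lc e (b (Sum.inr k)))
  high : ∀ l, w l = D (lc e (b (Sum.inl l)))

/-- The system consisting of `e` and of all dilates `Dʲ w`, `j ≥ 0`. -/
def system (D : H →ₗᵢ[ℂ] H) (e : K → H) (w : L → H) : K ⊕ (ℕ × L) → H
  | .inl k => e k
  | .inr (j, l) => (D ^ j) (w l)

/-- The coefficients `⟨f, Dᴶ e(m)⟩`. -/
def coef (D : H →ₗᵢ[ℂ] H) (e : K → H) (J : ℕ) (f : H) : K → ℂ :=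
  fun m => inner ℂ ((D ^ J) (e m)) f

variable {D : H →ₗᵢ[ℂ] H} {b b' : L ⊕ K → K →₀ ℂ} {e e' : K → H} {w w' : L → H}

lemma pow_succ_apply_isometry (D : H →ₗᵢ[ℂ] H) (J : ℕ) (x : H) :
    (D ^ (J + 1)) x = (D ^ J) (D x) := by
  rw [pow_succ]; rfl

lemma pow_add_apply_isometry (D : H →ₗᵢ[ℂ] H) (i j : ℕ) (x : H) :
    (D ^ (i + j)) x = (D ^ i) ((D ^ j) x) := by
  rw [pow_add]; rfl

lemma map_lc (D : H →ₗᵢ[ℂ] H) (e : K → H) (c : K →₀ ℂ) :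
    D (lc e c) = lc (fun k => D (e k)) c := by
  simp [lc, Finsupp.linearCombination_apply, Finsupp.sum, map_sum]

lemma inner_pow_lc (J : ℕ) (c : K →₀ ℂ) (f : H) :
    inner ℂ ((D ^ J) (D (lc e c))) f = c.sum fun m a => conj a * coef D e (J + 1) f m := by
  rw [← pow_succ_apply_isometry, map_lc, inner_lc_left]
  rfl

lemma TwoScale.ana_coef_inr (h : TwoScale D b e w) (J : ℕ) (f : H) (k : K) :
    ana b (coef D e (J + 1) f) (Sum.inr k) = coef D e J f k := by
  rw [ana, ← inner_pow_lc, ← h.low]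
  rfl

lemma TwoScale.ana_coef_inl (h : TwoScale D b e w) (J : ℕ) (f : H) (l : L) :
    ana b (coef D e (J + 1) f) (Sum.inl l) = inner ℂ ((D ^ J) (w l)) f := by
  rw [ana, ← inner_pow_lc, ← h.high]

lemma TwoScale.lowIter_coef (h : TwoScale D b e w) (f : H) (n j : ℕ) :
    lowIter b (coef D e (n + j) f) j = coef D e n f := by
  induction j generalizing n with
  | zero => rfl
  | succ j ih =>
    funext k
    rw [lowIter, show n + (j + 1) = (n + 1) + j by ring, ih]
    exact h.ana_coef_inr n f k

lemma TwoScale.energy_coef (h : TwoScale D b e w) (J : ℕ) (f : H) :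
    energy b J (coef D e J f) =
      ∑ j ∈ Finset.range J, nsq (fun l => inner ℂ ((D ^ j) (w l)) f) +
        nsq (fun k => inner ℂ (e k) f) := by
  rw [energy]
  congr 1
  · rw [← Finset.sum_range_reflect (fun j => nsq (fun l => inner ℂ ((D ^ j) (w l)) f))]
    refine Finset.sum_congr rfl fun j hj => ?_
    have hj' := Finset.mem_range.mp hj
    congr 1
    funext l
    conv_lhs => rw [show J = (J - 1 - j + 1) + j by omega]
    rw [h.lowIter_coef, h.ana_coef_inl]
  · have := h.lowIter_coef f 0 J
    rw [zero_add] at this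
    rw [this]
    rfl

lemma nsq_sum_prod (v : K ⊕ (ℕ × L) → ℂ) :
    nsq v = nsq (fun k => v (Sum.inl k)) + ∑' j : ℕ, nsq (fun l => v (Sum.inr (j, l))) := by
  simp only [nsq]
  rw [Summable.tsum_sum ENNReal.summable ENNReal.summable,
    ENNReal.tsum_prod (f := fun j l => ‖v (Sum.inr (j, l))‖ₑ ^ 2)]

/-- If `f` is orthogonal to all levels from `J` on, then the `J`-level analysis of its coefficients
collects all inner products with the system. -/
lemma TwoScale.energy_coef_eq (h : TwoScale D b e w) (J : ℕ) (f : H)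
    (hf : ∀ j l, J ≤ j → inner ℂ ((D ^ j) (w l)) f = 0) :
    energy b J (coef D e J f) = nsq (fun i => inner ℂ (system D e w i) f) := by
  rw [h.energy_coef, nsq_sum_prod, add_comm]
  congr 1
  rw [tsum_eq_sum (s := Finset.range J)]
  · rfl
  · intro j hj
    have hj' : J ≤ j := by simpa using hj
    simp [nsq, system, hf j _ hj']

lemma inner_lc_lc (hb : Biorth e e') (c c' : K →₀ ℂ) :
    inner ℂ (lc e c) (lc e' c') = c.sum fun m a => conj a * c' m := by
  rw [inner_lc_left]
  simp only [hb.inner_lc]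

/-- The orthogonality relations among the levels, from those at level zero. -/
lemma biorth_system (ht : TwoScale D b e w) (ht' : TwoScale D b' e' w')
    (hb : Biorth e e') (hM : AnaSyn b b') : Biorth (system D e w) (system D e' w') := by
  classical
  have hg : ∀ i j, inner ℂ (D (lc e (b i))) (D (lc e' (b' j))) = if i = j then (1 : ℂ) else 0 :=
    fun i j => by rw [D.inner_map_map, inner_lc_lc hb]; exact (hM i j).trans (by congr)
  have key : ∀ {b b' : L ⊕ K → K →₀ ℂ} {e e' : K → H} {w w' : L → H}, TwoScale D b e w →
      TwoScale D b' e' w' → (∀ i j, inner ℂ (D (lc e (b i))) (D (lc e' (b' j))) =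
        if i = j then (1 : ℂ) else 0) → (∀ j m l, inner ℂ (e m) ((D ^ j) (w' l)) = 0) ∧
        ∀ j l l', inner ℂ (w l) ((D ^ (j + 1)) (w' l')) = 0 := by
    intro b b' e e' w w' ht ht' hg
    have h1 : ∀ j m l, inner ℂ (e m) ((D ^ j) (w' l)) = 0 := by
      intro j
      induction j with
      | zero =>
        intro m l
        rw [ht.low, ht'.high, pow_zero]
        simpa using hg (Sum.inr m) (Sum.inl l)
      | succ j ih =>
        intro m l
        rw [ht.low, add_comm, pow_add_apply_isometry, pow_one, D.inner_map_map, inner_lc_left]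
        simp [ih]
    refine ⟨h1, fun j l l' => ?_⟩
    rw [ht.high, add_comm, pow_add_apply_isometry, pow_one, D.inner_map_map, inner_lc_left]
    simp [h1]
  obtain ⟨h1, h2⟩ := key ht ht' hg
  have hg' : ∀ i j, inner ℂ (D (lc e' (b' i))) (D (lc e (b j))) = if i = j then (1 : ℂ) else 0 :=
    fun i j => by rw [D.inner_map_map, inner_lc_lc hb.symm]; exact (hM.symm i j).trans (by congr)
  obtain ⟨h1', h2'⟩ := key ht' ht hg'
  rintro (k | ⟨i, l⟩) (k' | ⟨j, l'⟩)
  · simpa [system] using hb k k'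
  · simpa [system] using h1 j k l'
  · have := congrArg conj (h1' i k' l)
    rw [inner_conj_symm] at this
    simpa [system] using this
  · simp only [system]
    rcases lt_trichotomy i j with hij | rfl | hij
    · obtain ⟨n, rfl⟩ := Nat.exists_eq_add_of_lt hij
      rw [add_assoc, pow_add_apply_isometry, (D ^ i).inner_map_map, h2, if_neg]
      simp
    · rw [(D ^ i).inner_map_map, ht.high, ht'.high, hg]
      simp
    · obtain ⟨n, rfl⟩ := Nat.exists_eq_add_of_lt hij
      have := congrArg conj (h2' n l' l)
      rw [inner_conj_symm, map_zero] at this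
      rw [add_assoc, pow_add_apply_isometry, (D ^ j).inner_map_map, this, if_neg]
      simp

/-- Reconstruction at one level, applied to the unit sequence at `n`. -/
lemma SynAna.single_eq_sum (h : SynAna b b') (hb : ColFinite b) (n : K) :
    Finsupp.single n 1 = ∑ i ∈ (hb n).toFinset, conj (b i n) • b' i := by
  classical
  ext m
  rw [Finsupp.finsetSum_apply]
  have := h n m
  rw [finsum_eq_finsetSum_of_support_subset (s := (hb n).toFinset)] at this
  · simp only [Finsupp.smul_apply, smul_eq_mul]
    rw [this, Finsupp.single_apply]
  · intro i hi
    simp only [Set.Finite.coe_toFinset, Set.mem_ofPred_eq]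
    intro h0
    exact hi (by simp [h0])

end System

section System

variable {K L H : Type*} [NormedAddCommGroup H] [InnerProductSpace ℂ H]
variable {D : H →ₗᵢ[ℂ] H} {b b' : L ⊕ K → K →₀ ℂ} {e e' : K → H} {w w' : L → H}

/-- The span of the `J`-th dilates of the generators `e`. -/
def levelSpan (D : H →ₗᵢ[ℂ] H) (e : K → H) (J : ℕ) : Submodule ℂ H :=
  Submodule.span ℂ (Set.range fun m => (D ^ J) (e m))

lemma pow_lc_mem_levelSpan (D : H →ₗᵢ[ℂ] H) (e : K → H) (J : ℕ) (c : K →₀ ℂ) :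
    (D ^ J) (lc e c) ∈ levelSpan D e J := by
  rw [map_lc]
  exact Finsupp.mem_span_range_iff_exists_finsupp.mpr ⟨c, rfl⟩

lemma TwoScale.levelSpan_mono (h : TwoScale D b e w) : Monotone (levelSpan D e) := by
  refine monotone_nat_of_le_succ fun J => Submodule.span_le.mpr ?_
  rintro _ ⟨m, rfl⟩
  change (D ^ J) (e m) ∈ levelSpan D e (J + 1)
  rw [h.low, ← pow_succ_apply_isometry]
  exact pow_lc_mem_levelSpan D e (J + 1) _

lemma TwoScale.system_mem_levelSpan (h : TwoScale D b e w) (i : K ⊕ (ℕ × L)) :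
    ∃ J, system D e w i ∈ levelSpan D e J := by
  rcases i with k | ⟨j, l⟩
  · exact ⟨0, Submodule.subset_span ⟨k, by simp [system]⟩⟩
  · refine ⟨j + 1, ?_⟩
    rw [system, h.high, ← pow_succ_apply_isometry]
    exact pow_lc_mem_levelSpan D e (j + 1) _

/-- A finite linear combination of the system lies in the span of a single dilated level, beyond
which its coefficients vanish. -/
lemma TwoScale.exists_level (h : TwoScale D b e w) (c : K ⊕ (ℕ × L) →₀ ℂ) :
    ∃ J, 1 ≤ J ∧ lc (system D e w) c ∈ levelSpan D e J ∧ ∀ j l, J ≤ j → c (Sum.inr (j, l)) = 0 := by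
  classical
  choose lev hlev using h.system_mem_levelSpan
  set lev' : K ⊕ (ℕ × L) → ℕ := fun i => lev i + Sum.elim (fun _ => 0) (fun p => p.1 + 1) i
  refine ⟨c.support.sup lev' + 1, by omega, ?_, fun j l hj => ?_⟩
  · rw [lc, Finsupp.linearCombination_apply]
    refine Submodule.sum_mem _ fun i hi => Submodule.smul_mem _ _ (h.levelSpan_mono ?_ (hlev i))
    have : lev' i ≤ c.support.sup lev' := Finset.le_sup hi
    have h1 : lev i ≤ lev' i := Nat.le_add_right _ _
    omega
  · by_contra h0
    have : lev' (Sum.inr (j, l)) ≤ c.support.sup lev' :=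
      Finset.le_sup (Finsupp.mem_support_iff.mpr h0)
    have h1 : j + 1 ≤ lev' (Sum.inr (j, l)) := Nat.le_add_left _ _
    omega

/-- One-level perfect reconstruction puts every dilated generator into the span of the system. -/
lemma dense_system [CompleteSpace H] (ht : TwoScale D b e w) (hS : SynAna b' b)
    (hb' : ColFinite b') (hd : ∀ g : H, (∀ J m, inner ℂ ((D ^ J) (e m)) g = 0) → g = 0) :
    (Submodule.span ℂ (Set.range (system D e w))).topologicalClosure = ⊤ := by
  rw [Submodule.topologicalClosure_eq_top_iff, Submodule.eq_bot_iff]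
  intro g hg
  have hu : ∀ i, inner ℂ (system D e w i) g = 0 := fun i =>
    (Submodule.mem_orthogonal _ _).mp hg _ (Submodule.subset_span ⟨i, rfl⟩)
  refine hd g fun J => ?_
  induction J with
  | zero => exact fun m => by simpa [system] using hu (Sum.inl m)
  | succ J ih =>
    intro n
    have h1 : e n = ∑ i ∈ (hb' n).toFinset, conj (b' i n) • lc e (b i) := by
      rw [← one_smul ℂ (e n), ← Finsupp.linearCombination_single, hS.single_eq_sum hb' n,
        map_sum]
      simp only [map_smul]
    rw [pow_succ_apply_isometry, h1]
    simp only [map_sum, map_smul, sum_inner, inner_smul_left]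
    refine Finset.sum_eq_zero fun i _ => ?_
    rcases i with l | k
    · rw [← ht.high]
      simp [show inner ℂ ((D ^ J) (w l)) g = 0 from hu (Sum.inr (J, l))]
    · rw [← ht.low, ih, mul_zero]

/-- Stability of the filter bank `b` yields the Riesz bounds of the system dual to it. -/
lemma isRieszBasis_system [CompleteSpace H] (ht : TwoScale D b e w) (ht' : TwoScale D b' e' w')
    (hb : ColFinite b) (hS : SynAna b b') (hst : BankStable b) (he : Biorth e e')
    (hu : Biorth (system D e w) (system D e' w')) {B B' : ℝ≥0} (hB : IsBessel e B)
    (hB' : IsBessel e' B')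
    (hd' : ∀ g : H, (∀ J m, inner ℂ ((D ^ J) (e' m)) g = 0) → g = 0) :
    IsRieszBasis (system D e' w') := by
  obtain ⟨C₁, C₂, hC₁, hC₂, hC⟩ := hst
  have key : ∀ c : K ⊕ (ℕ × L) →₀ ℂ, ∃ v : ℝ≥0∞, v ≤ B * ‖lc (system D e' w') c‖ₑ ^ 2 ∧
      ‖lc (system D e' w') c‖ₑ ^ 2 ≤ B' * v ∧ C₁ * v ≤ nsq c ∧ nsq c ≤ C₂ * v := by
    intro c
    obtain ⟨J, hJ, hmem, hc⟩ := ht'.exists_level c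
    set f := lc (system D e' w') c
    obtain ⟨a, ha⟩ := Finsupp.mem_span_range_iff_exists_finsupp.mp hmem
    have ha' : f = lc (fun m => (D ^ J) (e' m)) a := ha.symm
    have hcoef : coef D e J f = a := by
      funext m
      rw [coef, ha']
      exact (he.isometry (D ^ J)).inner_lc a m
    have hinn : ∀ i, inner ℂ (system D e w i) f = c i := hu.inner_lc c
    have hen : energy b J (coef D e J f) = nsq c := by
      rw [ht.energy_coef_eq J f fun j l hj => ?_]
      · simp only [hinn]
      · exact (hinn (Sum.inr (j, l))).trans (hc j l hj)
    have hfin : nsq (coef D e J f) < ∞ := by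
      rw [hcoef, nsq_finsupp]
      exact ENNReal.ofReal_lt_top
    obtain ⟨h1, h2⟩ := hC J hJ _ hfin
    rw [hen] at h1 h2
    refine ⟨nsq (coef D e J f), (hB.isometry (D ^ J)).nsq_inner_le f, ?_, h1, h2⟩
    rw [hcoef, ha']
    exact hB'.isometry (D ^ J) a
  rw [isRieszBasis_iff]
  refine ⟨dense_system ht' hS hb hd', C₂ * B + 1, B' * C₁⁻¹ + 1, by positivity, by positivity,
    fun c => ?_, fun c => ?_⟩
  · obtain ⟨v, h1, -, -, h4⟩ := key c
    calc nsq c ≤ C₂ * v := h4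
      _ ≤ C₂ * (B * ‖lc (system D e' w') c‖ₑ ^ 2) := by gcongr
      _ = (C₂ * B) * ‖lc (system D e' w') c‖ₑ ^ 2 := by rw [mul_assoc]
      _ ≤ _ := by
        gcongr
        push_cast
        exact le_self_add
  · obtain ⟨v, -, h2, h3, -⟩ := key c
    have hv : v ≤ (C₁⁻¹ : ℝ≥0) * nsq c := by
      calc v = (C₁⁻¹ : ℝ≥0) * (C₁ * v) := by
            rw [← mul_assoc, ← ENNReal.coe_mul, inv_mul_cancel₀ hC₁.ne']; simp
        _ ≤ _ := by gcongr
    calc _ ≤ B' * v := h2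
      _ ≤ B' * ((C₁⁻¹ : ℝ≥0) * nsq c) := by gcongr
      _ = (B' * (C₁⁻¹ : ℝ≥0)) * nsq c := by rw [mul_assoc]
      _ ≤ _ := by
        gcongr
        push_cast
        exact le_self_add

/-- Biorthogonal generators and a stable biorthogonal filter bank generate a pair of biorthogonal
Riesz bases. -/
theorem areBiorthogonalBases_system [CompleteSpace H] (ht : TwoScale D b e w)
    (ht' : TwoScale D b' e' w') (hb : ColFinite b) (hb' : ColFinite b') (hA : AnaSyn b b')
    (hS : SynAna b b') (hst : BankStable b) (hst' : BankStable b') (he : Biorth e e')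
    {B B' : ℝ≥0} (hB : IsBessel e B) (hB' : IsBessel e' B')
    (hd : ∀ g : H, (∀ J m, inner ℂ ((D ^ J) (e m)) g = 0) → g = 0)
    (hd' : ∀ g : H, (∀ J m, inner ℂ ((D ^ J) (e' m)) g = 0) → g = 0) :
    AreBiorthogonalBases (system D e w) (system D e' w') := by
  have hu := biorth_system ht ht' he hA
  exact ⟨isRieszBasis_system ht' ht hb' (hS.symm hb) hst' he.symm hu.symm hB' hB hd,
    isRieszBasis_system ht ht' hb hS hst he hu hB hB' hd', hu⟩

/-- Frame bounds of the system yield stability of the filter bank: a square-summable `v` is the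
coefficient sequence at level `J` of a function orthogonal to all levels from `J` on. -/
lemma bankStable_of_system [CompleteSpace H] (ht : TwoScale D b e w) (he : Biorth e e')
    (ho : ∀ j l m, inner ℂ ((D ^ j) (w l)) (e' m) = 0) {B B' A A' : ℝ≥0} (hB : IsBessel e B)
    (hB' : IsBessel e' B') (hA : ∀ f, nsq (fun i => inner ℂ (system D e w i) f) ≤ A * ‖f‖ₑ ^ 2)
    (hA' : ∀ f : H, ‖f‖ₑ ^ 2 ≤ A' * nsq (fun i => inner ℂ (system D e w i) f)) :
    BankStable b := by
  refine ⟨(B * A' + 1)⁻¹, A * B' + 1, by positivity, by positivity, fun J _ v hv => ?_⟩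
  obtain ⟨f, hf, hle⟩ := (hB'.isometry (D ^ J)).exists_hasSum hv
  have hin : ∀ x, HasSum (fun m => v m * inner ℂ x ((D ^ J) (e' m))) (inner ℂ x f) := by
    intro x
    have := hf.mapL (innerSL ℂ x)
    simpa [inner_smul_right] using this
  have hcoef : coef D e J f = v := by
    classical
    funext n
    have h1 := hin ((D ^ J) (e n))
    have h2 := he.isometry (D ^ J)
    have h3 := h1.unique (hasSum_single n fun m hm => by
      rw [h2 n m, if_neg hm.symm, mul_zero])
    rw [coef, h3, h2 n n, if_pos rfl, mul_one]
  have hen : energy b J v = nsq (fun i => inner ℂ (system D e w i) f) := by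
    rw [← hcoef]
    refine ht.energy_coef_eq J f fun j l hj => ?_
    obtain ⟨n, rfl⟩ := Nat.exists_eq_add_of_le hj
    have h1 := hin ((D ^ (J + n)) (w l))
    refine h1.unique ?_
    simp only [pow_add_apply_isometry, (D ^ J).inner_map_map, ho, mul_zero]
    exact hasSum_zero
  have hvB : nsq v ≤ B * ‖f‖ₑ ^ 2 := by
    rw [← hcoef]
    exact (hB.isometry (D ^ J)).nsq_inner_le f
  rw [hen]
  constructor
  · have h1 : nsq v ≤ (B * A' + 1 : ℝ≥0) * nsq (fun i => inner ℂ (system D e w i) f) := by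
      calc nsq v ≤ B * ‖f‖ₑ ^ 2 := hvB
        _ ≤ B * (A' * nsq (fun i => inner ℂ (system D e w i) f)) := by gcongr; exact hA' f
        _ = (B * A') * nsq (fun i => inner ℂ (system D e w i) f) := by rw [mul_assoc]
        _ ≤ _ := by
          gcongr
          push_cast
          exact le_self_add
    calc _ ≤ ((B * A' + 1)⁻¹ : ℝ≥0) *
          ((B * A' + 1 : ℝ≥0) * nsq (fun i => inner ℂ (system D e w i) f)) := by gcongr
      _ = _ := by
        rw [← mul_assoc, ← ENNReal.coe_mul, inv_mul_cancel₀ (by positivity)]; simp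
  · calc _ ≤ A * ‖f‖ₑ ^ 2 := hA f
      _ ≤ A * (B' * nsq v) := by gcongr
      _ = (A * B') * nsq v := by rw [mul_assoc]
      _ ≤ _ := by
        gcongr
        push_cast
        exact le_self_add

/-- Biorthogonal systems that are complete force the one-level identities of the filter bank. -/
lemma anaSyn_synAna_of_system [CompleteSpace H] (ht : TwoScale D b e w)
    (ht' : TwoScale D b' e' w') (hb : ColFinite b) (he : Biorth e e')
    (hu : Biorth (system D e w) (system D e' w'))
    (hd : (Submodule.span ℂ (Set.range (system D e w))).topologicalClosure = ⊤) :
    AnaSyn b b' ∧ SynAna b b' := by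
  classical
  have hg : ∀ i, D (lc e (b i)) = system D e w (Sum.elim (fun l => Sum.inr (0, l)) Sum.inl i) := by
    rintro (l | k)
    · simp [system, ht.high]
    · simp [system, ← ht.low]
  have hg' : ∀ i, D (lc e' (b' i)) =
      system D e' w' (Sum.elim (fun l => Sum.inr (0, l)) Sum.inl i) := by
    rintro (l | k)
    · simp [system, ht'.high]
    · simp [system, ← ht'.low]
  have hinj : Function.Injective
      (Sum.elim (fun l => Sum.inr (0, l)) Sum.inl : L ⊕ K → K ⊕ (ℕ × L)) := by
    rintro (l | k) (l' | k') h <;> simp_all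
  refine ⟨fun i j => ?_, fun n m => ?_⟩
  · rw [ana, ← inner_lc_lc he, ← D.inner_map_map, hg, hg', hu]
    by_cases hij : i = j
    · rw [if_pos hij, if_pos (by rw [hij])]
    · rw [if_neg hij, if_neg fun h => hij (hinj h)]
  · set F := (hb n).toFinset with hF
    set x : H := D (e' n) - ∑ i ∈ F, conj (b i n) • D (lc e' (b' i)) with hx
    have hlow : ∀ i, inner ℂ (D (lc e (b i))) (D (e' n)) = conj (b i n) := by
      intro i
      rw [D.inner_map_map, ← inner_conj_symm, he.symm.inner_lc]
    have hlowx : ∀ i, inner ℂ (D (lc e (b i))) x = 0 := by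
      intro i
      have h1 : ∀ j ∈ F, inner ℂ (D (lc e (b i))) (conj (b j n) • D (lc e' (b' j))) =
          if i = j then conj (b j n) else 0 := by
        intro j _
        rw [inner_smul_right, hg, hg', hu]
        by_cases hij : i = j
        · rw [if_pos hij, if_pos (by rw [hij]), mul_one]
        · rw [if_neg hij, if_neg fun h => hij (hinj h), mul_zero]
      rw [hx, inner_sub_right, hlow, inner_sum, Finset.sum_congr rfl h1, Finset.sum_ite_eq]
      by_cases hi : b i n = 0
      · simp [hi]
      · rw [if_pos (by simpa [hF] using hi), sub_self]
    have hux : ∀ i, inner ℂ (system D e w i) x = 0 := by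
      rintro (k | ⟨_ | j, l⟩)
      · have := hlowx (Sum.inr k)
        rwa [hg] at this
      · have := hlowx (Sum.inl l)
        rwa [hg] at this
      · have h1 : inner ℂ ((D ^ (j + 1)) (w l)) (D (e' n)) = 0 := by
          rw [add_comm, pow_add_apply_isometry, pow_one, D.inner_map_map]
          have := hu (Sum.inr (j, l)) (Sum.inl n)
          rwa [if_neg (by simp)] at this
        rw [hx, inner_sub_right, inner_sum]
        rw [show inner ℂ (system D e w (Sum.inr (j + 1, l))) (D (e' n)) = 0 from h1, zero_sub,
          neg_eq_zero]
        refine Finset.sum_eq_zero fun i _ => ?_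
        rw [inner_smul_right, hg', hu, if_neg, mul_zero]
        rcases i with l' | k <;> simp
    have hx0 : x = 0 := by
      rw [Submodule.topologicalClosure_eq_top_iff] at hd
      have : x ∈ (Submodule.span ℂ (Set.range (system D e w)))ᗮ := by
        rw [Submodule.mem_orthogonal]
        intro y hy
        induction hy using Submodule.span_induction with
        | mem y hy => obtain ⟨i, rfl⟩ := hy; exact hux i
        | zero => simp
        | add y z _ _ h1 h2 => rw [inner_add_left, h1, h2, add_zero]
        | smul a y _ h1 => rw [inner_smul_left, h1, mul_zero]
      rwa [hd, Submodule.mem_bot] at this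
    have h1 : inner ℂ (D (e m)) x = 0 := by rw [hx0, inner_zero_right]
    rw [hx, inner_sub_right, D.inner_map_map, he, inner_sum, sub_eq_zero] at h1
    rw [finsum_eq_finsetSum_of_support_subset (s := F)]
    · rw [show (if n = m then (1 : ℂ) else 0) = if m = n then 1 else 0 by simp only [eq_comm]]
      refine Eq.trans ?_ h1.symm
      refine Finset.sum_congr rfl fun i _ => ?_
      rw [inner_smul_right, D.inner_map_map, he.inner_lc]
    · intro i hi
      simp only [hF, Set.Finite.coe_toFinset, Set.mem_ofPred_eq]
      intro h0
      exact hi (by simp [h0])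

/-- A pair of biorthogonal Riesz bases generated by filter banks forces biorthogonality and
stability of the filter banks. -/
theorem bank_of_areBiorthogonalBases [CompleteSpace H] (ht : TwoScale D b e w)
    (ht' : TwoScale D b' e' w') (hb : ColFinite b) {B B' : ℝ≥0} (hB : IsBessel e B) (hB' : IsBessel e' B')
    (h : AreBiorthogonalBases (system D e w) (system D e' w')) :
    Biorth e e' ∧ AnaSyn b b' ∧ SynAna b b' ∧ BankStable b ∧ BankStable b' := by
  obtain ⟨hR, hR', hu⟩ := h
  have hu : Biorth (system D e w) (system D e' w') := hu
  have he : Biorth e e' := by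
    intro i j
    refine (hu (Sum.inl i) (Sum.inl j)).trans ?_
    by_cases hij : i = j
    · rw [if_pos hij, if_pos (by rw [hij])]
    · rw [if_neg hij, if_neg (by simpa using hij)]
  obtain ⟨hd, A, C, -, -, -, hC⟩ := isRieszBasis_iff.mp hR
  obtain ⟨hd', A', C', -, -, -, hC'⟩ := isRieszBasis_iff.mp hR'
  obtain ⟨hA, hS⟩ := anaSyn_synAna_of_system ht ht' hb he hu hd
  refine ⟨he, hA, hS, ?_, ?_⟩
  · refine bankStable_of_system ht he (fun j l m => ?_) hB hB' hC.nsq_inner_le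
      (hu.enorm_sq_le hC' hd)
    have := hu (Sum.inr (j, l)) (Sum.inl m)
    rwa [if_neg (by simp)] at this
  · refine bankStable_of_system ht' he.symm (fun j l m => ?_) hB' hB hC'.nsq_inner_le
      (hu.symm.enorm_sq_le hC hd')
    have := hu.symm (Sum.inr (j, l)) (Sum.inl m)
    rwa [if_neg (by simp)] at this

end System

/-! ### Filter banks as coefficient sequences -/

variable {d r s : ℕ}

/-- Evaluating a row-vector-valued sequence at a component and a lattice point. -/
def flat {n : ℕ} (v : MSeq d 1 n) : Fin n × ZLat d → ℂ := fun m => v m.2 0 m.1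

/-- The row-vector-valued sequence with given components. -/
def unflat {n : ℕ} (v : Fin n × ZLat d → ℂ) : MSeq d 1 n := fun k => Matrix.of fun _ q => v (q, k)

@[simp] lemma flat_unflat {n : ℕ} (v : Fin n × ZLat d → ℂ) : flat (unflat v) = v := rfl

@[simp] lemma unflat_flat {n : ℕ} (v : MSeq d 1 n) : unflat (flat v) = v := by
  funext k
  ext p q
  rw [Subsingleton.elim p 0]
  rfl

lemma flat_injective {n : ℕ} : Function.Injective (flat : MSeq d 1 n → Fin n × ZLat d → ℂ) :=
  fun v w h => by rw [← unflat_flat v, h, unflat_flat]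

lemma IsDilation.isUnit_map {M : Matrix (Fin d) (Fin d) ℤ} (hM : IsDilation M) :
    IsUnit (M.map (fun z : ℤ => (z : ℂ))) := by
  by_contra h
  have h0 : (0 : ℂ) ∈ spectrum ℂ (M.map (fun z : ℤ => (z : ℂ))) :=
    (spectrum.zero_mem_iff ℂ).mpr h
  have := hM 0 h0
  rw [norm_zero] at this
  linarith

lemma IsDilation.det_ne_zero {M : Matrix (Fin d) (Fin d) ℤ} (hM : IsDilation M) : M.det ≠ 0 := by
  have h := (Matrix.isUnit_iff_isUnit_det _).mp hM.isUnit_map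
  have h1 : (M.map (fun z : ℤ => (z : ℂ))).det = ((M.det : ℤ) : ℂ) :=
    ((Int.castRingHom ℂ).map_det M).symm
  rw [h1] at h
  intro h0
  simp [h0] at h

lemma det_realMat (M : Matrix (Fin d) (Fin d) ℤ) : (realMat M).det = (M.det : ℝ) :=
  ((Int.castRingHom ℝ).map_det M).symm

lemma IsDilation.det_realMat_ne_zero {M : Matrix (Fin d) (Fin d) ℤ} (hM : IsDilation M) :
    (realMat M).det ≠ 0 := by
  rw [det_realMat]
  exact_mod_cast hM.det_ne_zero

lemma IsDilation.mulVec_injective {M : Matrix (Fin d) (Fin d) ℤ} (hM : IsDilation M) :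
    Function.Injective M.mulVec :=
  Matrix.mulVec_injective_of_det_ne_zero hM.det_ne_zero

/-- The coefficient sequence `(q, k) ↦ |det M|^{1/2} a(k - M x)_{p q}` of the filter `a`. -/
def filtCoeff {m n : ℕ} (a : MFilter d m n) (M : Matrix (Fin d) (Fin d) ℤ) (p : Fin m)
    (x : ZLat d) : Fin n × ZLat d →₀ ℂ :=
  Finsupp.ofSupportFinite
    (fun i => (sqrtAbsDet (realMat M) : ℂ) * a (i.2 - M *ᵥ x) p i.1) <| by
      classical
      refine ((Finset.univ ×ˢ a.support.image (· + M *ᵥ x) :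
        Finset (Fin n × ZLat d)).finite_toSet).subset fun i hi => ?_
      simp only [Finset.coe_product, Finset.coe_univ, Set.mem_prod, Set.mem_univ, true_and,
        Finset.coe_image, Set.mem_image, Finset.mem_coe, Finsupp.mem_support_iff]
      refine ⟨i.2 - M *ᵥ x, fun h0 => hi ?_, by simp⟩
      simp [h0]

lemma filtCoeff_apply {m n : ℕ} (a : MFilter d m n) (M : Matrix (Fin d) (Fin d) ℤ) (p : Fin m)
    (x : ZLat d) (q : Fin n) (k : ZLat d) :
    filtCoeff a M p x (q, k) = (sqrtAbsDet (realMat M) : ℂ) * a (k - M *ᵥ x) p q := rfl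

/-- The coefficient sequences of a filter bank. -/
def bankCoeff (M : Dilations d s) (B : FilterBank d r s) :
    (Fin s × ZLat d) ⊕ (Fin r × ZLat d) → (Fin r × ZLat d →₀ ℂ)
  | .inl (l, x) => filtCoeff (B.high l) (M l.succ) 0 x
  | .inr (p, x) => filtCoeff B.low (M 0) p x

lemma transition_apply {m n : ℕ} (a : MFilter d m n) (M : Matrix (Fin d) (Fin d) ℤ)
    (u : MSeq d 1 n) (x : ZLat d) (p : Fin m) :
    transition a M u x 0 p = (filtCoeff a M p x).sum fun i c => conj c * flat u i := by
  classical
  set F : Finset (ZLat d) := a.support.image (· + M *ᵥ x) with hF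
  have hmem : ∀ k, a (k - M *ᵥ x) ≠ 0 → k ∈ F := fun k hk => by
    rw [hF, Finset.mem_image]
    exact ⟨k - M *ᵥ x, Finsupp.mem_support_iff.mpr hk, by simp⟩
  rw [transition, finsum_eq_finsetSum_of_support_subset (s := F)]
  · rw [Finsupp.sum_of_support_subset _ (s := Finset.univ ×ˢ F) _ _ (by simp),
      Finset.sum_product_right, Matrix.smul_apply, Matrix.sum_apply, smul_eq_mul, Finset.mul_sum]
    · refine Finset.sum_congr rfl fun k _ => ?_
      rw [Matrix.mul_apply, Finset.mul_sum]
      refine Finset.sum_congr rfl fun q _ => ?_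
      rw [filtCoeff_apply, Matrix.conjTranspose_apply, map_mul, Complex.conj_ofReal, flat]
      simp only [starRingEnd_apply]
      ring
    · rintro ⟨q, k⟩ hk
      simp only [Finset.mem_product, Finset.mem_univ, true_and]
      refine hmem k fun h0 => Finsupp.mem_support_iff.mp hk ?_
      rw [filtCoeff_apply, h0]
      simp
  · intro k hk
    refine hmem k fun h0 => hk ?_
    simp [h0]

lemma subdivision_apply {m n : ℕ} (a : MFilter d m n) (M : Matrix (Fin d) (Fin d) ℤ)
    (u : MSeq d 1 m) (x : ZLat d) (q : Fin n) {F : Finset (ZLat d)}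
    (hF : ∀ k, a (x - M *ᵥ k) ≠ 0 → k ∈ F) :
    subdivision a M u x 0 q = ∑ p, ∑ k ∈ F, flat u (p, k) * filtCoeff a M p k (q, x) := by
  rw [subdivision, finsum_eq_finsetSum_of_support_subset (s := F)]
  · rw [Finset.sum_comm, Matrix.smul_apply, Matrix.sum_apply, smul_eq_mul, Finset.mul_sum]
    refine Finset.sum_congr rfl fun k _ => ?_
    rw [Matrix.mul_apply, Finset.mul_sum]
    refine Finset.sum_congr rfl fun p _ => ?_
    rw [filtCoeff_apply, flat]
    ring
  · intro k hk
    refine hF k fun h0 => hk ?_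
    simp [h0]

lemma finite_filter_ne_zero {m n : ℕ} (a : MFilter d m n) {M : Matrix (Fin d) (Fin d) ℤ}
    (hM : IsDilation M) (x : ZLat d) : {k | a (x - M *ᵥ k) ≠ 0}.Finite := by
  refine (a.support.finite_toSet.preimage (f := fun k => x - M *ᵥ k) ?_).subset fun k hk => ?_
  · intro k _ k' _ h
    exact hM.mulVec_injective (by simpa using h)
  · simpa using hk

/-- A finite set of shifts containing all those at which some filter of the bank meets `x`. -/
lemma exists_finset_shifts {M : Dilations d s} (hM : ∀ l, IsDilation (M l)) (B : FilterBank d r s)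
    (x : ZLat d) : ∃ F : Finset (ZLat d), (∀ k, B.low (x - M 0 *ᵥ k) ≠ 0 → k ∈ F) ∧
      ∀ l k, B.high l (x - M l.succ *ᵥ k) ≠ 0 → k ∈ F := by
  classical
  refine ⟨(finite_filter_ne_zero B.low (hM 0) x).toFinset ∪ Finset.univ.biUnion fun l =>
    (finite_filter_ne_zero (B.high l) (hM l.succ) x).toFinset, fun k hk => ?_, fun l k hk => ?_⟩
  · exact Finset.mem_union_left _ (by simpa using hk)
  · exact Finset.mem_union_right _ (Finset.mem_biUnion.mpr ⟨l, Finset.mem_univ _, by simpa using hk⟩)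

lemma mem_of_bankCoeff_ne_zero {M : Dilations d s} {B : FilterBank d r s} {x : ZLat d}
    {F : Finset (ZLat d)} (h0 : ∀ k, B.low (x - M 0 *ᵥ k) ≠ 0 → k ∈ F)
    (h1 : ∀ l k, B.high l (x - M l.succ *ᵥ k) ≠ 0 → k ∈ F) (q : Fin r)
    (i : (Fin s × ZLat d) ⊕ (Fin r × ZLat d)) (hi : bankCoeff M B i (q, x) ≠ 0) :
    i ∈ (Finset.univ ×ˢ F).disjSum (Finset.univ ×ˢ F) := by
  rcases i with ⟨l, k⟩ | ⟨p, k⟩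
  · simp only [Finset.inl_mem_disjSum, Finset.mem_product, Finset.mem_univ, true_and]
    refine h1 l k fun h => hi ?_
    rw [bankCoeff, filtCoeff_apply, h]
    simp
  · simp only [Finset.inr_mem_disjSum, Finset.mem_product, Finset.mem_univ, true_and]
    refine h0 k fun h => hi ?_
    rw [bankCoeff, filtCoeff_apply, h]
    simp

lemma colFinite_bankCoeff {M : Dilations d s} (hM : ∀ l, IsDilation (M l))
    (B : FilterBank d r s) : ColFinite (bankCoeff M B) := by
  rintro ⟨q, x⟩
  obtain ⟨F, h0, h1⟩ := exists_finset_shifts hM B x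
  exact (Finset.finite_toSet _).subset fun i hi => mem_of_bankCoeff_ne_zero h0 h1 q i hi

/-- The scalar components of the output of the analysis operator. -/
def flatOut (w : (Fin s → MSeq d 1 1) × MSeq d 1 r) : (Fin s × ZLat d) ⊕ (Fin r × ZLat d) → ℂ
  | .inl (l, x) => w.1 l x 0 0
  | .inr m => flat w.2 m

lemma flatOut_injective : Function.Injective
    (flatOut : (Fin s → MSeq d 1 1) × MSeq d 1 r → _) := by
  intro w w' h
  refine Prod.ext ?_ (flat_injective (funext fun m => congrFun h (Sum.inr m)))
  funext l x
  ext p q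
  rw [Subsingleton.elim p 0, Subsingleton.elim q 0]
  exact congrFun h (Sum.inl (l, x))

lemma flatOut_surjective : Function.Surjective
    (flatOut : (Fin s → MSeq d 1 1) × MSeq d 1 r → _) := by
  intro w
  refine ⟨(fun l x => Matrix.of fun _ _ => w (Sum.inl (l, x)), unflat fun m => w (Sum.inr m)), ?_⟩
  funext i
  rcases i with ⟨l, x⟩ | ⟨p, x⟩ <;> rfl

lemma flatOut_analysis (M : Dilations d s) (B : FilterBank d r s) (v : MSeq d 1 r) :
    flatOut (analysis M B v) = ana (bankCoeff M B) (flat v) := by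
  funext i
  rcases i with ⟨l, x⟩ | ⟨p, x⟩
  · exact transition_apply _ _ _ _ _
  · exact transition_apply _ _ _ _ _

lemma flat_synthesis {M : Dilations d s} (hM : ∀ l, IsDilation (M l)) (B : FilterBank d r s)
    (w : (Fin s → MSeq d 1 1) × MSeq d 1 r) :
    flat (synthesis M B w) = syn (bankCoeff M B) (flatOut w) := by
  funext ⟨q, x⟩
  obtain ⟨F, h0, h1⟩ := exists_finset_shifts hM B x
  rw [syn_eq_sum _ _ _ (mem_of_bankCoeff_ne_zero h0 h1 q), Finset.sum_disjSum,
    Finset.sum_product, Finset.sum_product, add_comm]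
  simp only [flat, synthesis, Pi.add_apply, Matrix.add_apply, Finset.sum_apply, Matrix.sum_apply]
  rw [subdivision_apply B.low (M 0) w.2 x q h0]
  congr 1
  refine Finset.sum_congr rfl fun l _ => ?_
  rw [subdivision_apply (B.high l) (M l.succ) (w.1 l) x q (h1 l)]
  simp
  rfl

lemma anaSyn_bankCoeff_iff {M : Dilations d s} (hM : ∀ l, IsDilation (M l))
    (B B' : FilterBank d r s) : AnaSyn (bankCoeff M B) (bankCoeff M B') ↔
      ∀ w, analysis M B (synthesis M B' w) = w := by
  rw [anaSyn_iff (colFinite_bankCoeff hM B')]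
  constructor
  · intro h w
    apply flatOut_injective
    rw [flatOut_analysis, flat_synthesis hM, h]
  · intro h w
    obtain ⟨w, rfl⟩ := flatOut_surjective w
    rw [← flat_synthesis hM, ← flatOut_analysis, h]

lemma synAna_bankCoeff_iff {M : Dilations d s} (hM : ∀ l, IsDilation (M l))
    (B B' : FilterBank d r s) : SynAna (bankCoeff M B) (bankCoeff M B') ↔
      ∀ v, synthesis M B' (analysis M B v) = v := by
  rw [synAna_iff (colFinite_bankCoeff hM B')]
  constructor
  · intro h v
    apply flat_injective
    rw [flat_synthesis hM, flatOut_analysis, h]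
  · intro h v
    rw [← flat_unflat v, ← flatOut_analysis, ← flat_synthesis hM, h]

lemma l2sq_eq_nsq {n : ℕ} (v : MSeq d 1 n) : l2sq v = nsq (flat v) := by
  rw [l2sq, nsq, ENNReal.tsum_prod (f := fun q k => ‖flat v (q, k)‖ₑ ^ 2), ENNReal.tsum_comm]
  refine tsum_congr fun k => ?_
  rw [tsum_fintype]
  simp [flat]

lemma sum_l2sq_eq_nsq (v : Fin s → MSeq d 1 1) :
    ∑ l, l2sq (v l) = nsq fun p : Fin s × ZLat d => v p.1 p.2 0 0 := by
  rw [nsq, ENNReal.tsum_prod (f := fun l k => ‖v l k 0 0‖ₑ ^ 2), tsum_fintype]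
  simp [l2sq]

lemma flat_lowCoeff (M : Dilations d s) (B : FilterBank d r s) (v : MSeq d 1 r) (j : ℕ) :
    flat (lowCoeff M B v j) = lowIter (bankCoeff M B) (flat v) j := by
  induction j with
  | zero => rfl
  | succ j ih =>
    funext ⟨p, x⟩
    rw [lowIter, ← ih, ← flatOut_analysis]
    rfl

lemma energy_bankCoeff (M : Dilations d s) (B : FilterBank d r s) (J : ℕ) (v : MSeq d 1 r) :
    (∑ j, ∑ l, l2sq ((analysisJ M B J v).1 j l)) + l2sq (analysisJ M B J v).2 =
      energy (bankCoeff M B) J (flat v) := by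
  rw [energy, l2sq_eq_nsq, analysisJ, flat_lowCoeff, ← Fin.sum_univ_eq_sum_range
    (fun j => nsq fun l => ana (bankCoeff M B) (lowIter (bankCoeff M B) (flat v) j) (Sum.inl l))]
  congr 1
  refine Finset.sum_congr rfl fun j _ => ?_
  rw [sum_l2sq_eq_nsq]
  congr 1
  funext ⟨l, x⟩
  rw [← flat_lowCoeff, ← flatOut_analysis]
  rfl

lemma hasStability_iff (M : Dilations d s) (B : FilterBank d r s) :
    HasStability M B ↔ BankStable (bankCoeff M B) := by
  refine exists_congr fun C₁ => exists_congr fun C₂ => and_congr_right fun _ =>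
    and_congr_right fun _ => forall_congr' fun J => forall_congr' fun _ => ?_
  simp only [energy_bankCoeff]
  simp only [l2sq_eq_nsq]
  constructor
  · intro h v hv
    have := h (unflat v)
    rw [flat_unflat] at this
    exact this hv
  · exact fun h v hv => h _ hv

/-! ### Characters of the lattice and dual framelet filter banks -/

/-- The character `k ↦ e^{2πi k·ω}` of `ℤ^d`. -/
def latChar (ω : Euc d) (k : ZLat d) : ℂ :=
  Complex.exp (2 * π * Complex.I * ((∑ i, (k i : ℝ) * ω i : ℝ) : ℂ))

lemma latChar_add (ω : Euc d) (k l : ZLat d) : latChar ω (k + l) = latChar ω k * latChar ω l := by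
  rw [latChar, latChar, latChar, ← Complex.exp_add, ← mul_add, ← Complex.ofReal_add,
    ← Finset.sum_add_distrib]
  simp [add_mul]

@[simp] lemma latChar_zero_right (ω : Euc d) : latChar ω 0 = 1 := by simp [latChar]

@[simp] lemma latChar_zero_left (k : ZLat d) : latChar 0 k = 1 := by simp [latChar]

/-- The character `latChar ω` as a monoid homomorphism. -/
def latCharHom (ω : Euc d) : Multiplicative (ZLat d) →* ℂ where
  toFun k := latChar ω k.toAdd
  map_one' := latChar_zero_right ω
  map_mul' _ _ := latChar_add ω _ _

lemma exp_two_pi_eq_one_iff (x : ℝ) :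
    Complex.exp (2 * π * Complex.I * (x : ℂ)) = 1 ↔ ∃ n : ℤ, x = n := by
  rw [Complex.exp_eq_one_iff]
  refine exists_congr fun n => ?_
  rw [mul_comm, mul_left_inj' Complex.two_pi_I_ne_zero]
  norm_cast

lemma latChar_single (ω : Euc d) (i : Fin d) :
    latChar ω (Pi.single i 1) = Complex.exp (2 * π * Complex.I * (ω i : ℂ)) := by
  rw [latChar, Finset.sum_eq_single i]
  · simp
  · intro j _ hj; simp [hj]
  · simp

lemma latChar_injective {ω ω' : Euc d} (hω : ∀ i, 0 ≤ ω i ∧ ω i < 1)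
    (hω' : ∀ i, 0 ≤ ω' i ∧ ω' i < 1) (h : latChar ω = latChar ω') : ω = ω' := by
  ext i
  have h1 := congrFun h (Pi.single i 1)
  rw [latChar_single, latChar_single] at h1
  have h2 : Complex.exp (2 * π * Complex.I * ((ω i - ω' i : ℝ) : ℂ)) = 1 := by
    rw [Complex.ofReal_sub, mul_sub, Complex.exp_sub, h1, div_self (Complex.exp_ne_zero _)]
  obtain ⟨n, hn⟩ := (exp_two_pi_eq_one_iff _).mp h2
  have h3 : n = 0 := by
    have ha := hω i
    have hb := hω' i
    have h4 : (-1 : ℝ) < n := by linarith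
    have h5 : (n : ℝ) < 1 := by linarith
    have h6 : -1 < n := by exact_mod_cast h4
    have h7 : n < 1 := by exact_mod_cast h5
    omega
  rw [h3] at hn
  simpa [sub_eq_zero] using hn

/-- Distinct characters of the lattice are linearly independent. -/
lemma eq_zero_of_sum_latChar {S : Finset (Euc d)} (hS : ∀ ω ∈ S, ∀ i, 0 ≤ ω i ∧ ω i < 1)
    {a : Euc d → ℂ} (h : ∀ k, ∑ ω ∈ S, a ω * latChar ω k = 0) : ∀ ω ∈ S, a ω = 0 := by
  have hinj : Function.Injective fun ω : S => latCharHom ω.1 := by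
    intro ω ω' h
    refine Subtype.ext (latChar_injective (hS _ ω.2) (hS _ ω'.2) ?_)
    funext k
    exact DFunLike.congr_fun h (Multiplicative.ofAdd k)
  have hli := (linearIndependent_monoidHom (Multiplicative (ZLat d)) ℂ).comp _ hinj
  rw [Fintype.linearIndependent_iff] at hli
  have := hli (fun ω => a ω.1) (by
    funext k
    have h1 := h k.toAdd
    rw [← Finset.sum_coe_sort] at h1
    simp only [Finset.sum_apply, Pi.smul_apply, Function.comp_apply, smul_eq_mul, Pi.zero_apply]
    exact h1)
  exact fun ω hω => this ⟨ω, hω⟩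

lemma sum_transpose_mulVec (M : Matrix (Fin d) (Fin d) ℤ) (k : ZLat d) (ω : Euc d) :
    ∑ i, ((M *ᵥ k) i : ℝ) * ω i = ∑ i, (k i : ℝ) * act (realMat M)ᵀ ω i := by
  simp only [Matrix.mulVec, dotProduct, act, realMat, Matrix.transpose_apply, Matrix.map_apply,
    Int.cast_sum, Int.cast_mul, Finset.sum_mul, Finset.mul_sum]
  rw [Finset.sum_comm]
  refine Finset.sum_congr rfl fun i _ => Finset.sum_congr rfl fun j _ => by ring

lemma act_act (A B : Matrix (Fin d) (Fin d) ℝ) (x : Euc d) : act A (act B x) = act (A * B) x := by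
  simp [act, Matrix.mulVec_mulVec]

@[simp] lemma act_one (x : Euc d) : act (1 : Matrix (Fin d) (Fin d) ℝ) x = x := by
  simp [act]

lemma IsDilation.isUnit_det_transpose {M : Matrix (Fin d) (Fin d) ℤ} (hM : IsDilation M) :
    IsUnit (realMat M)ᵀ.det := by
  rw [Matrix.det_transpose]
  exact hM.det_realMat_ne_zero.isUnit

lemma mem_Omega_iff {M : Matrix (Fin d) (Fin d) ℤ} (hM : IsDilation M) (ω : Euc d) :
    ω ∈ Omega M ↔ (∀ k, latChar ω (M *ᵥ k) = 1) ∧ ∀ i, 0 ≤ ω i ∧ ω i < 1 := by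
  refine and_congr_left fun _ => ?_
  constructor
  · rintro ⟨n, hn⟩ k
    rw [latChar, exp_two_pi_eq_one_iff, sum_transpose_mulVec, hn, act_act,
      Matrix.mul_nonsing_inv _ hM.isUnit_det_transpose, act_one]
    exact ⟨∑ i, k i * n i, by simp [latVec]⟩
  · intro h
    have h1 : ∀ i, ∃ n : ℤ, act (realMat M)ᵀ ω i = n := by
      intro i
      have h2 := h (Pi.single i 1)
      rw [latChar, exp_two_pi_eq_one_iff, sum_transpose_mulVec] at h2
      simpa [Pi.single_apply] using h2
    choose n hn using h1
    refine ⟨n, ?_⟩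
    have h3 : latVec n = act (realMat M)ᵀ ω := by
      ext i
      rw [hn i, latVec]
    rw [h3, act_act, Matrix.nonsing_inv_mul _ hM.isUnit_det_transpose, act_one]

lemma card_quotient_range {M : Matrix (Fin d) (Fin d) ℤ} (hM : IsDilation M) :
    Nat.card (ZLat d ⧸ LinearMap.range M.mulVecLin) = M.det.natAbs := by
  have hinj : Function.Injective M.mulVecLin := hM.mulVec_injective
  rw [← Submodule.natAbs_det_equiv (LinearMap.range M.mulVecLin)
    (LinearEquiv.ofInjective M.mulVecLin hinj)]
  congr 1
  rw [← LinearMap.det_toLin', Matrix.toLin'_apply']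
  rfl

/-- The sum of the characters in `Ω_M` detects the sublattice `M ℤ^d`, since `Ω_M` parametrizes
the dual group of `ℤ^d / M ℤ^d`. -/
lemma exists_Omega_finset {M : Matrix (Fin d) (Fin d) ℤ} (hM : IsDilation M) :
    ∃ S : Finset (Euc d), (S : Set (Euc d)) = Omega M ∧ ∀ p : ZLat d,
      (p ∈ LinearMap.range M.mulVecLin → ∑ ω ∈ S, latChar ω p = (|(realMat M).det| : ℝ)) ∧
      (p ∉ LinearMap.range M.mulVecLin → ∑ ω ∈ S, latChar ω p = 0) := by
  classical
  set N : Submodule ℤ (ZLat d) := LinearMap.range M.mulVecLin with hN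
  have hcard : Nat.card (ZLat d ⧸ N) = M.det.natAbs := card_quotient_range hM
  have : Finite (ZLat d ⧸ N) := Nat.finite_of_card_ne_zero (by
    rw [hcard]; exact Int.natAbs_ne_zero.mpr hM.det_ne_zero)
  have := Fintype.ofFinite (ZLat d ⧸ N)
  have : Fintype (AddChar (ZLat d ⧸ N) ℂ) := Fintype.ofFinite _
  -- the frequency of a character of the quotient
  have hex : ∀ χ : AddChar (ZLat d ⧸ N) ℂ, ∃ ω : Euc d, (∀ i, 0 ≤ ω i ∧ ω i < 1) ∧
      ∀ k, latChar ω k = χ (N.mkQ k) := by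
    intro χ
    have h1 : ∀ i : Fin d, ∃ t : ℝ, (0 ≤ t ∧ t < 1) ∧
        Complex.exp (2 * π * Complex.I * (t : ℂ)) = χ (N.mkQ (Pi.single i 1)) := by
      intro i
      set z := χ (N.mkQ (Pi.single i 1)) with hz
      have hzn : ‖z‖ = 1 := χ.norm_apply _
      refine ⟨Int.fract (z.arg / (2 * π)), ⟨Int.fract_nonneg _, Int.fract_lt_one _⟩, ?_⟩
      have h2 : (2 * π * Complex.I * ((Int.fract (z.arg / (2 * π)) : ℝ) : ℂ)) =
          z.arg * Complex.I - (⌊z.arg / (2 * π)⌋ : ℤ) * (2 * π * Complex.I) := by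
        rw [Int.fract]
        push_cast
        field_simp
      rw [h2, Complex.exp_sub, Complex.exp_int_mul_two_pi_mul_I, div_one]
      have := Complex.norm_mul_exp_arg_mul_I z
      rwa [hzn, Complex.ofReal_one, one_mul] at this
    choose t ht ht' using h1
    refine ⟨WithLp.toLp 2 t, ht, fun k => ?_⟩
    have h2 : k = ∑ i, k i • (Pi.single i 1 : ZLat d) := by
      simpa using (Pi.basisFun ℤ (Fin d)).sum_repr k |>.symm
    have h3 : χ (N.mkQ k) = ∏ i, χ (N.mkQ (Pi.single i 1)) ^ k i := by
      conv_lhs => rw [h2]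
      have h4 : ∀ (T : Finset (Fin d)) (f : Fin d → ZLat d ⧸ N),
          χ (∑ i ∈ T, f i) = ∏ i ∈ T, χ (f i) := by
        intro T f
        induction T using Finset.induction_on with
        | empty => simp
        | insert i T hi ih =>
          rw [Finset.sum_insert hi, Finset.prod_insert hi, AddChar.map_add_eq_mul, ih]
      rw [map_sum, h4]
      refine Finset.prod_congr rfl fun i _ => ?_
      rw [map_zsmul, AddChar.map_zsmul_eq_zpow]
    rw [h3, latChar, Complex.ofReal_sum, Finset.mul_sum, Complex.exp_sum]
    refine Finset.prod_congr rfl fun i _ => ?_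
    rw [← ht' i, ← Complex.exp_int_mul]
    congr 1
    push_cast
    ring
  choose Ψ hΨ hΨ' using hex
  have hΨinj : Function.Injective Ψ := by
    intro χ χ' h
    refine DFunLike.ext _ _ fun g => ?_
    obtain ⟨k, rfl⟩ := N.mkQ_surjective g
    rw [← hΨ', ← hΨ', h]
  refine ⟨Finset.univ.image Ψ, ?_, ?_⟩
  · ext ω
    rw [mem_Omega_iff hM]
    simp only [Finset.coe_image, Finset.coe_univ, Set.image_univ, Set.mem_range]
    constructor
    · rintro ⟨χ, rfl⟩
      refine ⟨fun k => ?_, hΨ χ⟩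
      rw [hΨ']
      have : N.mkQ (M *ᵥ k) = 0 := by
        rw [Submodule.mkQ_apply, Submodule.Quotient.mk_eq_zero]
        exact ⟨k, rfl⟩
      rw [this, AddChar.map_zero_eq_one]
    · rintro ⟨h1, h2⟩
      have hinv : ∀ p p' : ZLat d, N.mkQ p = N.mkQ p' → latChar ω p = latChar ω p' := by
        intro p p' hp
        rw [Submodule.mkQ_apply, Submodule.mkQ_apply, Submodule.Quotient.eq] at hp
        obtain ⟨k, hk⟩ := hp
        have h3 : p = M *ᵥ k + p' := by
          rw [show M *ᵥ k = p - p' from hk]; simp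
        rw [h3, latChar_add, h1, one_mul]
      set σ := Function.surjInv N.mkQ_surjective with hσ
      have hσ' : ∀ g, N.mkQ (σ g) = g := Function.surjInv_eq N.mkQ_surjective
      let χ : AddChar (ZLat d ⧸ N) ℂ :=
        { toFun := fun g => latChar ω (σ g)
          map_zero_eq_one' := by
            rw [hinv (σ 0) 0 (by rw [hσ', map_zero]), latChar_zero_right]
          map_add_eq_mul' := fun a b => by
            rw [← latChar_add]
            exact hinv _ _ (by rw [map_add, hσ', hσ', hσ']) }
      refine ⟨χ, latChar_injective (hΨ χ) h2 ?_⟩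
      funext k
      rw [hΨ' χ k]
      exact hinv _ _ (hσ' _)
  · intro p
    have hsum : ∑ ω ∈ Finset.univ.image Ψ, latChar ω p =
        ∑ χ : AddChar (ZLat d ⧸ N) ℂ, χ (N.mkQ p) := by
      rw [Finset.sum_image fun _ _ _ _ h => hΨinj h]
      exact Finset.sum_congr rfl fun χ _ => hΨ' χ p
    have h1 := AddChar.sum_apply_eq_ite (N.mkQ p)
    have h2 : N.mkQ p = 0 ↔ p ∈ N := by
      rw [Submodule.mkQ_apply, Submodule.Quotient.mk_eq_zero]
    rw [hsum]
    have h3 : ∑ χ : AddChar (ZLat d ⧸ N) ℂ, χ (N.mkQ p) =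
        if N.mkQ p = 0 then (Fintype.card (ZLat d ⧸ N) : ℂ) else 0 := by
      rw [← h1]
      exact Finset.sum_congr (by ext; simp) fun _ _ => rfl
    rw [h3]
    refine ⟨fun hp => ?_, fun hp => ?_⟩
    · rw [if_pos (h2.mpr hp), ← Nat.card_eq_fintype_card, hcard, det_realMat]
      rw [Nat.cast_natAbs, ← Int.cast_abs, Complex.ofReal_intCast]
    · rw [if_neg fun h => hp (h2.mp h)]

/-- The twisted correlation `∑ᵤ e^{-2πi u·ω} a(u)^* a'(u + t)` of two filters. -/
def twistCorr {m n : ℕ} (a a' : MFilter d m n) (ω : Euc d) (t : ZLat d) :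
    Matrix (Fin n) (Fin n) ℂ :=
  ∑ u ∈ a.support, latChar ω (-u) • ((a u)ᴴ * a' (u + t))

lemma sqrtAbsDet_mul_self (A : Matrix (Fin d) (Fin d) ℝ) :
    (sqrtAbsDet A : ℂ) * sqrtAbsDet A = (|A.det| : ℝ) := by
  rw [sqrtAbsDet, ← Complex.ofReal_mul, Real.mul_self_sqrt (abs_nonneg _)]

/-- The entries of synthesis after analysis with a single pair of filters, expanded in the
characters of `Ω_M`. -/
lemma sum_filtCoeff_mul {m n : ℕ} (a a' : MFilter d m n) {M : Matrix (Fin d) (Fin d) ℤ}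
    (hM : IsDilation M) {S : Finset (Euc d)} (hS : ∀ p : ZLat d,
      (p ∈ LinearMap.range M.mulVecLin → ∑ ω ∈ S, latChar ω p = (|(realMat M).det| : ℝ)) ∧
      (p ∉ LinearMap.range M.mulVecLin → ∑ ω ∈ S, latChar ω p = 0))
    (x t : ZLat d) (q q' : Fin n) {F : Finset (ZLat d)} (hF : ∀ k, a (x - M *ᵥ k) ≠ 0 → k ∈ F) :
    ∑ p, ∑ k ∈ F, conj (filtCoeff a M p k (q, x)) * filtCoeff a' M p k (q', x + t) =
      ∑ ω ∈ S, latChar ω x * twistCorr a a' ω t q q' := by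
  classical
  set G : ZLat d → ℂ := fun u => ((a u)ᴴ * a' (u + t)) q q' with hG
  set R := LinearMap.range M.mulVecLin with hR
  have hG0 : ∀ u, a u = 0 → G u = 0 := fun u hu => by simp [hG, hu]
  have h1 : ∑ p, ∑ k ∈ F, conj (filtCoeff a M p k (q, x)) * filtCoeff a' M p k (q', x + t) =
      ∑ k ∈ F, (|(realMat M).det| : ℝ) * G (x - M *ᵥ k) := by
    rw [Finset.sum_comm]
    refine Finset.sum_congr rfl fun k _ => ?_
    change _ = _ * ((a (x - M *ᵥ k))ᴴ * a' (x - M *ᵥ k + t)) q q'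
    rw [Matrix.mul_apply, Finset.mul_sum]
    refine Finset.sum_congr rfl fun p _ => ?_
    rw [filtCoeff_apply, filtCoeff_apply, map_mul, Complex.conj_ofReal, ← sqrtAbsDet_mul_self,
      Matrix.conjTranspose_apply, starRingEnd_apply, show x + t - M *ᵥ k = x - M *ᵥ k + t by abel]
    ring
  have h2 : ∑ k ∈ F, (|(realMat M).det| : ℝ) * G (x - M *ᵥ k) =
      ∑ u ∈ a.support, if x - u ∈ R then (|(realMat M).det| : ℝ) * G u else 0 := by
    rw [← finsum_eq_finsetSum_of_support_subset
        (fun k => ((|(realMat M).det| : ℝ) : ℂ) * G (x - M *ᵥ k)) (s := F)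
        (fun k hk => hF k fun h0 => hk (by simp [hG0 _ h0])),
      ← finsum_eq_finsetSum_of_support_subset
        (fun u => if x - u ∈ R then ((|(realMat M).det| : ℝ) : ℂ) * G u else 0) (s := a.support)]
    · have hinj : Function.Injective fun k : ZLat d => x - M *ᵥ k := fun k k' h =>
        hM.mulVec_injective (by simpa using h)
      rw [← finsum_mem_range (f := fun u => ((|(realMat M).det| : ℝ) : ℂ) * G u) hinj]
      refine finsum_congr fun u => ?_
      have hiff : u ∈ Set.range (fun k : ZLat d => x - M *ᵥ k) ↔ x - u ∈ R := by
        constructor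
        · rintro ⟨k, rfl⟩
          exact ⟨k, by simp⟩
        · rintro ⟨k, hk⟩
          refine ⟨k, ?_⟩
          change M *ᵥ k = x - u at hk
          simp [hk]
      rw [finsum_eq_if, if_congr hiff rfl rfl]
    · intro u hu
      rw [Finset.mem_coe, Finsupp.mem_support_iff]
      intro h0
      exact hu (by simp [hG0 _ h0])
  rw [h1, h2]
  simp only [twistCorr, Matrix.sum_apply, Matrix.smul_apply, smul_eq_mul, Finset.mul_sum]
  rw [Finset.sum_comm]
  refine Finset.sum_congr rfl fun u _ => ?_
  have h3 : ∀ ω ∈ S, latChar ω x * (latChar ω (-u) * ((a u)ᴴ * a' (u + t)) q q') =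
      latChar ω (x - u) * G u := by
    intro ω _
    rw [← mul_assoc, ← latChar_add, ← sub_eq_add_neg]
  rw [Finset.sum_congr rfl h3, ← Finset.sum_mul]
  by_cases h : x - u ∈ R
  · rw [if_pos h, (hS _).1 h]
  · rw [if_neg h, (hS _).2 h, zero_mul]

/-- The exponential `e^{-i t·ξ}`. -/
def latExp (ξ : Euc d) (t : ZLat d) : ℂ :=
  Complex.exp (-Complex.I * ((∑ i, (t i : ℝ) * ξ i : ℝ) : ℂ))

lemma latExp_add (ξ : Euc d) (t u : ZLat d) : latExp ξ (t + u) = latExp ξ t * latExp ξ u := by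
  rw [latExp, latExp, latExp, ← Complex.exp_add, ← mul_add, ← Complex.ofReal_add,
    ← Finset.sum_add_distrib]
  simp [add_mul]

lemma conj_latExp (ξ : Euc d) (t : ZLat d) : conj (latExp ξ t) = latExp ξ (-t) := by
  rw [latExp, latExp, ← Complex.exp_conj, map_mul, Complex.conj_ofReal, map_neg, Complex.conj_I]
  congr 1
  simp

lemma latExp_add_left (ξ ω : Euc d) (t : ZLat d) :
    latExp (ξ + (2 * π) • ω) t = latExp ξ t * latChar ω (-t) := by
  rw [latExp, latExp, latChar, ← Complex.exp_add]
  congr 1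
  simp only [PiLp.add_apply, PiLp.smul_apply, smul_eq_mul, Pi.neg_apply, Int.cast_neg, mul_add,
    Finset.sum_add_distrib, Complex.ofReal_add, neg_mul, Finset.sum_neg_distrib,
    Complex.ofReal_neg]
  rw [show ∑ i, (t i : ℝ) * (2 * π * ω i) = 2 * π * ∑ i, (t i : ℝ) * ω i by
    rw [Finset.mul_sum]; exact Finset.sum_congr rfl fun i _ => by ring]
  push_cast
  ring

/-- The product of symbols is the Fourier series of the twisted correlation. -/
lemma conjTranspose_fourierSeries_mul {m n : ℕ} (a a' : MFilter d m n) (ξ ω : Euc d)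
    {T : Finset (ZLat d)} (hT : ∀ u t, a u ≠ 0 → a' (u + t) ≠ 0 → t ∈ T) :
    (fourierSeries a ξ)ᴴ * fourierSeries a' (ξ + (2 * π) • ω) =
      ∑ t ∈ T, latExp (ξ + (2 * π) • ω) t • twistCorr a a' ω t := by
  set η := ξ + (2 * π) • ω with hη
  have h1 : fourierSeries a ξ = ∑ u ∈ a.support, latExp ξ u • a u := rfl
  have h2 : fourierSeries a' η = ∑ v ∈ a'.support, latExp η v • a' v := rfl
  rw [h1, h2, Matrix.conjTranspose_sum, Matrix.sum_mul]
  simp only [twistCorr, Finset.smul_sum]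
  rw [Finset.sum_comm]
  refine Finset.sum_congr rfl fun u hu => ?_
  have h3 : ∑ v ∈ a'.support, latExp η v • a' v = ∑ t ∈ T, latExp η (u + t) • a' (u + t) := by
    rw [← finsum_eq_finsetSum_of_support_subset (fun v => latExp η v • a' v) (s := a'.support),
      ← finsum_eq_finsetSum_of_support_subset (fun t => latExp η (u + t) • a' (u + t)) (s := T)]
    · exact (finsum_comp_equiv (Equiv.addLeft u)).symm
    · intro t ht
      refine hT u t (Finsupp.mem_support_iff.mp hu) fun h0 => ht ?_
      simp [h0]
    · intro v hv
      rw [Finset.mem_coe, Finsupp.mem_support_iff]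
      intro h0
      exact hv (by simp [h0])
  rw [h3, Matrix.mul_sum]
  refine Finset.sum_congr rfl fun t _ => ?_
  rw [Matrix.conjTranspose_smul, Matrix.smul_mul, Matrix.mul_smul, smul_smul, smul_smul]
  congr 1
  rw [← starRingEnd_apply, conj_latExp, latExp_add, hη, latExp_add_left ξ ω u]
  have h4 : latExp ξ (-u) * latExp ξ u = 1 := by
    rw [← latExp_add]; simp [latExp]
  calc latExp ξ (-u) * (latExp ξ u * latChar ω (-u) * latExp (ξ + (2 * π) • ω) t)
      = (latExp ξ (-u) * latExp ξ u) * (latChar ω (-u) * latExp (ξ + (2 * π) • ω) t) := by ring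
    _ = _ := by rw [h4]; ring

lemma finite_correlation_shifts {m n : ℕ} (a a' : MFilter d m n) :
    {t | ∃ u, a u ≠ 0 ∧ a' (u + t) ≠ 0}.Finite := by
  classical
  refine (Finset.finite_toSet (a.support.biUnion fun u => a'.support.image fun v => v - u)).subset ?_
  rintro t ⟨u, hu, hv⟩
  rw [Finset.mem_coe, Finset.mem_biUnion]
  exact ⟨u, by simpa using hu, Finset.mem_image.mpr ⟨u + t, by simpa using hv, by simp⟩⟩

@[simp] lemma latVec_zero : latVec (0 : ZLat d) = 0 := by
  ext i
  simp [latVec]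

@[simp] lemma act_zero (A : Matrix (Fin d) (Fin d) ℝ) : act A 0 = 0 := by
  simp [act]

lemma zero_mem_Omega (M : Matrix (Fin d) (Fin d) ℤ) : (0 : Euc d) ∈ Omega M :=
  ⟨⟨0, by rw [latVec_zero, act_zero]⟩, fun i => by simp⟩

/-- One-level perfect reconstruction `Ṽ W = Id` gives the dual framelet identities: the entries of
`Ṽ W` are trigonometric polynomials in the row index whose coefficients must agree. -/
theorem isDualFrameletFilterBank_of_synAna {M : Dilations d s} (hM : ∀ l, IsDilation (M l))
    {B B' : FilterBank d r s} (h : SynAna (bankCoeff M B) (bankCoeff M B')) :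
    IsDualFrameletFilterBank M B B' := by
  classical
  choose S hSO hS using fun l => exists_Omega_finset (hM l)
  set U : Finset (Euc d) := Finset.univ.biUnion S with hU
  have hSU : ∀ l, S l ⊆ U := fun l => Finset.subset_biUnion_of_mem S (Finset.mem_univ l)
  have hmemS : ∀ l ω, ω ∈ S l ↔ ω ∈ Omega (M l) := fun l ω => by
    rw [← hSO l, Finset.mem_coe]
  have h0U : (0 : Euc d) ∈ U := hSU 0 ((hmemS 0 0).mpr (zero_mem_Omega _))
  set X : Fin (s + 1) → Euc d → ℂ := fun l => (Omega (M l)).indicator fun _ => (1 : ℂ) with hX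
  have hsumX : ∀ l (f : Euc d → ℂ), ∑ ω ∈ S l, f ω = ∑ ω ∈ U, X l ω * f ω := by
    intro l f
    rw [← Finset.sum_subset (hSU l) (f := fun ω => X l ω * f ω)]
    · refine Finset.sum_congr rfl fun ω hω => ?_
      simp [hX, (hmemS l ω).mp hω]
    · intro ω _ hω
      have : ω ∉ Omega (M l) := fun h' => hω ((hmemS l ω).mpr h')
      simp [hX, this]
  -- the coefficient identity for each frequency
  have hcoef : ∀ ω ∈ U, ∀ t, X 0 ω • twistCorr B.low B'.low ω t +
      ∑ l : Fin s, X l.succ ω • twistCorr (B.high l) (B'.high l) ω t =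
      if ω = 0 ∧ t = 0 then 1 else 0 := by
    intro ω hω t
    ext q q'
    refine sub_eq_zero.mp (eq_zero_of_sum_latChar (S := U) (a := fun ω =>
      (X 0 ω • twistCorr B.low B'.low ω t +
        ∑ l : Fin s, X l.succ ω • twistCorr (B.high l) (B'.high l) ω t) q q' -
        (if ω = 0 ∧ t = 0 then (1 : Matrix (Fin r) (Fin r) ℂ) else 0) q q') ?_ ?_ ω hω)
    · intro ω hω
      obtain ⟨l, -, hl⟩ := Finset.mem_biUnion.mp hω
      exact ((hmemS l ω).mp hl).2
    · intro x
      obtain ⟨F, hF0, hF1⟩ := exists_finset_shifts hM B x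
      have h1 := h (q, x) (q', x + t)
      rw [finsum_eq_finsetSum_of_support_subset
        (s := (Finset.univ ×ˢ F).disjSum (Finset.univ ×ˢ F)), Finset.sum_disjSum,
        Finset.sum_product, Finset.sum_product] at h1
      · have h2 := sum_filtCoeff_mul B.low B'.low (hM 0) (hS 0) x t q q' hF0
        have h3 : ∀ l, ∑ k ∈ F, conj (filtCoeff (B.high l) (M l.succ) 0 k (q, x)) *
            filtCoeff (B'.high l) (M l.succ) 0 k (q', x + t) = ∑ ω ∈ S l.succ,
              latChar ω x * twistCorr (B.high l) (B'.high l) ω t q q' := fun l =>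
          (Fin.sum_univ_one _).symm.trans
            (sum_filtCoeff_mul (B.high l) (B'.high l) (hM l.succ) (hS l.succ) x t q q' (hF1 l))
        simp only [bankCoeff] at h1
        rw [h2] at h1
        rw [Finset.sum_congr rfl fun l _ => h3 l] at h1
        simp only [hsumX] at h1
        simp only [Matrix.add_apply, Matrix.sum_apply, Matrix.smul_apply, smul_eq_mul, sub_mul,
          add_mul, Finset.sum_sub_distrib, Finset.sum_add_distrib, Finset.sum_mul]
        rw [sub_eq_zero]
        have h4 : ∑ ω ∈ U, (if ω = 0 ∧ t = 0 then (1 : Matrix (Fin r) (Fin r) ℂ) else 0) q q' *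
            latChar ω x = if (q, x) = (q', x + t) then 1 else 0 := by
          rw [Finset.sum_eq_single 0]
          · by_cases ht : t = 0 <;> simp [ht, Matrix.one_apply]
          · intro ω _ hω
            simp [hω]
          · exact fun h' => absurd h0U h'
        rw [h4]
        refine Eq.trans ?_ (h1.trans (by congr))
        rw [add_comm, Finset.sum_comm]
        congr 1
        · exact Finset.sum_congr rfl fun l _ => Finset.sum_congr rfl fun ω _ => by ring
        · exact Finset.sum_congr rfl fun ω _ => by ring
      · intro i hi
        refine mem_of_bankCoeff_ne_zero hF0 hF1 q i fun h0 => hi ?_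
        simp [h0]
  intro ω hω
  have hωU : ω ∈ U := by
    obtain ⟨l, hl⟩ := Set.mem_iUnion.mp hω
    exact hSU l ((hmemS l ω).mpr hl)
  refine Eventually.of_forall fun ξ => ?_
  -- a common finite set of shifts for all filters
  set T : Finset (ZLat d) := insert 0 ((finite_correlation_shifts B.low B'.low).toFinset ∪
    Finset.univ.biUnion fun l => (finite_correlation_shifts (B.high l) (B'.high l)).toFinset) with hT
  rw [conjTranspose_fourierSeries_mul B.low B'.low ξ ω (T := T) fun u t hu hv =>
    Finset.mem_insert_of_mem (Finset.mem_union_left _ (by simpa using ⟨u, hu, hv⟩))]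
  have h5 : ∀ l, (fourierSeries (B.high l) ξ)ᴴ * fourierSeries (B'.high l) (ξ + (2 * π) • ω) = _ :=
    fun l => conjTranspose_fourierSeries_mul (B.high l) (B'.high l) ξ ω (T := T) fun u t hu hv =>
      Finset.mem_insert_of_mem (Finset.mem_union_right _ (Finset.mem_biUnion.mpr
        ⟨l, Finset.mem_univ _, by simpa using ⟨u, hu, hv⟩⟩))
  simp only [h5]
  have h6 : ∀ t ∈ T, latExp (ξ + (2 * π) • ω) t • (X 0 ω • twistCorr B.low B'.low ω t +
      ∑ l : Fin s, X l.succ ω • twistCorr (B.high l) (B'.high l) ω t) =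
      if t = 0 then (({0} : Set (Euc d)).indicator
        (fun _ => (1 : Matrix (Fin r) (Fin r) ℂ)) ω) else 0 := by
    intro t _
    rw [hcoef ω hωU t]
    by_cases ht : t = 0
    · by_cases hω0 : ω = 0
      · simp [ht, hω0, latExp]
      · simp [hω0]
    · simp [ht]
  have h7 := Finset.sum_congr (rfl : T = T) h6
  rw [Finset.sum_ite_eq' T 0, if_pos (by simp [hT])] at h7
  rw [← h7]
  simp only [smul_add, Finset.sum_add_distrib, Finset.smul_sum]
  congr 1
  · exact Finset.sum_congr rfl fun t _ => smul_comm _ _ _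
  · rw [Finset.sum_comm]
    exact Finset.sum_congr rfl fun t _ => Finset.sum_congr rfl fun l _ => smul_comm _ _ _

/-! ### Dilation and translation in `L₂(ℝ^d)` -/

/-- The Hilbert space `L₂(ℝ^d)`. -/
abbrev L2 (d : ℕ) := Lp (α := Euc d) ℂ 2 volume

lemma act_eq_toEuclideanLin (A : Matrix (Fin d) (Fin d) ℝ) :
    act A = (Matrix.toEuclideanLin A : Euc d →ₗ[ℝ] Euc d) := rfl

lemma det_toEuclideanLin (A : Matrix (Fin d) (Fin d) ℝ) :
    LinearMap.det (Matrix.toEuclideanLin A : Euc d →ₗ[ℝ] Euc d) = A.det :=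
  (congrArg LinearMap.det (DFunLike.congr_fun (Matrix.toLpLin_eq_toLin 2 2) A)).trans
    (LinearMap.det_toLin _ A)

lemma continuous_act (A : Matrix (Fin d) (Fin d) ℝ) : Continuous (act A) := by
  rw [act_eq_toEuclideanLin]
  exact LinearMap.continuous_of_finiteDimensional _

lemma act_add (A : Matrix (Fin d) (Fin d) ℝ) (x y : Euc d) : act A (x + y) = act A x + act A y :=
  map_add (Matrix.toEuclideanLin A : Euc d →ₗ[ℝ] Euc d) x y

lemma act_sub (A : Matrix (Fin d) (Fin d) ℝ) (x y : Euc d) : act A (x - y) = act A x - act A y :=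
  map_sub (Matrix.toEuclideanLin A : Euc d →ₗ[ℝ] Euc d) x y

lemma act_inv_act {A : Matrix (Fin d) (Fin d) ℝ} (hA : A.det ≠ 0) (x : Euc d) :
    act A⁻¹ (act A x) = x := by
  rw [act_act, Matrix.nonsing_inv_mul _ hA.isUnit, act_one]

lemma act_act_inv {A : Matrix (Fin d) (Fin d) ℝ} (hA : A.det ≠ 0) (x : Euc d) :
    act A (act A⁻¹ x) = x := by
  rw [act_act, Matrix.mul_nonsing_inv _ hA.isUnit, act_one]

lemma act_injective {A : Matrix (Fin d) (Fin d) ℝ} (hA : A.det ≠ 0) :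
    Function.Injective (act A) :=
  Function.LeftInverse.injective (act_inv_act hA)

lemma measurableEmbedding_act {A : Matrix (Fin d) (Fin d) ℝ} (hA : A.det ≠ 0) :
    MeasurableEmbedding (act A) :=
  (continuous_act A).measurableEmbedding (act_injective hA)

lemma map_act {A : Matrix (Fin d) (Fin d) ℝ} (hA : A.det ≠ 0) :
    Measure.map (act A) (volume : Measure (Euc d)) = ENNReal.ofReal |A.det⁻¹| • volume := by
  rw [act_eq_toEuclideanLin, Measure.map_linearMap_addHaar_eq_smul_addHaar, det_toEuclideanLin]
  rwa [det_toEuclideanLin]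

lemma quasiMeasurePreserving_act {A : Matrix (Fin d) (Fin d) ℝ} (hA : A.det ≠ 0) :
    Measure.QuasiMeasurePreserving (act A) (volume : Measure (Euc d)) volume :=
  ⟨(continuous_act A).measurable, by
    rw [map_act hA]; exact Measure.smul_absolutelyContinuous⟩

lemma integral_comp_act {E : Type*} [NormedAddCommGroup E] [NormedSpace ℝ E]
    {A : Matrix (Fin d) (Fin d) ℝ} (hA : A.det ≠ 0) (f : Euc d → E) :
    ∫ x, f (act A x) = |A.det|⁻¹ • ∫ x, f x := by
  rw [← (measurableEmbedding_act hA).integral_map, map_act hA, integral_smul_measure,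
    ENNReal.toReal_ofReal (abs_nonneg _), abs_inv]

/-- The normalized dilation `x ↦ |det A|^{1/2} f(A x)`. -/
def dilFun (A : Matrix (Fin d) (Fin d) ℝ) (f : Euc d → ℂ) : Euc d → ℂ :=
  fun x => (sqrtAbsDet A : ℂ) * f (act A x)

lemma eLpNorm_dilFun {A : Matrix (Fin d) (Fin d) ℝ} (hA : A.det ≠ 0) (f : Euc d → ℂ) :
    eLpNorm (dilFun A f) 2 volume = eLpNorm f 2 volume := by
  have h1 : dilFun A f = (sqrtAbsDet A : ℂ) • (f ∘ act A) := rfl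
  rw [h1, eLpNorm_const_smul, ← (measurableEmbedding_act hA).eLpNorm_map_measure, map_act hA,
    eLpNorm_smul_measure_of_ne_top (by simp), smul_eq_mul, ← mul_assoc]
  have h2 : ‖(sqrtAbsDet A : ℂ)‖ₑ * ENNReal.ofReal |A.det⁻¹| ^ (1 / (2 : ℝ≥0∞)).toReal = 1 := by
    have hpos : 0 < |A.det| := abs_pos.mpr hA
    rw [abs_inv, ENNReal.ofReal_rpow_of_pos (by positivity), ← ofReal_norm, Complex.norm_real,
      ← ENNReal.ofReal_mul (norm_nonneg _), sqrtAbsDet, Real.norm_of_nonneg (Real.sqrt_nonneg _)]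
    have h3 : (1 / (2 : ℝ≥0∞)).toReal = 1 / 2 := by simp
    rw [h3, ← Real.sqrt_eq_rpow, ← Real.sqrt_mul (abs_nonneg _), mul_inv_cancel₀ hpos.ne']
    simp
  rw [h2, one_mul]

lemma memLp_dilFun {A : Matrix (Fin d) (Fin d) ℝ} (hA : A.det ≠ 0) {f : Euc d → ℂ}
    (hf : MemLp f 2 volume) : MemLp (dilFun A f) 2 volume := by
  refine ⟨(hf.1.comp_quasiMeasurePreserving (quasiMeasurePreserving_act hA)).const_mul _, ?_⟩
  rw [eLpNorm_dilFun hA]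
  exact hf.2

lemma dilFun_congr {A : Matrix (Fin d) (Fin d) ℝ} (hA : A.det ≠ 0) {f g : Euc d → ℂ}
    (h : f =ᵐ[volume] g) : dilFun A f =ᵐ[volume] dilFun A g := by
  filter_upwards [(quasiMeasurePreserving_act hA).ae h] with x hx
  rw [dilFun, dilFun, hx]

/-- The normalized dilation as a linear isometry of `L₂(ℝ^d)`. -/
def dilOp (A : Matrix (Fin d) (Fin d) ℝ) (hA : A.det ≠ 0) : L2 d →ₗᵢ[ℂ] L2 d where
  toFun f := (memLp_dilFun hA (Lp.memLp f)).toLp _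
  map_add' f g := by
    rw [← MemLp.toLp_add]
    refine MemLp.toLp_congr _ _ ((dilFun_congr hA (Lp.coeFn_add f g)).trans ?_)
    exact Eventually.of_forall fun x => by simp [dilFun, mul_add]
  map_smul' c f := by
    rw [RingHom.id_apply, ← MemLp.toLp_const_smul]
    refine MemLp.toLp_congr _ _ ((dilFun_congr hA (Lp.coeFn_smul c f)).trans ?_)
    exact Eventually.of_forall fun x => by simp [dilFun]; ring
  norm_map' f := by
    change ‖(memLp_dilFun hA (Lp.memLp f)).toLp _‖ = ‖f‖
    rw [Lp.norm_toLp, eLpNorm_dilFun hA, Lp.norm_def]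

lemma dilOp_toLp {A : Matrix (Fin d) (Fin d) ℝ} (hA : A.det ≠ 0) {f : Euc d → ℂ}
    (hf : MemLp f 2 volume) : dilOp A hA (hf.toLp f) = (memLp_dilFun hA hf).toLp _ :=
  MemLp.toLp_congr (memLp_dilFun hA (Lp.memLp _)) _ (dilFun_congr hA hf.coeFn_toLp)

lemma det_pow_ne_zero {A : Matrix (Fin d) (Fin d) ℝ} (hA : A.det ≠ 0) (j : ℕ) :
    (A ^ j).det ≠ 0 := by
  rw [Matrix.det_pow]
  exact pow_ne_zero _ hA

lemma dilFun_dilFun (A B : Matrix (Fin d) (Fin d) ℝ) (f : Euc d → ℂ) :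
    dilFun A (dilFun B f) = dilFun (B * A) f := by
  funext x
  rw [dilFun, dilFun, dilFun, act_act, ← mul_assoc, ← Complex.ofReal_mul, sqrtAbsDet, sqrtAbsDet,
    sqrtAbsDet, Matrix.det_mul, abs_mul, Real.sqrt_mul (abs_nonneg _), mul_comm]
  ring_nf

lemma dilOp_pow_toLp {A : Matrix (Fin d) (Fin d) ℝ} (hA : A.det ≠ 0) {f : Euc d → ℂ}
    (hf : MemLp f 2 volume) (j : ℕ) :
    (dilOp A hA ^ j) (hf.toLp f) = (memLp_dilFun (det_pow_ne_zero hA j) hf).toLp _ := by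
  induction j with
  | zero =>
    refine MemLp.toLp_congr hf _ (Eventually.of_forall fun x => ?_)
    simp [dilFun, sqrtAbsDet]
  | succ j ih =>
    rw [add_comm, pow_add_apply_isometry, ih, pow_one, dilOp_toLp]
    refine MemLp.toLp_congr _ _ (Eventually.of_forall fun x => ?_)
    rw [dilFun_dilFun, ← pow_succ, add_comm]

lemma memLp_sub_right {f : Euc d → ℂ} (hf : MemLp f 2 volume) (v : Euc d) :
    MemLp (fun x => f (x - v)) 2 volume :=
  hf.comp_measurePreserving (measurePreserving_sub_right volume v)

lemma inner_toLp {f g : Euc d → ℂ} (hf : MemLp f 2 volume) (hg : MemLp g 2 volume) :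
    inner ℂ (hf.toLp f) (hg.toLp g) = ∫ x, conj (f x) * g x := by
  rw [L2.inner_def]
  refine integral_congr_ae ?_
  filter_upwards [hf.coeFn_toLp, hg.coeFn_toLp] with x h1 h2
  rw [h1, h2, RCLike.inner_apply, mul_comm]

/-- The integer translates of the components of a vector function, as elements of `L₂(ℝ^d)`. -/
def shifts {ψ : Fin r → Euc d → ℂ} (hψ : ∀ q, MemLp (ψ q) 2 volume) : Fin r × ZLat d → L2 d :=
  fun i => (memLp_sub_right (hψ i.1) (latVec i.2)).toLp _

lemma latVec_sub (k l : ZLat d) : latVec (k - l) = latVec k - latVec l := by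
  ext i
  simp [latVec]

lemma latVec_add (k l : ZLat d) : latVec (k + l) = latVec k + latVec l := by
  ext i
  simp [latVec]

lemma inner_shifts {ψ ψ' : Fin r → Euc d → ℂ} (hψ : ∀ q, MemLp (ψ q) 2 volume)
    (hψ' : ∀ q, MemLp (ψ' q) 2 volume) (p q : Fin r) (k l : ZLat d) :
    inner ℂ (shifts hψ (q, k)) (shifts hψ' (p, l)) =
      innerMat ψ' (fun q x => ψ q (x - latVec (k - l))) p q := by
  rw [shifts, shifts, inner_toLp, innerMat, Matrix.of_apply,
    ← integral_sub_right_eq_self (μ := (volume : Measure (Euc d)))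
      (fun x => ψ' p x * conj (ψ q (x - latVec (k - l)))) (latVec l)]
  refine integral_congr_ae (Eventually.of_forall fun x => ?_)
  simp only [latVec_sub]
  rw [mul_comm, show x - latVec l - (latVec k - latVec l) = x - latVec k by abel]

lemma biorth_shifts_iff {ψ ψ' : Fin r → Euc d → ℂ} (hψ : ∀ q, MemLp (ψ q) 2 volume)
    (hψ' : ∀ q, MemLp (ψ' q) 2 volume) : Biorth (shifts hψ) (shifts hψ') ↔
      ∀ k : ZLat d, innerMat ψ' (fun q x => ψ q (x - latVec k)) = if k = 0 then 1 else 0 := by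
  constructor
  · intro h k
    ext p q
    have h1 := h (q, k) (p, 0)
    rw [inner_shifts, sub_zero] at h1
    rw [h1]
    by_cases hk : k = 0 <;> simp [hk, Matrix.one_apply, eq_comm]
  · rintro h ⟨q, k⟩ ⟨p, l⟩
    rw [inner_shifts, h]
    by_cases hk : k = l
    · simp [hk, Matrix.one_apply, eq_comm]
    · simp [hk, sub_eq_zero]

/-! ### The Bessel bound for integer translates -/

/-- Schur test: a bounded family whose Gram matrix has a bounded number of nonzero entries in each
row is a Bessel sequence. -/
lemma isBessel_of_gram {K H : Type*} [NormedAddCommGroup H] [InnerProductSpace ℂ H] {e : K → H}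
    {N : ℕ} {C : ℝ≥0} (nbr : K → Finset K) (hN : ∀ k, (nbr k).card ≤ N)
    (hnbr : ∀ k j, inner ℂ (e k) (e j) ≠ 0 → j ∈ nbr k) (hC : ∀ k, ‖e k‖ ≤ C) :
    IsBessel e (N * C ^ 2) := by
  classical
  intro c
  set G : K → K → ℝ := fun k j => ‖inner ℂ (e k) (e j)‖ with hG
  have hGs : ∀ k j, G k j = G j k := fun k j => norm_inner_symm _ _
  have hrow : ∀ k, ∑ j ∈ c.support, G k j ≤ N * C ^ 2 := by
    intro k
    have h1 : ∑ j ∈ c.support, G k j ≤ ∑ j ∈ nbr k, G k j := by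
      rw [← Finset.sum_filter_add_sum_filter_not c.support (· ∈ nbr k)]
      have h2 : ∑ j ∈ c.support with j ∉ nbr k, G k j = 0 := by
        refine Finset.sum_eq_zero fun j hj => ?_
        have h3 : inner ℂ (e k) (e j) = 0 := by
          by_contra h0
          exact (Finset.mem_filter.mp hj).2 (hnbr k j h0)
        rw [hG]
        simp [h3]
      rw [h2, add_zero]
      refine Finset.sum_le_sum_of_subset_of_nonneg (fun j hj => (Finset.mem_filter.mp hj).2)
        fun _ _ _ => norm_nonneg _
    refine h1.trans ((Finset.sum_le_card_nsmul _ _ ((C : ℝ) ^ 2) fun j _ => ?_).trans ?_)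
    · calc G k j ≤ ‖e k‖ * ‖e j‖ := norm_inner_le_norm _ _
        _ ≤ C * C := by gcongr <;> exact hC _
        _ = _ := by ring
    · rw [nsmul_eq_mul]
      gcongr
      exact hN k
  have hmain : ‖lc e c‖ ^ 2 ≤ (N * C ^ 2) * c.sum fun _ a => ‖a‖ ^ 2 := by
    have h1 : (‖lc e c‖ ^ 2 : ℝ) = ‖inner ℂ (lc e c) (lc e c)‖ := by
      rw [inner_self_eq_norm_sq_to_K]
      simp
    have h2 : ‖inner ℂ (lc e c) (lc e c)‖ ≤
        ∑ k ∈ c.support, ∑ j ∈ c.support, (‖c k‖ ^ 2 / 2 * G k j + ‖c j‖ ^ 2 / 2 * G k j) := by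
      rw [inner_lc_left, Finsupp.sum]
      refine (norm_sum_le _ _).trans (Finset.sum_le_sum fun k _ => ?_)
      rw [inner_lc_right, Finsupp.sum, Finset.mul_sum]
      refine (norm_sum_le _ _).trans (Finset.sum_le_sum fun j _ => ?_)
      rw [norm_mul, norm_mul, RCLike.norm_conj, ← mul_assoc, ← add_mul]
      refine mul_le_mul_of_nonneg_right ?_ (norm_nonneg _)
      nlinarith [sq_nonneg (‖c k‖ - ‖c j‖)]
    have h3 : ∑ k ∈ c.support, ∑ j ∈ c.support, (‖c k‖ ^ 2 / 2 * G k j + ‖c j‖ ^ 2 / 2 * G k j) =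
        ∑ k ∈ c.support, ‖c k‖ ^ 2 * ∑ j ∈ c.support, G k j := by
      simp only [Finset.sum_add_distrib]
      rw [Finset.sum_comm (f := fun k j => ‖c j‖ ^ 2 / 2 * G k j), ← Finset.sum_add_distrib]
      refine Finset.sum_congr rfl fun k _ => ?_
      rw [← Finset.sum_add_distrib, Finset.mul_sum]
      refine Finset.sum_congr rfl fun j _ => ?_
      rw [hGs j k]
      ring
    rw [h1]
    refine h2.trans (h3.le.trans ?_)
    rw [Finsupp.sum, Finset.mul_sum]
    refine Finset.sum_le_sum fun k _ => ?_
    rw [mul_comm]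
    exact mul_le_mul_of_nonneg_right (hrow k) (by positivity)
  rw [nsq_finsupp, enorm_sq_eq_ofReal, ← ENNReal.ofReal_coe_nnreal,
    ← ENNReal.ofReal_mul (NNReal.coe_nonneg _)]
  exact ENNReal.ofReal_le_ofReal (by push_cast; exact hmain)

lemma finite_latVec_norm_le (R : ℝ) : {t : ZLat d | ‖latVec t‖ ≤ R}.Finite := by
  refine (Set.finite_Icc (fun _ => -⌈R⌉ : ZLat d) (fun _ => ⌈R⌉)).subset fun t ht => ?_
  have h : ∀ i, |(t i : ℝ)| ≤ R := fun i => (PiLp.norm_apply_le (latVec t) i).trans ht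
  refine ⟨fun i => ?_, fun i => ?_⟩
  · have h1 := (abs_le.mp (h i)).1
    have h2 : ((-⌈R⌉ : ℤ) : ℝ) ≤ t i := by
      push_cast
      linarith [Int.le_ceil R]
    exact_mod_cast h2
  · have h1 := (abs_le.mp (h i)).2
    have h2 : (t i : ℝ) ≤ (⌈R⌉ : ℤ) := h1.trans (Int.le_ceil R)
    exact_mod_cast h2

/-- All components vanish almost everywhere outside the ball of radius `R`. -/
def SuppRadius (ψ : Fin r → Euc d → ℂ) (R : ℝ) : Prop := ∀ q, ∀ᵐ x : Euc d, R < ‖x‖ → ψ q x = 0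

lemma exists_suppRadius {ψ : Fin r → Euc d → ℂ} (h : ∀ q, EssCompactSupport (ψ q)) :
    ∃ R : ℝ, 0 ≤ R ∧ SuppRadius ψ R := by
  choose K hK hψ using h
  have h1 : ∀ q, ∃ R, ∀ x ∈ K q, ‖x‖ ≤ R := fun q => (hK q).isBounded.exists_norm_le
  choose R hR using h1
  refine ⟨∑ q, |R q|, Finset.sum_nonneg fun _ _ => abs_nonneg _, fun q => ?_⟩
  filter_upwards [hψ q] with x hx hlt
  refine hx fun hmem => hlt.not_ge ((hR q x hmem).trans ((le_abs_self _).trans ?_))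
  exact Finset.single_le_sum (f := fun q => |R q|) (fun _ _ => abs_nonneg _) (Finset.mem_univ q)

/-- The integer translates of compactly supported `L₂` functions form a Bessel sequence. -/
lemma exists_isBessel_shifts {ψ : Fin r → Euc d → ℂ} (hψ : ∀ q, MemLp (ψ q) 2 volume)
    (hs : ∀ q, EssCompactSupport (ψ q)) : ∃ B, IsBessel (shifts hψ) B := by
  classical
  obtain ⟨R, -, hR⟩ := exists_suppRadius hs
  set T := (finite_latVec_norm_le (d := d) (R + R)).toFinset with hT
  refine ⟨_, isBessel_of_gram (N := (Finset.univ ×ˢ T : Finset (Fin r × ZLat d)).card)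
    (C := ∑ q, ‖(hψ q).toLp (ψ q)‖₊)
    (fun i => (Finset.univ ×ˢ T).image fun j => (j.1, i.2 + j.2)) (fun i => Finset.card_image_le)
    ?_ ?_⟩
  · rintro ⟨q, k⟩ ⟨p, l⟩ hne
    rw [Finset.mem_image]
    refine ⟨(p, l - k), ?_, by simp⟩
    simp only [hT, Finset.mem_product, Finset.mem_univ, true_and, Set.Finite.mem_toFinset]
    change ‖latVec (l - k)‖ ≤ R + R
    by_contra hlt
    rw [not_le, latVec_sub] at hlt
    refine hne ?_
    rw [shifts, shifts, inner_toLp]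
    refine integral_eq_zero_of_ae ?_
    have h1 := (measurePreserving_sub_right volume (latVec k)).quasiMeasurePreserving.ae (hR q)
    have h2 := (measurePreserving_sub_right volume (latVec l)).quasiMeasurePreserving.ae (hR p)
    filter_upwards [h1, h2] with x hx1 hx2
    simp only [Pi.zero_apply, mul_eq_zero, map_eq_zero]
    by_contra hcon
    push Not at hcon
    have h3 : ‖x - latVec k‖ ≤ R := not_lt.mp fun h => hcon.1 (hx1 h)
    have h4 : ‖x - latVec l‖ ≤ R := not_lt.mp fun h => hcon.2 (hx2 h)
    have h5 : latVec l - latVec k = (x - latVec k) - (x - latVec l) := by abel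
    rw [h5] at hlt
    linarith [norm_sub_le (x - latVec k) (x - latVec l)]
  · rintro ⟨q, k⟩
    have h1 : ‖shifts hψ (q, k)‖ = ‖(hψ q).toLp (ψ q)‖ := by
      rw [shifts, Lp.norm_toLp, Lp.norm_toLp]
      congr 1
      exact eLpNorm_comp_measurePreserving (hψ q).1 (measurePreserving_sub_right volume (latVec k))
    rw [h1]
    push_cast
    exact Finset.single_le_sum (f := fun q => ‖(hψ q).toLp (ψ q)‖) (fun _ _ => norm_nonneg _)
      (Finset.mem_univ q)

/-! ### Two-scale relations in the time domain -/

/-- On `L₁ ∩ L₂` the Plancherel extension of the Fourier transform is the Fourier integral. -/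
lemma fourier_toLp_ae {g : Euc d → ℂ} (h1 : Integrable g) (h2 : MemLp g 2 volume) :
    ∀ᵐ ξ : Euc d, (𝓕 (h2.toLp g) : L2 d) ξ = 𝓕 g ξ := by
  have hcont : Continuous (𝓕 g) :=
    VectorFourier.fourierIntegral_continuous Real.continuous_fourierChar continuous_inner h1
  refine ae_eq_of_integral_contDiff_smul_eq
    ((Lp.memLp (𝓕 (h2.toLp g) : L2 d)).locallyIntegrable (by norm_num))
    hcont.locallyIntegrable fun φ hφ hφs => ?_
  have hφ' : ContDiff ℝ ((⊤ : ℕ∞) : WithTop ℕ∞) fun x => (φ x : ℂ) := Complex.ofRealCLM.contDiff.comp hφ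
  have hφs' : HasCompactSupport fun x => (φ x : ℂ) := hφs.comp_left (g := Complex.ofReal) (by simp)
  set Φ : SchwartzMap (Euc d) ℂ := hφs'.toSchwartzMap hφ' with hΦ
  have e1 : ∫ x, φ x • (𝓕 (h2.toLp g) : L2 d) x =
      Lp.toTemperedDistribution (𝓕 (h2.toLp g) : L2 d) Φ := by
    rw [Lp.toTemperedDistribution_apply]
    exact integral_congr_ae (Eventually.of_forall fun x => by simp [hΦ])
  have e2 : ∫ x, φ x • 𝓕 g x = ∫ x, (𝓕 (Φ : Euc d → ℂ)) x • g x := by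
    have := VectorFourier.integral_fourierIntegral_smul_eq_flip (L := innerₗ (Euc d))
      (μ := volume) (ν := volume) Real.continuous_fourierChar continuous_inner
      (f := (Φ : Euc d → ℂ)) (g := g) Φ.integrable h1
    rw [flip_innerₗ] at this
    refine Eq.trans ?_ this.symm
    refine integral_congr_ae (Eventually.of_forall fun x => ?_)
    change φ x • 𝓕 g x = (φ x : ℂ) • 𝓕 g x
    rw [Complex.coe_smul]
  rw [e1, e2, ← Lp.fourier_toTemperedDistribution_eq, TemperedDistribution.fourier_apply,
    Lp.toTemperedDistribution_apply]
  refine integral_congr_ae ?_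
  filter_upwards [h2.coeFn_toLp] with x hx
  rw [hx, SchwartzMap.fourier_coe]

/-- The Fourier integral `∫ f(x) e^{-i x·ξ} dx`. -/
def ftInt (f : Euc d → ℂ) (ξ : Euc d) : ℂ :=
  ∫ x : Euc d, Complex.exp (-Complex.I * ((∑ i, x i * ξ i : ℝ) : ℂ)) * f x

lemma ftVec_apply (ψ : Fin r → Euc d → ℂ) (ξ : Euc d) (q : Fin r) :
    ftVec ψ ξ q = ftInt (ψ q) ξ := rfl

lemma ftInt_eq_fourier (f : Euc d → ℂ) (ξ : Euc d) : ftInt f ξ = 𝓕 f ((2 * π)⁻¹ • ξ) := by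
  rw [Real.fourier_eq', ftInt]
  refine integral_congr_ae (Eventually.of_forall fun x => ?_)
  have h1 : (-2 * π * inner ℝ x ((2 * π)⁻¹ • ξ) : ℝ) = -∑ i, x i * ξ i := by
    rw [inner_smul_right, PiLp.inner_apply]
    simp only [RCLike.inner_apply, conj_trivial]
    have : ∑ i, ξ i * x i = ∑ i, x i * ξ i := Finset.sum_congr rfl fun i _ => mul_comm _ _
    rw [this]
    field_simp
  simp only [h1, smul_eq_mul]
  congr 2
  push_cast
  ring

lemma two_pi_inv_ne_zero : (2 * π : ℝ)⁻¹ ≠ 0 := by positivity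

lemma ftL2_toLp_ae {g : Euc d → ℂ} (h1 : Integrable g) (h2 : MemLp g 2 volume) :
    ∀ᵐ ξ : Euc d, ftL2 (h2.toLp g) ξ = ftInt g ξ := by
  have := (Measure.quasiMeasurePreserving_smul (volume : Measure (Euc d)) two_pi_inv_ne_zero).ae
    (fourier_toLp_ae h1 h2)
  filter_upwards [this] with ξ hξ
  rw [ftL2, hξ, ftInt_eq_fourier]

lemma eq_of_ftL2_ae_eq {f g : L2 d} (h : ∀ᵐ ξ : Euc d, ftL2 f ξ = ftL2 g ξ) : f = g := by
  have h2 : (2 * π : ℝ) ≠ 0 := by positivity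
  have h1 := (Measure.quasiMeasurePreserving_smul (volume : Measure (Euc d)) h2).ae h
  have h3 : (𝓕 f : L2 d) = 𝓕 g := by
    refine Lp.ext ?_
    filter_upwards [h1] with ξ hξ
    simpa only [ftL2, smul_smul, inv_mul_cancel₀ h2, one_smul] using hξ
  exact (Lp.fourierTransformₗᵢ (Euc d) ℂ).injective h3

lemma integrable_of_suppRadius {ψ : Fin r → Euc d → ℂ} (hψ : ∀ q, MemLp (ψ q) 2 volume) {R : ℝ}
    (hR : SuppRadius ψ R) (q : Fin r) : Integrable (ψ q) := by
  have h1 : ψ q =ᵐ[volume] (Metric.closedBall 0 R).indicator (ψ q) := by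
    filter_upwards [hR q] with x hx
    by_cases h : x ∈ Metric.closedBall (0 : Euc d) R
    · simp [h]
    · rw [Set.indicator_of_notMem h]
      exact hx (by simpa using h)
  have hfin : volume (Metric.closedBall (0 : Euc d) R) ≠ ∞ := measure_closedBall_lt_top.ne
  have : IsFiniteMeasure (volume.restrict (Metric.closedBall (0 : Euc d) R)) :=
    ⟨by simpa using measure_closedBall_lt_top⟩
  have h2 : Integrable (ψ q) (volume.restrict (Metric.closedBall (0 : Euc d) R)) :=
    ((hψ q).restrict _).integrable (by norm_num)
  exact (integrable_congr h1).mpr ((integrable_indicator_iff measurableSet_closedBall).mpr h2)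

lemma integrable_dilFun {A : Matrix (Fin d) (Fin d) ℝ} (hA : A.det ≠ 0) {f : Euc d → ℂ}
    (hf : Integrable f) : Integrable (dilFun A f) := by
  refine Integrable.const_mul ?_ _
  have h1 : Integrable f (Measure.map (act A) volume) := by
    rw [map_act hA]
    exact hf.smul_measure (by simp)
  exact (measurableEmbedding_act hA).integrable_map_iff.mp h1

lemma norm_exp_neg_I_mul (t : ℝ) : ‖Complex.exp (-Complex.I * (t : ℂ))‖ = 1 := by
  rw [show -Complex.I * (t : ℂ) = ((-t : ℝ) : ℂ) * Complex.I by push_cast; ring]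
  exact Complex.norm_exp_ofReal_mul_I _

lemma integrable_exp_mul {f : Euc d → ℂ} (hf : Integrable f) (ξ : Euc d) :
    Integrable fun x : Euc d => Complex.exp (-Complex.I * ((∑ i, x i * ξ i : ℝ) : ℂ)) * f x := by
  refine hf.bdd_mul (c := 1) (Continuous.aestronglyMeasurable (by fun_prop))
    (Eventually.of_forall fun x => ?_)
  rw [norm_exp_neg_I_mul]

lemma sum_act_mul (A : Matrix (Fin d) (Fin d) ℝ) (x η : Euc d) :
    ∑ i, act A x i * η i = ∑ i, x i * act Aᵀ η i := by
  simp only [act, Matrix.mulVec, dotProduct, Matrix.transpose_apply, Finset.sum_mul,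
    Finset.mul_sum]
  rw [Finset.sum_comm]
  exact Finset.sum_congr rfl fun i _ => Finset.sum_congr rfl fun j _ => by ring

lemma ftInt_dilFun_sub {A : Matrix (Fin d) (Fin d) ℝ} (hA : A.det ≠ 0) (f : Euc d → ℂ)
    (n : ZLat d) (ξ : Euc d) : ftInt (dilFun A fun y => f (y - latVec n)) ξ =
      (sqrtAbsDet A : ℂ) * ((|A.det|⁻¹ : ℝ) : ℂ) *
        (latExp (act Aᵀ⁻¹ ξ) n * ftInt f (act Aᵀ⁻¹ ξ)) := by
  set η := act Aᵀ⁻¹ ξ with hη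
  have hξ : act Aᵀ η = ξ := by
    rw [hη, act_act_inv]
    rwa [Matrix.det_transpose]
  set F : Euc d → ℂ := fun y =>
    Complex.exp (-Complex.I * ((∑ i, y i * η i : ℝ) : ℂ)) * f (y - latVec n) with hF
  have h1 : ftInt (dilFun A fun y => f (y - latVec n)) ξ =
      ∫ x, (sqrtAbsDet A : ℂ) * F (act A x) := by
    refine integral_congr_ae (Eventually.of_forall fun x => ?_)
    simp only [hF, dilFun, sum_act_mul, hξ]
    ring
  have h2 : ∫ y, F y = latExp η n * ftInt f η := by
    rw [← integral_add_right_eq_self F (latVec n), ftInt, ← integral_const_mul]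
    refine integral_congr_ae (Eventually.of_forall fun y => ?_)
    simp only [hF, add_sub_cancel_right]
    rw [← mul_assoc, latExp, ← Complex.exp_add, ← mul_add, ← Complex.ofReal_add,
      ← Finset.sum_add_distrib]
    have h3 : ∑ i, (y + latVec n) i * η i = ∑ i, ((n i : ℝ) * η i + y i * η i) :=
      Finset.sum_congr rfl fun i _ => by simp [latVec]; ring
    rw [h3]
  rw [h1, integral_const_mul, integral_comp_act hA, h2, Complex.real_smul]
  ring

/-- A refinement relation in the Fourier domain is a two-scale relation in the time domain. -/
lemma two_scale_of_ftL2 {ψ : Fin r → Euc d → ℂ} (hψ : ∀ q, MemLp (ψ q) 2 volume) {R : ℝ}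
    (hR : SuppRadius ψ R) {A : Matrix (Fin d) (Fin d) ℝ} (hA : A.det ≠ 0) {m : ℕ}
    (a : MFilter d m r) (p : Fin m) {f : Euc d → ℂ} (hf : MemLp f 2 volume)
    (h : ∀ᵐ ξ : Euc d, ftL2 (hf.toLp f) ξ =
      (fourierSeries a (act Aᵀ⁻¹ ξ) *ᵥ ftVec ψ (act Aᵀ⁻¹ ξ)) p) :
    ∀ᵐ x : Euc d, f x = (sqrtAbsDet A : ℂ) *
      ∑ n ∈ a.support, ∑ q, a n p q * dilFun A (fun y => ψ q (y - latVec n)) x := by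
  set g : Euc d → ℂ := fun x => (sqrtAbsDet A : ℂ) *
      ∑ n ∈ a.support, ∑ q, a n p q * dilFun A (fun y => ψ q (y - latVec n)) x with hg
  have hint : ∀ n q, Integrable (dilFun A fun y => ψ q (y - latVec n)) := fun n q =>
    integrable_dilFun hA ((integrable_of_suppRadius hψ hR q).comp_sub_right (latVec n))
  have hg1 : Integrable g := (integrable_finsetSum _ fun n _ => integrable_finsetSum _ fun q _ =>
    (hint n q).const_mul _).const_mul _
  have hg2 : MemLp g 2 volume := (memLp_finsetSum _ fun n _ => memLp_finsetSum _ fun q _ =>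
    (memLp_dilFun hA (memLp_sub_right (hψ q) (latVec n))).const_mul _).const_mul _
  have hft : ∀ ξ, ftInt g ξ = (fourierSeries a (act Aᵀ⁻¹ ξ) *ᵥ ftVec ψ (act Aᵀ⁻¹ ξ)) p := by
    intro ξ
    have h1 : ftInt g ξ = (sqrtAbsDet A : ℂ) * ∑ n ∈ a.support, ∑ q, a n p q *
        ftInt (dilFun A fun y => ψ q (y - latVec n)) ξ := by
      have h2 : ∀ x : Euc d, Complex.exp (-Complex.I * ((∑ i, x i * ξ i : ℝ) : ℂ)) * g x =
          (sqrtAbsDet A : ℂ) * ∑ n ∈ a.support, ∑ q, a n p q *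
            (Complex.exp (-Complex.I * ((∑ i, x i * ξ i : ℝ) : ℂ)) *
              dilFun A (fun y => ψ q (y - latVec n)) x) := by
        intro x
        rw [hg]
        simp only [Finset.mul_sum]
        exact Finset.sum_congr rfl fun n _ => Finset.sum_congr rfl fun q _ => by ring
      rw [ftInt]
      simp only [h2]
      rw [integral_const_mul, integral_finsetSum]
      · congr 1
        refine Finset.sum_congr rfl fun n _ => ?_
        rw [integral_finsetSum]
        · exact Finset.sum_congr rfl fun q _ => integral_const_mul _ _
        · exact fun q _ => (integrable_exp_mul (hint n q) ξ).const_mul _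
      · exact fun n _ => integrable_finsetSum _ fun q _ =>
          (integrable_exp_mul (hint n q) ξ).const_mul _
    rw [h1]
    simp only [ftInt_dilFun_sub hA]
    have hdet : (sqrtAbsDet A : ℂ) * (sqrtAbsDet A * ((|A.det|⁻¹ : ℝ) : ℂ)) = 1 := by
      rw [← mul_assoc, sqrtAbsDet_mul_self, ← Complex.ofReal_mul,
        mul_inv_cancel₀ (abs_pos.mpr hA).ne', Complex.ofReal_one]
    rw [Matrix.mulVec, dotProduct]
    change _ = ∑ q, (∑ n ∈ a.support, latExp (act Aᵀ⁻¹ ξ) n • a n) p q * _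
    simp only [Matrix.sum_apply, Matrix.smul_apply, smul_eq_mul, Finset.sum_mul, Finset.mul_sum]
    rw [Finset.sum_comm]
    refine Finset.sum_congr rfl fun q _ => Finset.sum_congr rfl fun n _ => ?_
    rw [ftVec_apply]
    linear_combination (a n p q * latExp (act Aᵀ⁻¹ ξ) n * ftInt (ψ q) (act Aᵀ⁻¹ ξ)) * hdet
  have heq : hf.toLp f = hg2.toLp g := by
    refine eq_of_ftL2_ae_eq ?_
    filter_upwards [h, ftL2_toLp_ae hg1 hg2] with ξ h1 h2
    rw [h1, h2, hft]
  filter_upwards [hf.coeFn_toLp, hg2.coeFn_toLp] with x h1 h2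
  rw [← h1, heq, h2]

lemma sum_smul_toLp {ι : Type*} (F : Finset ι) (c : ι → ℂ) {f : ι → Euc d → ℂ}
    (hf : ∀ i, MemLp (f i) 2 volume) :
    ∑ i ∈ F, c i • (hf i).toLp (f i) =
      (memLp_finsetSum F fun i _ => (hf i).const_mul (c i)).toLp
        (fun x => ∑ i ∈ F, c i * f i x) := by
  classical
  refine Lp.ext ?_
  have h1 : ∀ G : Finset ι, ((∑ i ∈ G, c i • (hf i).toLp (f i) : L2 d) : Euc d → ℂ) =ᵐ[volume]
      fun x => ∑ i ∈ G, c i * f i x := by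
    intro G
    induction G using Finset.induction_on with
    | empty =>
      filter_upwards [Lp.coeFn_zero ℂ 2 (volume : Measure (Euc d))] with x hx
      simp
    | insert i G hi ih =>
      rw [Finset.sum_insert hi]
      filter_upwards [ih, Lp.coeFn_add (c i • (hf i).toLp (f i)) (∑ i ∈ G, c i • (hf i).toLp (f i)),
        Lp.coeFn_smul (c i) ((hf i).toLp (f i)), (hf i).coeFn_toLp] with x h1 h2 h3 h4
      rw [h2, Pi.add_apply, h1, h3, Pi.smul_apply, h4, Finset.sum_insert hi, smul_eq_mul]
  exact (h1 F).trans (MemLp.coeFn_toLp _).symm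

lemma latVec_mulVec (M : Matrix (Fin d) (Fin d) ℤ) (k : ZLat d) :
    latVec (M *ᵥ k) = act (realMat M) (latVec k) := by
  ext i
  simp [latVec, act, realMat, Matrix.mulVec, dotProduct]

/-- The translate by `A⁻¹ M k` of a function with a two-scale relation is the dilate of the linear
combination of shifts whose coefficients are those of the filter. -/
lemma toLp_eq_dilOp_lc {ψ : Fin r → Euc d → ℂ} (hψ : ∀ q, MemLp (ψ q) 2 volume)
    {A : Matrix (Fin d) (Fin d) ℝ} (hA : A.det ≠ 0) {m : ℕ} (a : MFilter d m r) (p : Fin m)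
    {f : Euc d → ℂ} (h : ∀ᵐ x : Euc d, f x = (sqrtAbsDet A : ℂ) *
      ∑ n ∈ a.support, ∑ q, a n p q * dilFun A (fun y => ψ q (y - latVec n)) x)
    (M : Matrix (Fin d) (Fin d) ℤ) (k : ZLat d)
    (hmem : MemLp (fun x => (sqrtAbsDet (A⁻¹ * realMat M) : ℂ) *
      f (x - act (A⁻¹ * realMat M) (latVec k))) 2 volume) :
    hmem.toLp _ = dilOp A hA (lc (shifts hψ) (filtCoeff a M p k)) := by
  classical
  set F : Finset (Fin r × ZLat d) := Finset.univ ×ˢ a.support.image (· + M *ᵥ k) with hF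
  have hsub : (filtCoeff a M p k).support ⊆ F := by
    rintro ⟨q, x⟩ hx
    simp only [hF, Finset.mem_product, Finset.mem_univ, true_and, Finset.mem_image]
    refine ⟨x - M *ᵥ k, ?_, by simp⟩
    rw [Finsupp.mem_support_iff] at hx ⊢
    exact fun h0 => hx (by rw [filtCoeff_apply, h0]; simp)
  have h1 : dilOp A hA (lc (shifts hψ) (filtCoeff a M p k)) = ∑ i ∈ F, filtCoeff a M p k i •
      (memLp_dilFun hA (memLp_sub_right (hψ i.1) (latVec i.2))).toLp _ := by
    rw [map_lc, lc, Finsupp.linearCombination_apply,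
      Finsupp.sum_of_support_subset _ hsub _ (by simp)]
    refine Finset.sum_congr rfl fun i _ => ?_
    rw [shifts, dilOp_toLp]
  rw [h1, sum_smul_toLp F (fun i => filtCoeff a M p k i)
    (fun i => memLp_dilFun hA (memLp_sub_right (hψ i.1) (latVec i.2)))]
  refine MemLp.toLp_congr _ _ ?_
  set v := act (A⁻¹ * realMat M) (latVec k) with hv
  have hAv : act A v = latVec (M *ᵥ k) := by
    rw [hv, act_act, ← mul_assoc, Matrix.mul_nonsing_inv _ hA.isUnit, one_mul, latVec_mulVec]
  have hc : (sqrtAbsDet (A⁻¹ * realMat M) : ℂ) * sqrtAbsDet A = sqrtAbsDet (realMat M) := by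
    rw [← Complex.ofReal_mul, sqrtAbsDet, sqrtAbsDet, sqrtAbsDet, ← Real.sqrt_mul (abs_nonneg _),
      ← abs_mul, ← Matrix.det_mul, Matrix.mul_assoc, Matrix.det_mul, Matrix.det_mul, mul_comm,
      mul_assoc, ← Matrix.det_mul A, Matrix.mul_nonsing_inv _ hA.isUnit, Matrix.det_one, mul_one]
  filter_upwards [(measurePreserving_sub_right volume v).quasiMeasurePreserving.ae h] with x hx
  rw [hx, ← mul_assoc, hc, hF, Finset.sum_product_right, Finset.sum_image (by simp), Finset.mul_sum]
  refine Finset.sum_congr rfl fun n _ => ?_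
  rw [Finset.mul_sum]
  refine Finset.sum_congr rfl fun q _ => ?_
  rw [filtCoeff_apply, add_sub_cancel_right, ← mul_assoc]
  congr 1
  rw [dilFun, dilFun, act_sub, hAv, latVec_add, sub_sub, add_comm (latVec n)]

/-! ### Density of the dilated shift-invariant spaces -/

lemma tendsto_norm_pow_of_spectralRadius_lt_one {A : Type*} [NormedRing A] [NormedAlgebra ℂ A]
    [CompleteSpace A] {a : A} (h : spectralRadius ℂ a < 1) :
    Tendsto (fun J : ℕ => ‖a ^ J‖) atTop (𝓝 0) := by
  obtain ⟨c, hc1, hc2⟩ := exists_between h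
  have hev := (spectrum.pow_nnnorm_pow_one_div_tendsto_nhds_spectralRadius a).eventually_lt_const hc1
  rw [← tendsto_zero_iff_norm_tendsto_zero, tendsto_zero_iff_enorm_tendsto_zero]
  refine tendsto_of_tendsto_of_tendsto_of_le_of_le' tendsto_const_nhds
    (ENNReal.tendsto_pow_atTop_nhds_zero_of_lt_one hc2) (Eventually.of_forall fun _ => zero_le)
    ?_
  filter_upwards [hev, eventually_gt_atTop 0] with J hJ hJ0
  have hJ' : (0 : ℝ) < J := by exact_mod_cast hJ0
  have h1 := ENNReal.rpow_le_rpow hJ.le hJ'.le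
  rwa [← ENNReal.rpow_mul, one_div, inv_mul_cancel₀ hJ'.ne', ENNReal.rpow_one,
    ENNReal.rpow_natCast] at h1

/-- The powers of the inverse of a dilation matrix tend to zero, uniformly on bounded sets. -/
lemma IsDilation.eventually_norm_act_le (hd : 0 < d) {M : Matrix (Fin d) (Fin d) ℤ}
    (hM : IsDilation M) (R : ℝ) {δ : ℝ} (hδ : 0 < δ) :
    ∀ᶠ J : ℕ in atTop, ∀ y : Euc d, ‖y‖ ≤ R → ‖act (realMat M ^ J)⁻¹ y‖ ≤ δ := by
  have : Nonempty (Fin d) := ⟨⟨0, hd⟩⟩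
  let : NormedRing (Matrix (Fin d) (Fin d) ℂ) := Matrix.linftyOpNormedRing
  let : NormedAlgebra ℂ (Matrix (Fin d) (Fin d) ℂ) := Matrix.linftyOpNormedAlgebra
  have : CompleteSpace (Matrix (Fin d) (Fin d) ℂ) := FiniteDimensional.complete ℂ _
  obtain ⟨u, hu⟩ := hM.isUnit_map
  set N : Matrix (Fin d) (Fin d) ℂ := (u⁻¹).val with hN
  have hrad : spectralRadius ℂ N < 1 := by
    refine spectrum.spectralRadius_lt_of_forall_lt N (r := 1) fun k hk => ?_
    have hk0 : k ≠ 0 := by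
      rintro rfl
      exact (spectrum.zero_notMem_iff ℂ).mpr (u⁻¹).isUnit hk
    have h1 : ((Units.mk0 k hk0)⁻¹ : ℂˣ).1 ∈ spectrum ℂ (u : Matrix (Fin d) (Fin d) ℂ) := by
      have := (spectrum.inv_mem_iff (r := (Units.mk0 k hk0)) (a := u⁻¹)).mp hk
      rwa [inv_inv] at this
    rw [hu] at h1
    have h2 := hM _ h1
    rw [Units.val_inv_eq_inv_val, Units.val_mk0, norm_inv] at h2
    have h3 : ‖k‖ < 1 := (one_lt_inv₀ (norm_pos_iff.mpr hk0)).mp h2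
    exact_mod_cast h3
  have hpow := tendsto_norm_pow_of_spectralRadius_lt_one hrad
  have hentry : ∀ J i j, ‖(N ^ J) i j‖ ≤ ‖N ^ J‖ := by
    intro J i j
    rw [Matrix.linfty_opNorm_def, ← coe_nnnorm]
    refine NNReal.coe_le_coe.mpr (le_trans ?_ (Finset.le_sup (Finset.mem_univ i)))
    exact Finset.single_le_sum (f := fun j => ‖(N ^ J) i j‖₊) (fun _ _ => zero_le)
      (Finset.mem_univ j)
  -- transfer the convergence of the entries to the real matrices
  have hmap : ∀ J, ((realMat M ^ J)⁻¹).map (fun x : ℝ => (x : ℂ)) = N ^ J := by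
    intro J
    set φ := (Complex.ofRealHom.mapMatrix : Matrix (Fin d) (Fin d) ℝ →+* Matrix (Fin d) (Fin d) ℂ)
    have h1 : φ (realMat M) = u := by
      rw [hu]
      ext i j
      simp [φ, realMat]
    have h2 : φ ((realMat M ^ J)⁻¹) * (u : Matrix (Fin d) (Fin d) ℂ) ^ J = 1 := by
      rw [← h1, ← map_pow, ← map_mul, Matrix.nonsing_inv_mul _
        (det_pow_ne_zero hM.det_realMat_ne_zero J).isUnit, map_one]
    have h3 : (u : Matrix (Fin d) (Fin d) ℂ) ^ J * N ^ J = 1 := by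
      rw [hN, ← Units.val_pow_eq_pow_val, ← Units.val_pow_eq_pow_val, ← Units.val_mul, inv_pow,
        mul_inv_cancel, Units.val_one]
    change φ _ = _
    calc φ ((realMat M ^ J)⁻¹) = φ ((realMat M ^ J)⁻¹) *
          ((u : Matrix (Fin d) (Fin d) ℂ) ^ J * N ^ J) := by rw [h3, mul_one]
      _ = N ^ J := by rw [← mul_assoc, h2, one_mul]
  have hreal : Tendsto (fun J => (realMat M ^ J)⁻¹) atTop (𝓝 0) := by
    refine tendsto_pi_nhds.mpr fun i => tendsto_pi_nhds.mpr fun j => ?_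
    have h1 : Tendsto (fun J => (N ^ J) i j) atTop (𝓝 0) :=
      squeeze_zero_norm (fun J => hentry J i j) hpow
    have h2 := (Complex.continuous_re.tendsto 0).comp h1
    refine h2.congr fun J => ?_
    rw [Function.comp_apply, ← hmap]
    simp
  set T : Matrix (Fin d) (Fin d) ℝ →ₗ[ℝ] (Euc d →L[ℝ] Euc d) :=
    (Matrix.toEuclideanCLM (n := Fin d) (𝕜 := ℝ)).toAlgEquiv.toLinearMap with hT
  have hTc : Continuous T := LinearMap.continuous_of_finiteDimensional T
  have h0 : Tendsto (fun J => ‖T ((realMat M ^ J)⁻¹)‖) atTop (𝓝 0) := by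
    have := ((hTc.norm).tendsto 0).comp hreal
    simpa [Function.comp_def] using this
  have hpos : 0 < δ / (|R| + 1) := by positivity
  filter_upwards [h0.eventually_lt_const hpos] with J hJ y hy
  have h1 : act (realMat M ^ J)⁻¹ y = T ((realMat M ^ J)⁻¹) y := rfl
  rw [h1]
  calc _ ≤ ‖T ((realMat M ^ J)⁻¹)‖ * ‖y‖ := ContinuousLinearMap.le_opNorm _ _
    _ ≤ δ / (|R| + 1) * (|R| + 1) := by
      gcongr
      linarith [le_abs_self R]
    _ = δ := by field_simp

/-- The half-open unit cube with corner `k`. -/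
def cube (k : ZLat d) : Set (Euc d) := {x | ∀ i, ⌊x i⌋ = k i}

lemma cube_eq_preimage (k : ZLat d) : cube k = (WithLp.ofLp : Euc d → Fin d → ℝ) ⁻¹'
    (Set.univ.pi fun i => Set.Ico (k i : ℝ) (k i + 1)) := by
  ext x
  simp [cube, Int.floor_eq_iff]

lemma measurableSet_cube (k : ZLat d) : MeasurableSet (cube k) := by
  rw [cube_eq_preimage]
  exact (PiLp.volume_preserving_ofLp (Fin d)).measurable
    (MeasurableSet.univ_pi fun _ => measurableSet_Ico)

lemma volume_cube (k : ZLat d) : volume (cube k) = 1 := by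
  rw [cube_eq_preimage, (PiLp.volume_preserving_ofLp (Fin d)).measure_preimage
    (MeasurableSet.univ_pi fun _ => measurableSet_Ico).nullMeasurableSet, Real.volume_pi_Ico]
  simp

lemma disjoint_cube {k l : ZLat d} (h : k ≠ l) : Disjoint (cube k) (cube l) := by
  rw [Set.disjoint_left]
  intro x hk hl
  exact h (funext fun i => (hk i).symm.trans (hl i))

lemma norm_sub_latVec_le {k : ZLat d} {x : Euc d} (hx : x ∈ cube k) :
    ‖x - latVec k‖ ≤ Real.sqrt d := by
  rw [EuclideanSpace.norm_eq]
  refine Real.sqrt_le_sqrt ?_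
  calc ∑ i, ‖(x - latVec k) i‖ ^ 2 ≤ ∑ _i : Fin d, (1 : ℝ) := by
        refine Finset.sum_le_sum fun i _ => ?_
        have h1 : (x - latVec k) i = x i - (⌊x i⌋ : ℝ) := by rw [hx i]; simp [latVec]
        have h2 := Int.floor_le (x i)
        have h3 := Int.lt_floor_add_one (x i)
        rw [h1, Real.norm_eq_abs, sq_abs]
        nlinarith
    _ = d := by simp

lemma norm_conj_mul_sub_le {a a' b b' x : ℂ} {α β : ℝ} (ha : ‖a - x * b‖ ≤ α)
    (ha' : ‖a' - x * b'‖ ≤ β) :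
    ‖conj a' * a - conj (x * b') * (x * b)‖ ≤ β * ‖a‖ + ‖x * b'‖ * α := by
  have h1 : conj a' * a - conj (x * b') * (x * b) =
      conj (a' - x * b') * a + conj (x * b') * (a - x * b) := by
    rw [map_sub]; ring
  rw [h1]
  refine (norm_add_le _ _).trans ?_
  rw [norm_mul, norm_mul, RCLike.norm_conj, RCLike.norm_conj]
  gcongr

lemma integral_conj_dilFun_mul {P : Matrix (Fin d) (Fin d) ℝ} (hP : P.det ≠ 0)
    (ψ h : Euc d → ℂ) (v : Euc d) :
    ∫ x, conj (dilFun P (fun y => ψ (y - v)) x) * h x =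
      ((sqrtAbsDet P)⁻¹ : ℂ) * ∫ y, conj (ψ y) * h (act P⁻¹ (y + v)) := by
  set F : Euc d → ℂ := fun y => conj (ψ (y - v)) * h (act P⁻¹ y) with hF
  have h1 : ∫ x, conj (dilFun P (fun y => ψ (y - v)) x) * h x =
      ∫ x, (sqrtAbsDet P : ℂ) * F (act P x) := by
    refine integral_congr_ae (Eventually.of_forall fun x => ?_)
    simp only [hF, dilFun, act_inv_act hP, map_mul, Complex.conj_ofReal]
    ring
  have h2 : ∫ y, F y = ∫ y, conj (ψ y) * h (act P⁻¹ (y + v)) := by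
    rw [← integral_add_right_eq_self F v]
    refine integral_congr_ae (Eventually.of_forall fun y => ?_)
    simp only [hF, add_sub_cancel_right]
  have h3 : (sqrtAbsDet P : ℂ) ≠ 0 := by
    rw [sqrtAbsDet]
    exact_mod_cast (Real.sqrt_pos.mpr (abs_pos.mpr hP)).ne'
  rw [h1, integral_const_mul, integral_comp_act hP, h2, Complex.real_smul, ← mul_assoc]
  congr 1
  rw [Complex.ofReal_inv, ← sqrtAbsDet_mul_self]
  field_simp

/-- Sampling: the pairing of a slowly varying `f` with a translate of `ψ` is close to the value of
`f` at the base point times the conjugate mean of `ψ`. -/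
lemma norm_integral_sub_le {ψ f : Euc d → ℂ} (hψ : Integrable ψ) {R ε : ℝ}
    (hR : ∀ᵐ x : Euc d, R < ‖x‖ → ψ x = 0) {v : Euc d} (hf : Continuous f) {H : ℝ}
    (hH : ∀ x, ‖f x‖ ≤ H) (hε : ∀ y, ‖y‖ ≤ R → ‖f (y + v) - f v‖ ≤ ε) :
    ‖(∫ y, conj (ψ y) * f (y + v)) - f v * conj (∫ y, ψ y)‖ ≤ ε * ∫ y, ‖ψ y‖ := by
  have hψc : Integrable fun y => conj (ψ y) := by
    simpa using (Complex.conjCLE.toContinuousLinearMap.integrable_comp hψ)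
  have h1 : Integrable fun y => conj (ψ y) * f (y + v) := by
    refine hψc.mul_bdd (c := H) ?_ (Eventually.of_forall fun y => hH _)
    exact (hf.comp (by fun_prop)).aestronglyMeasurable
  have h2 : (∫ y, conj (ψ y) * f (y + v)) - f v * conj (∫ y, ψ y) =
      ∫ y, conj (ψ y) * (f (y + v) - f v) := by
    simp only [mul_sub]
    rw [integral_sub h1 (hψc.mul_const _), integral_mul_const, integral_conj, mul_comm (f v)]
  rw [h2, ← integral_const_mul]
  refine norm_integral_le_of_norm_le (hψ.norm.const_mul ε) ?_
  filter_upwards [hR] with y hy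
  rw [norm_mul, RCLike.norm_conj, mul_comm]
  by_cases hlt : R < ‖y‖
  · simp [hy hlt]
  · gcongr
    exact hε y (not_lt.mp hlt)

lemma norm_integral_conj_mul_le {ψ f : Euc d → ℂ} (hψ : Integrable ψ) {H : ℝ}
    (hH : ∀ x, ‖f x‖ ≤ H) (v : Euc d) :
    ‖∫ y, conj (ψ y) * f (y + v)‖ ≤ H * ∫ y, ‖ψ y‖ := by
  rw [← integral_const_mul]
  refine norm_integral_le_of_norm_le (hψ.norm.const_mul H) (Eventually.of_forall fun y => ?_)
  rw [norm_mul, RCLike.norm_conj, mul_comm]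
  gcongr
  exact hH _

/-- Comparison of `∫ |f|²` with the sum of `⟨f, ψ'(· - k)⟩ ⟨ψ(· - k), f⟩` when `f` varies slowly:
by the normalization of the means, on each unit cube both are close to `|f(k)|²`. -/
lemma norm_integral_sub_sum_le {ψ ψ' : Fin r → Euc d → ℂ} (hψ : ∀ q, Integrable (ψ q))
    (hψ' : ∀ q, Integrable (ψ' q)) {R : ℝ} (hR : SuppRadius ψ R) (hR' : SuppRadius ψ' R)
    (hRd : Real.sqrt d ≤ R) (hnorm : ∑ q, conj (∫ y, ψ q y) * ∫ y, ψ' q y = 1)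
    {f : Euc d → ℂ} (hf : Continuous f) {H ε : ℝ} (hH : ∀ x, ‖f x‖ ≤ H)
    (hε : ∀ v y, ‖y‖ ≤ R → ‖f (y + v) - f v‖ ≤ ε) (S : Finset (ZLat d))
    (hS : ∀ x, f x ≠ 0 → ∃ k ∈ S, x ∈ cube k) :
    ‖(∫ x, ((‖f x‖ ^ 2 : ℝ) : ℂ)) - ∑ k ∈ S, ∑ q,
        conj (∫ y, conj (ψ' q y) * f (y + latVec k)) * ∫ y, conj (ψ q y) * f (y + latVec k)‖ ≤
      S.card * (ε * (2 * H + 2 * H * ∑ q, (∫ y, ‖ψ q y‖) * ∫ y, ‖ψ' q y‖)) := by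
  have hH0 : 0 ≤ H := (norm_nonneg _).trans (hH 0)
  have hε0 : 0 ≤ ε := (norm_nonneg _).trans
    (hε 0 0 (by rw [norm_zero]; exact (Real.sqrt_nonneg _).trans hRd))
  set G : Euc d → ℂ := fun x => ((‖f x‖ ^ 2 : ℝ) : ℂ) with hG
  have hGc : Continuous G := by fun_prop
  have hGH : ∀ x, ‖G x‖ ≤ H ^ 2 := fun x => by
    rw [hG, Complex.norm_real, norm_pow, norm_norm]
    exact pow_le_pow_left₀ (norm_nonneg _) (hH x) 2
  have hfin : ∀ k : ZLat d, volume (cube k) < ∞ := fun k => by simp [volume_cube]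
  have hint : ∀ k : ZLat d, IntegrableOn G (cube k) := fun k =>
    Measure.integrableOn_of_bounded (hfin k).ne hGc.aestronglyMeasurable
      (Eventually.of_forall hGH)
  have hsplit : ∫ x, G x = ∑ k ∈ S, ∫ x in cube k, G x := by
    rw [← integral_biUnion_finset S (fun k _ => measurableSet_cube k)
      (fun k _ l _ hkl => disjoint_cube hkl) (fun k _ => hint k)]
    refine (setIntegral_eq_integral_of_forall_compl_eq_zero fun x hx => ?_).symm
    by_contra h0
    have h1 : f x ≠ 0 := fun h1 => h0 (by simp [hG, h1])
    obtain ⟨k, hk, hxk⟩ := hS x h1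
    exact hx (Set.mem_biUnion hk hxk)
  have hcube : ∀ k : ZLat d, ‖(∫ x in cube k, G x) - G (latVec k)‖ ≤ ε * (2 * H) := by
    intro k
    have h1 : (∫ x in cube k, G x) - G (latVec k) = ∫ x in cube k, (G x - G (latVec k)) := by
      rw [integral_sub (hint k) (integrableOn_const (hfin k).ne), setIntegral_const]
      simp [measureReal_def, volume_cube]
    rw [h1]
    have h2 := norm_setIntegral_le_of_norm_le_const (C := ε * (2 * H)) (hfin k)
      (f := fun x => G x - G (latVec k)) fun x hx => by
        have h3 := hε (latVec k) (x - latVec k) ((norm_sub_latVec_le hx).trans hRd)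
        rw [sub_add_cancel] at h3
        rw [hG]
        simp only
        rw [← Complex.ofReal_sub, Complex.norm_real, sq_sub_sq, norm_mul, mul_comm]
        refine mul_le_mul ?_ ?_ (norm_nonneg _) hε0
        · exact (abs_norm_sub_norm_le _ _).trans h3
        · rw [Real.norm_of_nonneg (by positivity)]
          linarith [hH x, hH (latVec k)]
    simpa [measureReal_def, volume_cube] using h2
  have hsum : ∀ k : ZLat d, ‖G (latVec k) - ∑ q,
        conj (∫ y, conj (ψ' q y) * f (y + latVec k)) * ∫ y, conj (ψ q y) * f (y + latVec k)‖ ≤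
      ε * (2 * H * ∑ q, (∫ y, ‖ψ q y‖) * ∫ y, ‖ψ' q y‖) := by
    intro k
    have h1 : G (latVec k) = ∑ q, conj (f (latVec k) * conj (∫ y, ψ' q y)) *
        (f (latVec k) * conj (∫ y, ψ q y)) := by
      have h2 : ∀ q, conj (f (latVec k) * conj (∫ y, ψ' q y)) *
          (f (latVec k) * conj (∫ y, ψ q y)) =
          G (latVec k) * (conj (∫ y, ψ q y) * ∫ y, ψ' q y) := fun q => by
        simp only [hG]
        rw [map_mul, Complex.conj_conj, Complex.ofReal_pow, ← Complex.conj_mul']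
        ring
      simp_rw [h2]
      rw [← Finset.mul_sum, hnorm, mul_one]
    rw [h1, ← Finset.sum_sub_distrib, Finset.mul_sum, Finset.mul_sum]
    refine (norm_sum_le _ _).trans (Finset.sum_le_sum fun q _ => ?_)
    rw [norm_sub_rev]
    have h2 := norm_conj_mul_sub_le
      (norm_integral_sub_le (hψ q) (hR q) hf hH (hε (latVec k)))
      (norm_integral_sub_le (hψ' q) (hR' q) hf hH (hε (latVec k)))
    refine h2.trans ?_
    have h3 := norm_integral_conj_mul_le (hψ q) hH (latVec k)
    have h4 : ‖f (latVec k) * conj (∫ y, ψ' q y)‖ ≤ H * ∫ y, ‖ψ' q y‖ := by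
      rw [norm_mul, RCLike.norm_conj]
      exact mul_le_mul (hH _) (norm_integral_le_integral_norm _) (norm_nonneg _) hH0
    have h5 : 0 ≤ ∫ y, ‖ψ q y‖ := integral_nonneg fun _ => norm_nonneg _
    have h6 : 0 ≤ ∫ y, ‖ψ' q y‖ := integral_nonneg fun _ => norm_nonneg _
    calc _ ≤ (ε * ∫ y, ‖ψ' q y‖) * (H * ∫ y, ‖ψ q y‖) +
          (H * ∫ y, ‖ψ' q y‖) * (ε * ∫ y, ‖ψ q y‖) := by gcongr
      _ = _ := by ring
  rw [hsplit, ← Finset.sum_sub_distrib, ← nsmul_eq_mul, ← Finset.sum_const]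
  refine (norm_sum_le _ _).trans (Finset.sum_le_sum fun k _ => ?_)
  rw [mul_add]
  refine (norm_sub_le_norm_sub_add_norm_sub _ (G (latVec k)) _).trans ?_
  exact add_le_add (hcube k) (hsum k)

/-- The number of lattice points in a dilated ball is at most a constant times the determinant. -/
lemma card_mul_le {P : Matrix (Fin d) (Fin d) ℝ} (hP : P.det ≠ 0) {a : ℝ}
    (h1 : ∀ y : Euc d, ‖y‖ ≤ Real.sqrt d → ‖act P⁻¹ y‖ ≤ 1) (S : Finset (ZLat d))
    (hS : ∀ k ∈ S, ‖act P⁻¹ (latVec k)‖ ≤ a) :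
    |P.det|⁻¹ * S.card ≤ volume.real (Metric.closedBall (0 : Euc d) (a + 1)) := by
  have hP' : P⁻¹.det ≠ 0 := by
    rw [Matrix.det_nonsing_inv, Ring.inverse_eq_inv']
    exact inv_ne_zero hP
  have hsub : (⋃ k ∈ S, cube k) ⊆ act P⁻¹ ⁻¹' Metric.closedBall (0 : Euc d) (a + 1) := by
    refine Set.iUnion₂_subset fun k hk x hx => ?_
    rw [Set.mem_preimage, mem_closedBall_zero_iff]
    have h2 : act P⁻¹ x = act P⁻¹ (latVec k) + act P⁻¹ (x - latVec k) := by
      rw [← act_add, add_sub_cancel]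
    rw [h2]
    exact (norm_add_le _ _).trans (add_le_add (hS k hk) (h1 _ (norm_sub_latVec_le hx)))
  have hvol : volume (act P⁻¹ ⁻¹' Metric.closedBall (0 : Euc d) (a + 1)) =
      ENNReal.ofReal |P.det| * volume (Metric.closedBall (0 : Euc d) (a + 1)) := by
    rw [← Measure.map_apply (continuous_act _).measurable Metric.isClosed_closedBall.measurableSet,
      map_act hP', Matrix.det_nonsing_inv, Ring.inverse_eq_inv', inv_inv]
    rfl
  have hcard : (S.card : ℝ≥0∞) ≤
      ENNReal.ofReal |P.det| * volume (Metric.closedBall (0 : Euc d) (a + 1)) := by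
    rw [← hvol]
    refine le_trans (le_of_eq ?_) (measure_mono hsub)
    rw [measure_biUnion_finset (fun k _ l _ hkl => disjoint_cube hkl)
      (fun k _ => measurableSet_cube k)]
    simp [volume_cube]
  have h3 := ENNReal.toReal_mono (ENNReal.mul_ne_top ENNReal.ofReal_ne_top
    measure_closedBall_lt_top.ne) hcard
  rw [ENNReal.toReal_mul, ENNReal.toReal_ofReal (abs_nonneg _), ENNReal.toReal_natCast] at h3
  rw [inv_mul_le_iff₀ (abs_pos.mpr hP)]
  exact h3

/-- A quasi-projection property: at fine scales, the sum of `⟨f, Dᴶe'ₖ⟩ ⟨Dᴶeₖ, f⟩` over a suitable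
finite set of indices recovers `‖f‖²`, for continuous compactly supported `f`. -/
lemma exists_norm_sq_sub_sum_le (hd : 0 < d) {M : Matrix (Fin d) (Fin d) ℤ} (hM : IsDilation M)
    {ψ ψ' : Fin r → Euc d → ℂ} (hψ : ∀ q, MemLp (ψ q) 2 volume)
    (hψ' : ∀ q, MemLp (ψ' q) 2 volume) {R : ℝ} (hR : SuppRadius ψ R) (hR' : SuppRadius ψ' R)
    (hRd : Real.sqrt d ≤ R) (hnorm : ∑ q, conj (∫ y, ψ q y) * ∫ y, ψ' q y = 1)
    {f : Euc d → ℂ} (hf : Continuous f) (hfs : HasCompactSupport f) (hfL : MemLp f 2 volume)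
    {η : ℝ} (hη : 0 < η) :
    ∃ (J : ℕ) (F : Finset (Fin r × ZLat d)), ‖hfL.toLp f‖ ^ 2 ≤
      ‖∑ i ∈ F, conj (inner ℂ ((dilOp (realMat M) hM.det_realMat_ne_zero ^ J) (shifts hψ' i))
          (hfL.toLp f)) * inner ℂ ((dilOp (realMat M) hM.det_realMat_ne_zero ^ J) (shifts hψ i))
          (hfL.toLp f)‖ + η := by
  classical
  obtain ⟨H, hH⟩ : ∃ H : ℝ, ∀ x, ‖f x‖ ≤ H := hf.bounded_above_of_compact_support hfs
  have hH0 : 0 ≤ H := (norm_nonneg _).trans (hH 0)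
  obtain ⟨R₀, hR₀⟩ : ∃ R₀ : ℝ, ∀ x, f x ≠ 0 → ‖x‖ ≤ R₀ := by
    obtain ⟨R₀, h⟩ := hfs.isCompact.isBounded.exists_norm_le
    exact ⟨R₀, fun x hx => h x (subset_tsupport f hx)⟩
  set C : ℝ := 2 * H + 2 * H * ∑ q, (∫ y, ‖ψ q y‖) * ∫ y, ‖ψ' q y‖ with hC
  have hC0 : 0 ≤ C := by
    have : 0 ≤ ∑ q, (∫ y, ‖ψ q y‖) * ∫ y, ‖ψ' q y‖ := Finset.sum_nonneg fun q _ =>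
      mul_nonneg (integral_nonneg fun _ => norm_nonneg _) (integral_nonneg fun _ => norm_nonneg _)
    positivity
  set V : ℝ := volume.real (Metric.closedBall (0 : Euc d) (R₀ + 1 + 1)) with hV
  have hV0 : 0 ≤ V := measureReal_nonneg
  set ε : ℝ := η / (V * C + 1) with hε
  have hε0 : 0 < ε := by positivity
  obtain ⟨δ, hδ0, hδ⟩ := Metric.uniformContinuous_iff.mp
    (hfs.uniformContinuous_of_continuous hf) ε hε0
  have hm : 0 < min (δ / 2) 1 := by positivity
  obtain ⟨J, hJ⟩ := (hM.eventually_norm_act_le hd R hm).exists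
  set P := realMat M ^ J with hPdef
  have hP : P.det ≠ 0 := det_pow_ne_zero hM.det_realMat_ne_zero J
  have hP' : P⁻¹.det ≠ 0 := by
    rw [Matrix.det_nonsing_inv, Ring.inverse_eq_inv']
    exact inv_ne_zero hP
  set g : Euc d → ℂ := fun y => f (act P⁻¹ y) with hg
  have hgc : Continuous g := hf.comp (continuous_act _)
  have hgH : ∀ x, ‖g x‖ ≤ H := fun x => hH _
  have hgε : ∀ v y, ‖y‖ ≤ R → ‖g (y + v) - g v‖ ≤ ε := by
    intro v y hy
    rw [← dist_eq_norm]
    refine (hδ ?_).le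
    rw [dist_eq_norm, act_add, add_sub_cancel_right]
    have := (hJ y hy).trans (min_le_left _ _)
    linarith
  -- the lattice points whose unit cubes meet the support of `g`
  have hSfin : {k : ZLat d | ‖act P⁻¹ (latVec k)‖ ≤ R₀ + 1}.Finite := by
    obtain ⟨R₁, hR₁⟩ := ((isCompact_closedBall (0 : Euc d) (R₀ + 1)).image
      (continuous_act P)).isBounded.exists_norm_le
    refine (finite_latVec_norm_le R₁).subset fun k hk => ?_
    rw [Set.mem_ofPred_eq, ← act_act_inv hP (latVec k)]
    exact hR₁ _ ⟨_, mem_closedBall_zero_iff.mpr hk, rfl⟩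
  set S := hSfin.toFinset with hSdef
  have hunit : ∀ y : Euc d, ‖y‖ ≤ Real.sqrt d → ‖act P⁻¹ y‖ ≤ 1 := fun y hy =>
    (hJ y (hy.trans hRd)).trans (min_le_right _ _)
  have hS : ∀ x, g x ≠ 0 → ∃ k ∈ S, x ∈ cube k := by
    intro x hx
    have hxk : x ∈ cube (fun i => ⌊x i⌋ : ZLat d) := fun i => rfl
    refine ⟨_, ?_, hxk⟩
    rw [hSdef, Set.Finite.mem_toFinset, Set.mem_ofPred_eq]
    have h1 := hR₀ _ hx
    have h2 := hunit _ (norm_sub_latVec_le hxk)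
    rw [act_sub] at h2
    linarith [norm_le_norm_add_norm_sub (act P⁻¹ x) (act P⁻¹ (latVec fun i => ⌊x i⌋))]
  have hcard := card_mul_le hP hunit S (a := R₀ + 1) fun k hk => by
    simpa [hSdef] using hk
  have hmain := norm_integral_sub_sum_le (integrable_of_suppRadius hψ hR)
    (integrable_of_suppRadius hψ' hR') hR hR' hRd hnorm hgc hgH hgε S hS
  refine ⟨J, Finset.univ ×ˢ S, ?_⟩
  have hinner : ∀ {φ : Fin r → Euc d → ℂ} (hφ : ∀ q, MemLp (φ q) 2 volume) q k,
      inner ℂ ((dilOp (realMat M) hM.det_realMat_ne_zero ^ J) (shifts hφ (q, k))) (hfL.toLp f) =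
        ((sqrtAbsDet P)⁻¹ : ℂ) * ∫ y, conj (φ q y) * g (y + latVec k) := by
    intro φ hφ q k
    rw [shifts, dilOp_pow_toLp, inner_toLp]
    exact integral_conj_dilFun_mul hP _ _ _
  have hsq : (‖hfL.toLp f‖ ^ 2 : ℝ) = |P.det|⁻¹ * ‖∫ x, ((‖g x‖ ^ 2 : ℝ) : ℂ)‖ := by
    have h1 : ((‖hfL.toLp f‖ ^ 2 : ℝ) : ℂ) = ∫ x, ((‖f x‖ ^ 2 : ℝ) : ℂ) := by
      have h2 := inner_self_eq_norm_sq_to_K (𝕜 := ℂ) (hfL.toLp f)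
      rw [inner_toLp] at h2
      rw [Complex.ofReal_pow]
      refine h2.symm.trans (integral_congr_ae (Eventually.of_forall fun x => ?_))
      simp only
      rw [Complex.conj_mul', Complex.ofReal_pow]
    have h2 := integral_comp_act hP' fun x => ((‖f x‖ ^ 2 : ℝ) : ℂ)
    rw [Matrix.det_nonsing_inv, Ring.inverse_eq_inv', abs_inv, inv_inv] at h2
    rw [show (∫ x, ((‖g x‖ ^ 2 : ℝ) : ℂ)) = |P.det| • ∫ x, ((‖f x‖ ^ 2 : ℝ) : ℂ) from h2, ← h1,
      norm_smul, Real.norm_of_nonneg (abs_nonneg _), ← mul_assoc,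
      inv_mul_cancel₀ (abs_pos.mpr hP).ne', one_mul, Complex.norm_real,
      Real.norm_of_nonneg (by positivity)]
  have hsum : ∑ i ∈ Finset.univ ×ˢ S,
      conj (inner ℂ ((dilOp (realMat M) hM.det_realMat_ne_zero ^ J) (shifts hψ' i))
          (hfL.toLp f)) * inner ℂ ((dilOp (realMat M) hM.det_realMat_ne_zero ^ J) (shifts hψ i))
          (hfL.toLp f) =
      ((|P.det|⁻¹ : ℝ) : ℂ) * ∑ k ∈ S, ∑ q, conj (∫ y, conj (ψ' q y) * g (y + latVec k)) *
        ∫ y, conj (ψ q y) * g (y + latVec k) := by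
    rw [Finset.sum_product_right, Finset.mul_sum]
    refine Finset.sum_congr rfl fun k _ => ?_
    rw [Finset.mul_sum]
    refine Finset.sum_congr rfl fun q _ => ?_
    rw [hinner hψ', hinner hψ, map_mul, map_inv₀, Complex.conj_ofReal, Complex.ofReal_inv,
      ← sqrtAbsDet_mul_self, mul_inv]
    ring
  rw [hsum, norm_mul, Complex.norm_real, Real.norm_of_nonneg (by positivity), hsq]
  have hdet : 0 ≤ |P.det|⁻¹ := by positivity
  have h1 := mul_le_mul_of_nonneg_left ((norm_sub_norm_le _ _).trans hmain) hdet
  have h2 : |P.det|⁻¹ * (S.card * (ε * C)) ≤ η := by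
    calc |P.det|⁻¹ * (S.card * (ε * C)) = |P.det|⁻¹ * S.card * (ε * C) := by ring
      _ ≤ V * (ε * C) := by gcongr
      _ = η * ((V * C) / (V * C + 1)) := by rw [hε]; ring
      _ ≤ η * 1 := by
        gcongr
        rw [div_le_one (by positivity)]
        linarith
      _ = η := mul_one _
  rw [mul_sub] at h1
  linarith

lemma norm_sum_conj_mul_le {K : Type*} (F : Finset K) {a b : K → ℂ} {A B : ℝ≥0∞}
    (ha : nsq a ≤ A) (hb : nsq b ≤ B) :
    ‖∑ i ∈ F, conj (a i) * b i‖ₑ ^ 2 ≤ A * B := by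
  have h0 : ‖∑ i ∈ F, conj (a i) * b i‖ ≤ ∑ i ∈ F, ‖a i‖ * ‖b i‖ := by
    refine (norm_sum_le _ _).trans (le_of_eq (Finset.sum_congr rfl fun i _ => ?_))
    rw [norm_mul, RCLike.norm_conj]
  have h1 : ‖∑ i ∈ F, conj (a i) * b i‖ ^ 2 ≤ (∑ i ∈ F, ‖a i‖ ^ 2) * ∑ i ∈ F, ‖b i‖ ^ 2 :=
    (pow_le_pow_left₀ (norm_nonneg _) h0 2).trans (Finset.sum_mul_sq_le_sq_mul_sq F _ _)
  have h2 : ∀ c : K → ℂ, ENNReal.ofReal (∑ i ∈ F, ‖c i‖ ^ 2) ≤ nsq c := fun c => by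
    rw [ENNReal.ofReal_sum_of_nonneg fun i _ => by positivity]
    simp_rw [← enorm_sq_eq_ofReal]
    exact ENNReal.sum_le_tsum F
  rw [enorm_sq_eq_ofReal]
  refine (ENNReal.ofReal_le_ofReal h1).trans ?_
  rw [ENNReal.ofReal_mul (Finset.sum_nonneg fun i _ => by positivity)]
  exact mul_le_mul' ((h2 a).trans ha) ((h2 b).trans hb)

/-- The functions `Dᴶ eₖ` span a dense subspace of `L₂(ℝ^d)`. -/
lemma eq_zero_of_inner_dilOp_shifts_eq_zero (hd : 0 < d) {M : Matrix (Fin d) (Fin d) ℤ}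
    (hM : IsDilation M) {ψ ψ' : Fin r → Euc d → ℂ} (hψ : ∀ q, MemLp (ψ q) 2 volume)
    (hψ' : ∀ q, MemLp (ψ' q) 2 volume) (hs : ∀ q, EssCompactSupport (ψ q))
    (hs' : ∀ q, EssCompactSupport (ψ' q)) (hnorm : ∑ q, conj (∫ y, ψ q y) * ∫ y, ψ' q y = 1)
    (g : L2 d) (hg : ∀ J m,
      inner ℂ ((dilOp (realMat M) hM.det_realMat_ne_zero ^ J) (shifts hψ m)) g = 0) : g = 0 := by
  obtain ⟨B, hB⟩ := exists_isBessel_shifts hψ hs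
  obtain ⟨B', hB'⟩ := exists_isBessel_shifts hψ' hs'
  obtain ⟨R₁, -, h1⟩ := exists_suppRadius hs
  obtain ⟨R₂, -, h2⟩ := exists_suppRadius hs'
  set R := max (Real.sqrt d) (max R₁ R₂) with hRdef
  have hR : SuppRadius ψ R := fun q => by
    filter_upwards [h1 q] with x hx hlt
    exact hx (lt_of_le_of_lt ((le_max_left _ _).trans (le_max_right _ _)) hlt)
  have hR' : SuppRadius ψ' R := fun q => by
    filter_upwards [h2 q] with x hx hlt
    exact hx (lt_of_le_of_lt ((le_max_right _ _).trans (le_max_right _ _)) hlt)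
  -- the key estimate for continuous compactly supported functions
  set C : ℝ := Real.sqrt (B * B') with hC
  have key : ∀ {f : Euc d → ℂ} (_ : Continuous f) (_ : HasCompactSupport f)
      (hfL : MemLp f 2 volume), ‖hfL.toLp f‖ ≤ C * ‖hfL.toLp f - g‖ := by
    intro f hf hfs hfL
    set u := hfL.toLp f with hu
    have h3 : ‖u‖ ^ 2 ≤ ‖u‖ * (C * ‖u - g‖) := by
      refine le_of_forall_pos_le_add fun η hη => ?_
      obtain ⟨J, F, hJF⟩ := exists_norm_sq_sub_sum_le hd hM hψ hψ' hR hR' (le_max_left _ _) hnorm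
        hf hfs hfL hη
      refine hJF.trans (add_le_add_left ?_ η)
      have h4 : ∀ i, inner ℂ ((dilOp (realMat M) hM.det_realMat_ne_zero ^ J) (shifts hψ i)) u =
          inner ℂ ((dilOp (realMat M) hM.det_realMat_ne_zero ^ J) (shifts hψ i)) (u - g) :=
        fun i => by rw [inner_sub_right, hg, sub_zero]
      simp_rw [← hu, h4]
      have h5 := norm_sum_conj_mul_le F
        ((hB'.isometry (dilOp (realMat M) hM.det_realMat_ne_zero ^ J)).nsq_inner_le u)
        ((hB.isometry (dilOp (realMat M) hM.det_realMat_ne_zero ^ J)).nsq_inner_le (u - g))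
      simp_rw [enorm_sq_eq_ofReal] at h5
      have h6 := ENNReal.toReal_mono (by finiteness) h5
      rw [ENNReal.toReal_mul, ENNReal.toReal_mul, ENNReal.toReal_mul,
        ENNReal.toReal_ofReal (by positivity), ENNReal.toReal_ofReal (by positivity),
        ENNReal.toReal_ofReal (by positivity), ENNReal.coe_toReal, ENNReal.coe_toReal] at h6
      refine abs_le_of_sq_le_sq' ?_ (by positivity) |>.2
      refine h6.trans (le_of_eq ?_)
      rw [mul_pow, mul_pow, hC, Real.sq_sqrt (by positivity)]
      ring
    rcases (norm_nonneg u).eq_or_lt with h4 | h4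
    · rw [← h4]; positivity
    · rw [sq] at h3
      exact le_of_mul_le_mul_left h3 h4
  rw [← norm_le_zero_iff]
  refine le_of_forall_pos_le_add fun ε hε => ?_
  have hδ : 0 < ε / (C + 1) := by positivity
  obtain ⟨f, hfs, hfg, hf, hfL⟩ := (Lp.memLp g).exists_hasCompactSupport_eLpNorm_sub_le
    (by simp) (ENNReal.ofReal_pos.mpr hδ).ne'
  have h3 : ‖hfL.toLp f - g‖ ≤ ε / (C + 1) := by
    rw [norm_sub_rev, Lp.norm_def]
    refine ENNReal.toReal_le_of_le_ofReal hδ.le (le_trans (le_of_eq (eLpNorm_congr_ae ?_)) hfg)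
    exact (Lp.coeFn_sub _ _).trans ((EventuallyEq.refl _ _).sub hfL.coeFn_toLp)
  calc ‖g‖ ≤ ‖hfL.toLp f‖ + ‖hfL.toLp f - g‖ := by
        rw [norm_sub_rev]; exact norm_le_norm_add_norm_sub' _ _
    _ ≤ C * ‖hfL.toLp f - g‖ + ‖hfL.toLp f - g‖ := by gcongr; exact key hf hfs hfL
    _ = (C + 1) * ‖hfL.toLp f - g‖ := by ring
    _ ≤ (C + 1) * (ε / (C + 1)) := by gcongr
    _ = 0 + ε := by
        rw [mul_div_cancel₀ _ (by positivity), zero_add]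

/-! ### The affine system as a two-scale system -/

/-- The family `|det(M₀⁻¹Mₗ)|^{1/2} ψˡ(· - M₀⁻¹ Mₗ k)` of high-pass generators at scale zero. -/
def highShifts (M : Dilations d s) {ψ : Fin s → Euc d → ℂ} (hψ : ∀ l, MemLp (ψ l) 2 volume) :
    Fin s × ZLat d → L2 d :=
  fun i => ((memLp_sub_right (hψ i.1)
    (act ((realMat (M 0))⁻¹ * realMat (M i.1.succ)) (latVec i.2))).const_mul
      (sqrtAbsDet ((realMat (M 0))⁻¹ * realMat (M i.1.succ)) : ℂ)).toLp _

/-- Reordering of the indices of the affine system. -/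
def affineIndexEquiv (d r s : ℕ) : (Fin r × ZLat d) ⊕ (Fin s × ℕ × ZLat d) ≃
    (Fin r × ZLat d) ⊕ (ℕ × (Fin s × ZLat d)) :=
  Equiv.sumCongr (Equiv.refl _)
    ⟨fun i => (i.2.1, i.1, i.2.2), fun i => (i.2.1, i.1, i.2.2), fun _ => rfl, fun _ => rfl⟩

lemma dilFun_high_eq (M : Dilations d s) (ψ₀ : Fin r → Euc d → ℂ) (ψ : Fin s → Euc d → ℂ)
    (l : Fin s) (j : ℕ) (k : ZLat d) :
    affineSystem M ψ₀ ψ (Sum.inr (l, j, k)) = dilFun (realMat (M 0) ^ j)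
      fun x => (sqrtAbsDet ((realMat (M 0))⁻¹ * realMat (M l.succ)) : ℂ) *
        ψ l (x - act ((realMat (M 0))⁻¹ * realMat (M l.succ)) (latVec k)) := by
  funext x
  simp only [affineSystem, dilate, dilFun]
  ring

lemma memLp_affineSystem {M : Dilations d s} (hM : IsDilation (M 0)) {ψ₀ : Fin r → Euc d → ℂ}
    {ψ : Fin s → Euc d → ℂ} (hψ₀ : ∀ q, MemLp (ψ₀ q) 2 volume) (hψ : ∀ l, MemLp (ψ l) 2 volume)
    (i : (Fin r × ZLat d) ⊕ (Fin s × ℕ × ZLat d)) : MemLp (affineSystem M ψ₀ ψ i) 2 volume := by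
  match i with
  | .inl (q, k) => exact memLp_sub_right (hψ₀ q) _
  | .inr (l, j, k) =>
    rw [dilFun_high_eq]
    exact memLp_dilFun (det_pow_ne_zero hM.det_realMat_ne_zero j)
      ((memLp_sub_right (hψ l) _).const_mul _)

lemma toLp_affineSystem {M : Dilations d s} (hM : IsDilation (M 0)) {ψ₀ : Fin r → Euc d → ℂ}
    {ψ : Fin s → Euc d → ℂ} (hψ₀ : ∀ q, MemLp (ψ₀ q) 2 volume) (hψ : ∀ l, MemLp (ψ l) 2 volume)
    (h : ∀ i, MemLp (affineSystem M ψ₀ ψ i) 2 volume) :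
    (fun i => (h i).toLp _) = system (dilOp (realMat (M 0)) hM.det_realMat_ne_zero) (shifts hψ₀)
      (highShifts M hψ) ∘ affineIndexEquiv d r s := by
  funext i
  match i with
  | .inl (q, k) => rfl
  | .inr (l, j, k) =>
    refine Eq.trans ?_ (dilOp_pow_toLp hM.det_realMat_ne_zero _ j).symm
    exact MemLp.toLp_congr _ _ (Eventually.of_forall fun x => congrFun (dilFun_high_eq ..) x)

lemma isBiorthogonalWavelet_iff {M : Dilations d s} (hM : IsDilation (M 0))
    {ψ₀ ψ₀' : Fin r → Euc d → ℂ} {ψ ψ' : Fin s → Euc d → ℂ} (hψ₀ : ∀ q, MemLp (ψ₀ q) 2 volume)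
    (hψ₀' : ∀ q, MemLp (ψ₀' q) 2 volume) (hψ : ∀ l, MemLp (ψ l) 2 volume)
    (hψ' : ∀ l, MemLp (ψ' l) 2 volume) :
    IsBiorthogonalWavelet M ψ₀ ψ ψ₀' ψ' ↔ AreBiorthogonalBases
      (system (dilOp (realMat (M 0)) hM.det_realMat_ne_zero) (shifts hψ₀) (highShifts M hψ))
      (system (dilOp (realMat (M 0)) hM.det_realMat_ne_zero) (shifts hψ₀') (highShifts M hψ')) := by
  constructor
  · rintro ⟨h, h', hb⟩
    rw [toLp_affineSystem hM hψ₀ hψ, toLp_affineSystem hM hψ₀' hψ'] at hb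
    have := hb.comp_equiv (affineIndexEquiv d r s).symm
    simpa only [Function.comp_assoc, Equiv.self_comp_symm, Function.comp_id] using this
  · intro hb
    refine ⟨memLp_affineSystem hM hψ₀ hψ, memLp_affineSystem hM hψ₀' hψ', ?_⟩
    rw [toLp_affineSystem hM hψ₀ hψ, toLp_affineSystem hM hψ₀' hψ']
    exact hb.comp_equiv _

lemma twoScale_shifts {M : Dilations d s} (hM : IsDilation (M 0)) (B : FilterBank d r s)
    {ψ₀ : Fin r → Euc d → ℂ} {ψ : Fin s → Euc d → ℂ} (hψ₀ : ∀ q, MemLp (ψ₀ q) 2 volume)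
    (hs : ∀ q, EssCompactSupport (ψ₀ q))
    (href : ∀ ξ, ftVec ψ₀ (act (realMat (M 0))ᵀ ξ) = fourierSeries B.low ξ *ᵥ ftVec ψ₀ ξ)
    (hψ : ∀ l, MemLp (ψ l) 2 volume) (hgen : AreGeneratedBy (M 0) B.high ψ₀ ψ) :
    TwoScale (dilOp (realMat (M 0)) hM.det_realMat_ne_zero) (bankCoeff M B) (shifts hψ₀)
      (highShifts M hψ) := by
  obtain ⟨R, -, hR⟩ := exists_suppRadius hs
  have hA := hM.det_realMat_ne_zero
  constructor
  · rintro ⟨p, k⟩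
    have h1 := two_scale_of_ftL2 hψ₀ hR hA B.low p (hψ₀ p) (by
      filter_upwards [ftL2_toLp_ae (integrable_of_suppRadius hψ₀ hR p) (hψ₀ p)] with ξ hξ
      have hT : (realMat (M 0))ᵀ.det ≠ 0 := by rwa [Matrix.det_transpose]
      rw [hξ, ← href, act_act_inv hT]
      rfl)
    have h2 : (realMat (M 0))⁻¹ * realMat (M 0) = 1 := Matrix.nonsing_inv_mul _ hA.isUnit
    refine Eq.trans ?_ (toLp_eq_dilOp_lc hψ₀ hA B.low p h1 (M 0) k
      ((memLp_sub_right (hψ₀ p) _).const_mul _))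
    refine MemLp.toLp_congr _ _ (Eventually.of_forall fun x => ?_)
    simp [h2, act_one, sqrtAbsDet]
  · rintro ⟨l, k⟩
    obtain ⟨hl, h1⟩ := hgen l
    exact toLp_eq_dilOp_lc hψ₀ hA (B.high l) 0 (two_scale_of_ftL2 hψ₀ hR hA (B.high l) 0 hl h1)
      (M l.succ) k _

lemma sum_conj_integral_mul_integral {ψ ψ' : Fin r → Euc d → ℂ}
    (h : star (ftVec ψ 0) ⬝ᵥ ftVec ψ' 0 = 1) :
    ∑ q, conj (∫ y, ψ q y) * ∫ y, ψ' q y = 1 := by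
  simpa [ftVec, dotProduct] using h

end

end MixedWavelet

theorem mainTheorem2 {d r s : ℕ} (hd : 0 < d)
    (M : Dilations d s) (hM : ∀ l, IsDilation (M l))
    (B B' : FilterBank d r s)
    (ψ₀ ψ₀' : Fin r → Euc d → ℂ) (ψ ψ' : Fin s → Euc d → ℂ)
    (hst : IsStandardRefinable (M 0) B.low ψ₀)
    (hst' : IsStandardRefinable (M 0) B'.low ψ₀')
    (href : ∀ ξ, ftVec ψ₀ (act (realMat (M 0))ᵀ ξ) = fourierSeries B.low ξ *ᵥ ftVec ψ₀ ξ)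
    (href' : ∀ ξ, ftVec ψ₀' (act (realMat (M 0))ᵀ ξ) = fourierSeries B'.low ξ *ᵥ ftVec ψ₀' ξ)
    (hnorm : star (ftVec ψ₀ 0) ⬝ᵥ ftVec ψ₀' 0 = 1)
    (hψ : AreGeneratedBy (M 0) B.high ψ₀ ψ)
    (hψ' : AreGeneratedBy (M 0) B'.high ψ₀' ψ') :
    ((IsBiorthogonalWaveletFilterBank M B B' ∧
        (HasStability M B ∧ HasStability M B') ∧
        (∀ k : ZLat d, innerMat ψ₀' (fun q x => ψ₀ q (x - latVec k)) = if k = 0 then 1 else 0)) →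
      IsBiorthogonalWavelet M ψ₀ ψ ψ₀' ψ') ∧
    (IsBiorthogonalWavelet M ψ₀ ψ ψ₀' ψ' →
      (∃ C : ℝ, 0 < C ∧ BracketLowerBound ψ₀ C ∧ BracketLowerBound ψ₀' C) →
      (IsBiorthogonalWaveletFilterBank M B B' ∧
        (HasStability M B ∧ HasStability M B') ∧
        (∀ k : ZLat d, innerMat ψ₀' (fun q x => ψ₀ q (x - latVec k)) =
          if k = 0 then 1 else 0))) := by
  have hL := hst.1
  have hL' := hst'.1
  have hH : ∀ l, MemLp (ψ l) 2 volume := fun l => (hψ l).1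
  have hH' : ∀ l, MemLp (ψ' l) 2 volume := fun l => (hψ' l).1
  have ht := twoScale_shifts (hM 0) B hL hst.2.1 href hH hψ
  have ht' := twoScale_shifts (hM 0) B' hL' hst'.2.1 href' hH' hψ'
  obtain ⟨C, hC⟩ := exists_isBessel_shifts hL hst.2.1
  obtain ⟨C', hC'⟩ := exists_isBessel_shifts hL' hst'.2.1
  have hb := colFinite_bankCoeff hM B
  have hb' := colFinite_bankCoeff hM B'
  have hmean := sum_conj_integral_mul_integral hnorm
  have hmean' : ∑ q, conj (∫ y, ψ₀' q y) * ∫ y, ψ₀ q y = 1 := by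
    have := congrArg conj hmean
    rw [map_sum, map_one] at this
    rw [← this]
    exact Finset.sum_congr rfl fun q _ => by rw [map_mul, Complex.conj_conj, mul_comm]
  rw [isBiorthogonalWavelet_iff (hM 0) hL hL' hH hH']
  refine ⟨?_, fun h _ => ?_⟩
  · rintro ⟨⟨-, hsyn, hana⟩, ⟨hstab, hstab'⟩, hbi⟩
    exact areBiorthogonalBases_system ht ht' hb hb' ((anaSyn_bankCoeff_iff hM B B').mpr hana)
      ((synAna_bankCoeff_iff hM B B').mpr hsyn) ((hasStability_iff M B).mp hstab)
      ((hasStability_iff M B').mp hstab') ((biorth_shifts_iff hL hL').mpr hbi) hC hC'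
      (eq_zero_of_inner_dilOp_shifts_eq_zero hd (hM 0) hL hL' hst.2.1 hst'.2.1 hmean)
      (eq_zero_of_inner_dilOp_shifts_eq_zero hd (hM 0) hL' hL hst'.2.1 hst.2.1 hmean')
  · obtain ⟨hbi, hA, hS, hstab, hstab'⟩ := bank_of_areBiorthogonalBases ht ht' hb hC hC' h
    exact ⟨⟨isDualFrameletFilterBank_of_synAna hM hS, (synAna_bankCoeff_iff hM B B').mp hS,
      (anaSyn_bankCoeff_iff hM B B').mp hA⟩, ⟨(hasStability_iff M B).mpr hstab,
      (hasStability_iff M B').mpr hstab'⟩, (biorth_shifts_iff hL hL').mp hbi⟩
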